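/- Let $X$ be a standard Borel space with an atomless probability measure $m$. Let $G=SL(2,\mathbb R)$, written as matrices $g=\begin{pmatrix}\alpha&\beta\\ \gamma&\delta\end{pmatrix}$, and let $P\subset G$ be the subgroup $\beta=0$ of lower triangular matrices $(\varepsilon,\gamma)=\begin{pmatrix}\varepsilon^{-1}&0\\ \gamma&\varepsilon\end{pmatrix}$. Let $G^X$ and $P^X$ be the groups of bounded measurable maps $X\to G$, $X\to P$ with pointwise multiplication. Let $L$ be the upper half-plane with the action $gz=\frac{\delta z+\gamma}{\beta z+\alpha}$, and let $L^X$ be the set of measurable maps $z:X\to L$ that are bounded for the hyperbolic metric; $G^X$ acts on $L^X$ pointwise. **The measure.** Let $\mathcal L$ be the infinite-dimensional Lebesgue measure on the cone $l^1_+(X)$ of the measures $\xi=\sum_k r_k\delta_{x_k}$ with $r_k>0$, $\sum_k r_k<\infty$, written $\xi=\{r_k,x_k\}$. It is $d\mathcal L(\xi)=e^{\sum_k r_k}\,d\Gamma(\xi)$, where $\Gamma$ is the law of the gamma process, whose points $(r_k,x_k)$ form a Poisson process with intensity $r^{-1}e^{-r}\,dr\,dm(x)$. **The integral model.** Let $H^0=\{(f,\bar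 f):f\in\mathbb C\}$ be the two-dimensional real Hilbert space with the norm $\|(f,\bar f)\|^2=2|f|^2$, and let $h=2^{-1/2}(1,1)$. For $\xi=\{r_k,x_k\}$ let $H^0_\xi=\bigotimes_k H^0$ be the real countable tensor product, over the points of $\xi$, with stabilizing vector $h$. Let $\mathrm{INT}\,H^0=\int^\oplus H^0_\xi\,d\mathcal L(\xi)$. The representation $\mathrm{INT}\,T^0$ of $P^X$ in $\mathrm{INT}\,H^0$ is given by the following formulas, while $(\pm1,0)$-valued currents act identically: $$(U(1,\gamma)F)(\xi)=\Big(\bigotimes_k T^0_{r_k}(\gamma(x_k))\Big)F(\xi),\qquad T^0_r(\gamma)(f,\bar f)=(e^{ir^2\gamma}f,e^{-ir^2\gamma}\bar f),$$ $$(U(a,0)F)(\xi)=e^{\frac12\int_X\log a\,dm}\,F(a\xi)\quad(a>0),\qquad a\xi=\{a(x_k)r_k,x_k\}.$$ **The operators.** For $z\in L^X$ put $$F^0_z(\xi)=\bigotimes_k 2^{-1/2}\big(e^{ir_k^2z(x_k)},e^{-ir_k^2\overline{z(x_k)}}\big).$$ Put $c(z_1,z_2)=\log(-i(z_1-\bar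 z_2))$, $z_0=i$, and $$u(g,z)=c(gz,gz_0)-c(z,z_0)-\tfrac12\big(c(gz_0,gz_0)-c(z_0,z_0)\big).$$ For $g\in G^X$ define $$U^0(g)F^0_z=e^{\frac12\mathrm{Re}\int_X u(g(x),z(x))\,dm(x)}\,F^0_{gz}.\qquad(*)$$ **The Fock representation.** The special orthogonal representation $T$ of $G$ acts in the real Hilbert space $A^2(L)$ that underlies the space of square-integrable (with respect to area $du\,dv$) holomorphic functions on $L$, by $(T(g)f)(w)=f(g^{-1}w)\,(g^{-1})'(w)$. It has the nontrivial $1$-cocycle $$b(g)(w)=\frac1{\sqrt{2\pi}}\Big(\frac1{w-\overline{gi}}-\frac1{w+i}\Big),$$ which is normalized so that $\|b(g)\|^2=\log\cosh\big(\tfrac12\,d(gi,i)\big)$, where $d$ is the hyperbolic distance. Let $\mathcal H^X=L^2(X,m;A^2(L))$, with the pointwise extensions $T^X$ and $b^X$ of $T$ and $b$ to $G^X$. Let $\mathrm{EXP}\,\mathcal H^X=\bigoplus_{k\ge0}S^k\mathcal H^X$ and $\mathrm{EXP}\,v=\bigoplus_k (k!)^{-1/2}v^{\otimes k}$. The Vershik–Gelfand–Graev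 representation of $G^X$ (1973), in its orthogonal form realized in the Fock space $\mathrm{EXP}\,\mathcal H^X$, is given by $$V(g)\,\mathrm{EXP}\,v=e^{-\frac12\|b^X(g)\|^2-\langle T^X(g)v,\,b^X(g)\rangle}\,\mathrm{EXP}\big(T^X(g)v+b^X(g)\big).$$ **Theorem.** 1. The measure $\mathcal L$ is concentrated on measures $\xi=\sum_k r_k\delta_{x_k}$ with infinitely many distinct points $x_k$ and pairwise distinct weights $r_k>0$, $\sum_k r_k<\infty$. It satisfies $$\int e^{-\sum_k r_kf(x_k)}\,d\mathcal L(\xi)=e^{-\int_X\log f\,dm}$$ for all measurable $f:X\to\mathbb R$ with $0<c\le f\le C$ for some constants $c,C$. The functionals $F^0_z$, $z\in L^X$, lie in $\mathrm{INT}\,H^0$. 2. For every $g\in G^X$ the operator $U^0(g)$ given by $(*)$ extends to an orthogonal operator on $\mathrm{INT}\,H^0$, and this is its only extension to a bounded linear operator. The operators $U^0(g)$ form an orthogonal representation of $G^X$ in $\mathrm{INT}\,H^0$. 3. The restriction of this representation to $P^X$ coincides with $\mathrm{INT}\,T^0$. 4. The operators $V(g)$ are well defined and form an orthogonal representation of $G^X$,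 and $U^0$ is equivalent to $V$: there is a surjective linear isometry $W:\mathrm{INT}\,H^0\to\mathrm{EXP}\,\mathcal H^X$ with $WU^0(g)=V(g)W$ for all $g\in G^X$. -/

import Mathlib

open MeasureTheory ProbabilityTheory Filter
open scoped ENNReal UpperHalfPlane

noncomputable section

namespace CurrentGroup

/-! ### Hilbert spaces generated by vectors with prescribed inner products -/

/-- The extension of a linear isometry to the completion. -/
def completionMap {E : Type*} [SeminormedAddCommGroup E] [NormedSpace ℝ E] (L : E →ₗᵢ[ℝ] E) :
    UniformSpace.Completion E →ₗᵢ[ℝ] UniformSpace.Completion E where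
  toFun := UniformSpace.Completion.map L
  map_add' x y := by
    have hL := L.isometry.uniformContinuous
    have hc := UniformSpace.Completion.continuous_map (f := L)
    induction x, y using UniformSpace.Completion.induction_on₂ with
    | hp =>
      exact isClosed_eq (hc.comp continuous_add)
        ((hc.comp continuous_fst).add (hc.comp continuous_snd))
    | ih a b =>
      rw [← UniformSpace.Completion.coe_add, UniformSpace.Completion.map_coe hL,
        UniformSpace.Completion.map_coe hL, UniformSpace.Completion.map_coe hL, map_add,
        UniformSpace.Completion.coe_add]
  map_smul' r x := by
    have hL := L.isometry.uniformContinuous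
    have hc := UniformSpace.Completion.continuous_map (f := L)
    induction x using UniformSpace.Completion.induction_on with
    | hp => exact isClosed_eq (hc.comp (continuous_const_smul r)) (hc.const_smul r)
    | ih a =>
      rw [← UniformSpace.Completion.coe_smul, UniformSpace.Completion.map_coe hL,
        UniformSpace.Completion.map_coe hL, map_smul, UniformSpace.Completion.coe_smul]
      rfl
  norm_map' x := by
    have hL := L.isometry.uniformContinuous
    have hc := UniformSpace.Completion.continuous_map (f := L)
    change ‖UniformSpace.Completion.map L x‖ = ‖x‖
    induction x using UniformSpace.Completion.induction_on with
    | hp => exact isClosed_eq hc.norm continuous_norm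
    | ih a =>
      rw [UniformSpace.Completion.map_coe hL, UniformSpace.Completion.norm_coe,
        UniformSpace.Completion.norm_coe, LinearIsometry.norm_map]

/-- A real positive semidefinite kernel on a set `A`. -/
structure PosKernel (A : Type*) where
  ker : Matrix A A ℝ
  posSemidef : ker.PosSemidef

namespace PosKernel

variable {A : Type*}

/-- The semi-inner product of formal linear combinations determined by the kernel. -/
def form (K : PosKernel A) (f g : A →₀ ℝ) : ℝ :=
  f.sum fun a s => g.sum fun b t => s * t * K.ker a b

theorem form_symm (K : PosKernel A) (f g : A →₀ ℝ) : K.form g f = K.form f g := by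
  unfold form
  rw [Finsupp.sum_comm]
  have h : ∀ a b, K.ker a b = K.ker b a := fun a b => by
    simpa using K.posSemidef.isHermitian.apply b a
  simp only [Finsupp.sum]
  refine Finset.sum_congr rfl fun a _ => Finset.sum_congr rfl fun b _ => ?_
  rw [h a b]; ring

theorem form_nonneg (K : PosKernel A) (f : A →₀ ℝ) : 0 ≤ K.form f f := by
  have h := K.posSemidef.2 f
  simp only [star_trivial] at h
  refine h.trans (le_of_eq ?_)
  simp only [form, Finsupp.sum]
  refine Finset.sum_congr rfl fun a _ => Finset.sum_congr rfl fun b _ => ?_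
  ring

theorem form_add (K : PosKernel A) (f g k : A →₀ ℝ) :
    K.form (f + g) k = K.form f k + K.form g k := by
  unfold form
  rw [Finsupp.sum_add_index'] <;> simp [← Finsupp.sum_add, add_mul]

theorem form_smul (K : PosKernel A) (f g : A →₀ ℝ) (r : ℝ) :
    K.form (r • f) g = r * K.form f g := by
  unfold form
  rw [Finsupp.sum_smul_index] <;> simp [Finsupp.mul_sum, ← mul_assoc]

theorem form_single (K : PosKernel A) (a b : A) :
    K.form (Finsupp.single a 1) (Finsupp.single b 1) = K.ker a b := by
  simp [form]

theorem form_mapDomain (K : PosKernel A) (φ : A → A)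
    (hφ : ∀ a b, K.ker (φ a) (φ b) = K.ker a b) (f g : A →₀ ℝ) :
    K.form (Finsupp.mapDomain φ f) (Finsupp.mapDomain φ g) = K.form f g := by
  unfold form
  rw [Finsupp.sum_mapDomain_index (by simp) (by simp [add_mul, Finsupp.sum_add])]
  refine Finsupp.sum_congr fun a _ => ?_
  rw [Finsupp.sum_mapDomain_index (by simp) (by simp [mul_add, add_mul])]
  simp [hφ]

/-- The formal real linear combinations of elements of `A`, with the semi-inner product
determined by `K`. -/
def Pre (_K : PosKernel A) : Type _ := A →₀ ℝ

instance (K : PosKernel A) : AddCommGroup K.Pre := inferInstanceAs (AddCommGroup (A →₀ ℝ))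

instance (K : PosKernel A) : Module ℝ K.Pre := inferInstanceAs (Module ℝ (A →₀ ℝ))

/-- The identity map from formal linear combinations. -/
def toPre (K : PosKernel A) : (A →₀ ℝ) ≃ₗ[ℝ] K.Pre := LinearEquiv.refl ℝ _

instance core (K : PosKernel A) : PreInnerProductSpace.Core ℝ K.Pre where
  inner f g := K.form (K.toPre.symm f) (K.toPre.symm g)
  conj_inner_symm _ _ := K.form_symm _ _
  re_inner_nonneg _ := K.form_nonneg _
  add_left _ _ _ := K.form_add _ _ _
  smul_left _ _ _ := K.form_smul _ _ _

instance (K : PosKernel A) : SeminormedAddCommGroup K.Pre :=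
  InnerProductSpace.Core.toSeminormedAddCommGroup (𝕜 := ℝ)

instance (K : PosKernel A) : InnerProductSpace ℝ K.Pre := InnerProductSpace.ofCore _

/-- The real Hilbert space generated by vectors `gen a`, `a ∈ A`, with
`⟪gen a, gen b⟫ = K.ker a b`. -/
abbrev Space (K : PosKernel A) : Type _ := UniformSpace.Completion K.Pre

/-- The generating vectors. -/
def gen (K : PosKernel A) (a : A) : K.Space :=
  UniformSpace.Completion.coe' (K.toPre (Finsupp.single a 1))

theorem inner_gen (K : PosKernel A) (a b : A) :
    inner ℝ (K.gen a) (K.gen b) = K.ker a b := by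
  unfold gen
  rw [UniformSpace.Completion.inner_coe]
  exact K.form_single a b

theorem dense_span_gen (K : PosKernel A) :
    Dense (Submodule.span ℝ (Set.range K.gen) : Set K.Space) := by
  have h : ∀ f : A →₀ ℝ, (UniformSpace.Completion.coe' (K.toPre f) : K.Space) ∈
      Submodule.span ℝ (Set.range K.gen) := by
    intro f
    induction f using Finsupp.induction_linear with
    | zero =>
      rw [map_zero, UniformSpace.Completion.coe_zero]
      exact Submodule.zero_mem _
    | add f g hf hg =>
      rw [map_add, UniformSpace.Completion.coe_add]
      exact Submodule.add_mem _ hf hg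
    | single a r =>
      have h2 : Finsupp.single a r = r • Finsupp.single a (1 : ℝ) := by simp
      rw [h2, map_smul, UniformSpace.Completion.coe_smul]
      exact Submodule.smul_mem _ _ (Submodule.subset_span ⟨a, rfl⟩)
  refine (UniformSpace.Completion.denseRange_coe (α := K.Pre)).mono ?_
  rintro _ ⟨f, rfl⟩
  exact h (K.toPre.symm f)

/-- The isometry of formal combinations induced by a kernel preserving map. -/
def preMap (K : PosKernel A) (φ : A → A) (hφ : ∀ a b, K.ker (φ a) (φ b) = K.ker a b) :
    K.Pre →ₗᵢ[ℝ] K.Pre :=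
  LinearMap.isometryOfInner
    (K.toPre.toLinearMap ∘ₗ Finsupp.lmapDomain ℝ ℝ φ ∘ₗ K.toPre.symm.toLinearMap)
    (fun f g => K.form_mapDomain φ hφ (K.toPre.symm f) (K.toPre.symm g))

/-- A map of `A` which preserves the kernel induces a linear isometry `gen a ↦ gen (φ a)`. -/
def map (K : PosKernel A) (φ : A → A) (hφ : ∀ a b, K.ker (φ a) (φ b) = K.ker a b) :
    K.Space →ₗᵢ[ℝ] K.Space :=
  completionMap (K.preMap φ hφ)

theorem map_gen (K : PosKernel A) (φ : A → A) (hφ : ∀ a b, K.ker (φ a) (φ b) = K.ker a b)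
    (a : A) : K.map φ hφ (K.gen a) = K.gen (φ a) := by
  have hL := (K.preMap φ hφ).isometry.uniformContinuous
  change UniformSpace.Completion.map (K.preMap φ hφ) _ = _
  unfold gen
  rw [UniformSpace.Completion.map_coe hL]
  congr 1
  exact congrArg K.toPre (Finsupp.mapDomain_single (f := φ))

/-- Inner products of a family of vectors form a positive semidefinite matrix. -/
theorem posSemidef_inner {H : Type*} [SeminormedAddCommGroup H] [InnerProductSpace ℝ H]
    (v : A → H) : (Matrix.of fun a b => inner ℝ (v a) (v b)).PosSemidef := by
  refine ⟨Matrix.IsHermitian.ext fun a b => by simp [real_inner_comm], fun x => ?_⟩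
  have h : (x.sum fun i xi => x.sum fun j xj =>
      star xi * (Matrix.of fun a b => inner ℝ (v a) (v b)) i j * xj)
      = inner ℝ (x.sum fun i xi => xi • v i) (x.sum fun i xi => xi • v i) := by
    simp only [Finsupp.sum, sum_inner, inner_sum, real_inner_smul_left, real_inner_smul_right,
      star_trivial, Matrix.of_apply]
    refine Finset.sum_congr rfl fun a _ => Finset.sum_congr rfl fun b _ => ?_
    rw [real_inner_comm]
    ring
  rw [h]
  exact real_inner_self_nonneg

/-- Finite entrywise products of positive semidefinite matrices are positive semidefinite. -/
theorem posSemidef_prod {ι : Type*} (s : Finset ι) (M : ι → Matrix A A ℝ)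
    (hM : ∀ i, (M i).PosSemidef) : (Matrix.of fun a b => ∏ i ∈ s, M i a b).PosSemidef := by
  classical
  induction s using Finset.induction_on with
  | empty =>
    simpa using posSemidef_inner (fun _ : A => (1 : ℝ))
  | insert i s his ih =>
    have h : (Matrix.hadamard (M i) (Matrix.of fun a b => ∏ i ∈ s, M i a b)).PosSemidef :=
      (hM i).hadamard ih
    have h2 : (Matrix.of fun a b => ∏ i ∈ insert i s, M i a b)
        = Matrix.hadamard (M i) (Matrix.of fun a b => ∏ i ∈ s, M i a b) := by
      ext a b
      simp [Finset.prod_insert his]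
    rw [h2]
    exact h

/-- Pointwise limits of positive semidefinite matrices are positive semidefinite. -/
theorem posSemidef_of_tendsto {ι : Type*} {l : Filter ι} [l.NeBot] (M : ι → Matrix A A ℝ)
    (hM : ∀ i, (M i).PosSemidef) (N : Matrix A A ℝ)
    (h : ∀ a b, Tendsto (fun i => M i a b) l (nhds (N a b))) : N.PosSemidef := by
  refine ⟨Matrix.IsHermitian.ext fun a b => ?_, fun x => ?_⟩
  · refine tendsto_nhds_unique (h b a) ((h a b).congr fun i => ?_)
    simpa using ((hM i).isHermitian.apply b a)
  · refine ge_of_tendsto' (f := fun i => x.sum fun a s => x.sum fun b t =>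
      star s * M i a b * t) (x := l) ?_ fun i => (hM i).2 x
    simp only [Finsupp.sum]
    exact tendsto_finsetSum _ fun a _ => tendsto_finsetSum _ fun b _ =>
      ((h a b).const_mul _).mul_const _

end PosKernel

/-! ### Countable tensor products with a stabilizing unit vector -/

section Tensor

variable {H : Type*} [NormedAddCommGroup H] [InnerProductSpace ℝ H] (h : H)

/-- The sequences of vectors of `H` which are summably close to `h`. They include the sequences
that are eventually equal to `h`. -/
def StabSeq : Type _ := {f : ℕ → H // Summable fun k => ‖f k - h‖}

theorem multipliable_inner (hh : ‖h‖ = 1) (f g : StabSeq h) :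
    Multipliable fun k => inner ℝ (f.1 k) (g.1 k) := by
  have hg : Summable fun k => ‖g.1 k‖ * ‖f.1 k - h‖ := by
    obtain ⟨C, hC⟩ : ∃ C, ∀ k, ‖g.1 k‖ ≤ C := by
      obtain ⟨C, hC⟩ := g.2.tendsto_atTop_zero.bddAbove_range
      refine ⟨C + 1, fun k => ?_⟩
      have h1 : ‖g.1 k - h‖ ≤ C := hC ⟨k, rfl⟩
      have h2 : ‖g.1 k‖ ≤ ‖g.1 k - h‖ + ‖h‖ := by
        simpa using norm_add_le (g.1 k - h) h
      linarith
    exact Summable.of_nonneg_of_le (fun k => by positivity)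
      (fun k => mul_le_mul_of_nonneg_right (hC k) (norm_nonneg _)) (f.2.mul_left C)
  have hs : Summable fun k => ‖inner ℝ (f.1 k) (g.1 k) - 1‖ := by
    refine Summable.of_nonneg_of_le (fun k => norm_nonneg _) (fun k => ?_) (hg.add g.2)
    have h1 : inner ℝ (f.1 k) (g.1 k) - 1
        = inner ℝ (f.1 k - h) (g.1 k) + inner ℝ h (g.1 k - h) := by
      rw [inner_sub_left, inner_sub_right, real_inner_self_eq_norm_sq, hh]
      ring
    rw [h1]
    refine (norm_add_le _ _).trans (add_le_add ?_ ?_)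
    · rw [mul_comm]
      exact norm_inner_le_norm _ _
    · simpa [hh] using norm_inner_le_norm (𝕜 := ℝ) h (g.1 k - h)
  simpa using multipliable_one_add_of_summable hs

/-- The kernel `⟪⊗ f_k, ⊗ g_k⟫ = ∏ ⟪f_k, g_k⟫`. -/
def tensorKernel (hh : ‖h‖ = 1) : PosKernel (StabSeq h) where
  ker := Matrix.of fun f g => ∏' k, inner ℝ (f.1 k) (g.1 k)
  posSemidef := by
    refine PosKernel.posSemidef_of_tendsto (l := atTop)
      (fun s : Finset ℕ => Matrix.of fun f g : StabSeq h => ∏ k ∈ s,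
        (Matrix.of fun f g : StabSeq h => inner ℝ (f.1 k) (g.1 k)) f g)
      (fun s => PosKernel.posSemidef_prod s _ fun k => PosKernel.posSemidef_inner _) _ ?_
    intro f g
    exact (multipliable_inner h hh f g).hasProd

/-- The countable tensor product `H ⊗ H ⊗ ⋯` of copies of `H` with stabilizing unit vector `h`:
the Hilbert space generated by the decomposable vectors `⊗ f_k`, with
`⟪⊗ f_k, ⊗ g_k⟫ = ∏ ⟪f_k, g_k⟫`. The vectors with `f_k = h` for all large `k` are total in it, so
that it is the completion of the inductive limit of the finite tensor powers of `H` with respect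
to the embeddings `x ↦ x ⊗ h`. -/
abbrev CountableTensor (hh : ‖h‖ = 1) : Type _ := (tensorKernel h hh).Space

open Classical in
/-- The decomposable vector `⊗ f_k`. -/
def tens (hh : ‖h‖ = 1) (f : ℕ → H) : CountableTensor h hh :=
  if hf : Summable fun k => ‖f k - h‖ then (tensorKernel h hh).gen ⟨f, hf⟩ else 0

open Classical in
/-- The tensor product `⊗ R_k` of isometries `R_k` of `H` for which `R_k h` is summably close
to `h`; it maps `⊗ f_k` to `⊗ R_k f_k`. -/
def tensMap (hh : ‖h‖ = 1) (R : ℕ → H ≃ₗᵢ[ℝ] H) :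
    CountableTensor h hh →ₗᵢ[ℝ] CountableTensor h hh :=
  if hR : Summable fun k => ‖R k h - h‖ then
    (tensorKernel h hh).map
      (fun f => ⟨fun k => R k (f.1 k), by
        refine Summable.of_nonneg_of_le (fun k => norm_nonneg _) (fun k => ?_) (f.2.add hR)
        have h1 : R k (f.1 k) - h = R k (f.1 k - h) + (R k h - h) := by
          rw [map_sub]; abel
        rw [h1]
        refine (norm_add_le _ _).trans (le_of_eq ?_)
        rw [LinearIsometryEquiv.norm_map]⟩)
      (fun f g => tprod_congr fun k => (R k).inner_map_map _ _)
  else LinearIsometry.id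

/-- The permutation of the tensor factors, `⊗ f_k ↦ ⊗ f_{τ k}`. -/
def tensPerm (hh : ‖h‖ = 1) (τ : Equiv.Perm ℕ) :
    CountableTensor h hh →ₗᵢ[ℝ] CountableTensor h hh :=
  (tensorKernel h hh).map (fun f => ⟨fun k => f.1 (τ k), (τ.summable_iff).2 f.2⟩)
    (fun f g => τ.tprod_eq fun k => inner ℝ (f.1 k) (g.1 k))

end Tensor

/-! ### The Fock space -/

section Fock

variable (E : Type*) [NormedAddCommGroup E] [InnerProductSpace ℝ E]

/-- The kernel `⟪v ⊗ ⋯ ⊗ v, w ⊗ ⋯ ⊗ w⟫ = ⟪v, w⟫ ^ k`. -/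
def symKernel (k : ℕ) : PosKernel E where
  ker := Matrix.of fun v w => (inner ℝ v w) ^ k
  posSemidef := by
    have := PosKernel.posSemidef_prod (Finset.range k)
      (fun _ => Matrix.of fun v w : E => inner ℝ v w)
      (fun _ => PosKernel.posSemidef_inner (fun v : E => v))
    simpa using this

/-- The `k`-th symmetric Hilbert tensor power of `E`, generated by the powers `v ⊗ ⋯ ⊗ v`. -/
abbrev SymPower (k : ℕ) : Type _ := (symKernel E k).Space

/-- The Fock space over `E`, the Hilbert sum of the symmetric tensor powers of `E`. -/
abbrev Fock : Type _ := lp (fun k : ℕ => SymPower E k) 2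

variable {E}

theorem memlp_expVec (v : E) :
    Memℓp (fun k : ℕ => (Real.sqrt (k.factorial : ℝ))⁻¹ • (symKernel E k).gen v) 2 := by
  refine memℓp_gen ?_
  have h : ∀ k : ℕ, ‖(Real.sqrt (k.factorial : ℝ))⁻¹ • (symKernel E k).gen v‖
      ^ (2 : ℝ≥0∞).toReal = (‖v‖ ^ 2) ^ k / k.factorial := by
    intro k
    have h1 : ‖(symKernel E k).gen v‖ ^ 2 = (‖v‖ ^ 2) ^ k := by
      rw [← real_inner_self_eq_norm_sq, PosKernel.inner_gen]
      change (inner ℝ v v) ^ k = _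
      rw [real_inner_self_eq_norm_sq]
    rw [ENNReal.toReal_ofNat, Real.rpow_ofNat, norm_smul, mul_pow, h1, norm_inv, inv_pow,
      Real.norm_eq_abs, sq_abs, Real.sq_sqrt (Nat.cast_nonneg _)]
    ring
  simp only [h]
  exact Real.summable_pow_div_factorial _

/-- The exponential vector `1 ⊕ v ⊕ (1/√2!) v ⊗ v ⊕ ⋯`. -/
def expVec (v : E) : Fock E := ⟨_, memlp_expVec v⟩

end Fock

/-! ### The infinite-dimensional Lebesgue measure -/

section Lebesgue

/-- The exponential integral `∫_r^∞ e^{-t} t⁻¹ dt`. -/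
def expInt (r : ℝ) : ℝ := ∫ t in Set.Ioi r, Real.exp (-t) / t

/-- The inverse function of the decreasing bijection `expInt : (0, ∞) → (0, ∞)`. -/
def expIntInv (s : ℝ) : ℝ := sInf {r | 0 < r ∧ expInt r ≤ s}

/-- A discrete measure `ξ = ∑ r_k δ_{x_k}` is represented by the sequence of the pairs
`(r_k, x_k)`, enumerated so that `r_0 > r_1 > ⋯`. -/
abbrev Config (X : Type*) : Type _ := ℕ → ℝ × X

/-- The cone of finite discrete measures `ξ = ∑ r_k δ_{x_k}` with distinct points `x_k` and
distinct positive weights. -/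
def l1plus (X : Type*) : Set (Config X) :=
  {ξ | StrictAnti (fun k => (ξ k).1) ∧ (∀ k, 0 < (ξ k).1) ∧ (Summable fun k => (ξ k).1) ∧
    Function.Injective fun k => (ξ k).2}

variable {X : Type*} [MeasurableSpace X]

/-- The law of the gamma process on `(X, m)`, that is, of the points `(r_k, x_k)` of a Poisson
process with intensity `r⁻¹ e^{-r} dr dm(x)`: the `expInt r_k` are the successive points of a
Poisson process with unit intensity on `(0, ∞)`, and the `x_k` are independent with law `m`. -/
def gammaLaw (m : Measure X) : Measure (Config X) :=
  (Measure.infinitePi fun _ : ℕ => (expMeasure 1).prod m).map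
    fun ω k => (expIntInv (∑ j ∈ Finset.range (k + 1), (ω j).1), (ω k).2)

/-- The infinite-dimensional Lebesgue measure `dℒ(ξ) = e^{∑ r_k} dΓ(ξ)`, where `Γ` is the law of
the gamma process. -/
def infLebesgue (m : Measure X) : Measure (Config X) :=
  (gammaLaw m).withDensity fun ξ => ENNReal.ofReal (Real.exp (∑' k, (ξ k).1))

open Classical in
/-- A permutation which puts a sequence into decreasing order, if there is one. -/
def sortPerm (s : ℕ → ℝ) : Equiv.Perm ℕ :=
  if hs : ∃ σ : Equiv.Perm ℕ, StrictAnti fun k => s (σ k) then hs.choose else 1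

end Lebesgue

/-! ### Currents with values in `SL(2, ℝ)` and in the upper half-plane -/

section Currents

/-- The group `SL(2, ℝ)`. -/
abbrev SL2 : Type := Matrix.SpecialLinearGroup (Fin 2) ℝ

/-- The matrix with rows `(δ, γ)` and `(β, α)`, for the matrix with rows `(α, β)` and `(γ, δ)`. -/
def flip (g : SL2) : SL2 :=
  ⟨!![g 1 1, g 1 0; g 0 1, g 0 0], by
    have h := g.det_coe
    rw [Matrix.det_fin_two] at h
    rw [Matrix.det_fin_two_of]
    linarith⟩

/-- The action `g z = (δ z + γ) / (β z + α)` of the matrix `g` with rows `(α, β)` and `(γ, δ)`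
on the upper half-plane. -/
def act (g : SL2) (z : ℍ) : ℍ := flip g • z

theorem coe_act (g : SL2) (z : ℍ) :
    (act g z : ℂ) = ((g 1 1 : ℂ) * z + g 1 0) / ((g 0 1 : ℂ) * z + g 0 0) := by
  rw [act, UpperHalfPlane.coe_specialLinearGroup_apply]
  simp [flip]

theorem dist_act_I (g : SL2) : Real.cosh (dist (act g UpperHalfPlane.I) UpperHalfPlane.I)
    = (g 0 0 ^ 2 + g 0 1 ^ 2 + g 1 0 ^ 2 + g 1 1 ^ 2) / 2 := by
  have hdet : g 0 0 * g 1 1 - g 0 1 * g 1 0 = 1 := by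
    have h := g.det_coe
    rwa [Matrix.det_fin_two] at h
  have hc := coe_act g UpperHalfPlane.I
  rw [UpperHalfPlane.coe_I] at hc
  have hn : (0 : ℝ) < g 0 0 ^ 2 + g 0 1 ^ 2 := by
    rcases eq_or_ne (g 0 0) 0 with h0 | h0
    · have h1 : g 0 1 ≠ 0 := by
        intro h1
        simp [h0, h1] at hdet
      positivity
    · positivity
  have him : (act g UpperHalfPlane.I).im = 1 / (g 0 0 ^ 2 + g 0 1 ^ 2) := by
    rw [← UpperHalfPlane.coe_im, hc, Complex.div_im]
    simp [Complex.normSq_apply]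
    field_simp
    linear_combination hdet
  have hre : (act g UpperHalfPlane.I).re
      = (g 1 1 * g 0 1 + g 1 0 * g 0 0) / (g 0 0 ^ 2 + g 0 1 ^ 2) := by
    rw [← UpperHalfPlane.coe_re, hc, Complex.div_re]
    simp [Complex.normSq_apply]
    field_simp
    ring
  rw [UpperHalfPlane.cosh_dist', him, hre, UpperHalfPlane.I_re, UpperHalfPlane.I_im]
  field_simp
  linear_combination (-(g 0 0 * g 1 1 - g 0 1 * g 1 0) - 1) * hdet

variable (X : Type*) [MeasurableSpace X]

/-- The group of bounded measurable maps `X → SL(2, ℝ)` with pointwise multiplication. -/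
def currents : Subgroup (X → SL2) where
  carrier := {g | (∀ i j, Measurable fun x => g x i j) ∧ ∃ C : ℝ, ∀ x i j, |g x i j| ≤ C}
  one_mem' := by
    refine ⟨fun i j => measurable_const, 1, fun x i j => ?_⟩
    fin_cases i <;> fin_cases j <;> simp
  mul_mem' := by
    rintro g g' ⟨hg, C, hC⟩ ⟨hg', C', hC'⟩
    have e : ∀ x i j, (g * g') x i j = g x i 0 * g' x 0 j + g x i 1 * g' x 1 j := by
      intro x i j
      simp [Matrix.mul_apply, Fin.sum_univ_two]
    refine ⟨fun i j => ?_, C * C' + C * C', fun x i j => ?_⟩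
    · simp only [e]
      exact ((hg i 0).mul (hg' 0 j)).add ((hg i 1).mul (hg' 1 j))
    · rw [e]
      have hC0 : 0 ≤ C := (abs_nonneg _).trans (hC x 0 0)
      refine (abs_add_le _ _).trans (add_le_add ?_ ?_) <;> rw [abs_mul] <;>
        exact mul_le_mul (hC _ _ _) (hC' _ _ _) (abs_nonneg _) hC0
  inv_mem' := by
    rintro g ⟨hg, C, hC⟩
    have e : ∀ x, ((g⁻¹) x : Matrix (Fin 2) (Fin 2) ℝ)
        = !![g x 1 1, -g x 0 1; -g x 1 0, g x 0 0] := by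
      intro x
      simp [Matrix.SpecialLinearGroup.coe_inv, Matrix.adjugate_fin_two]
    refine ⟨fun i j => ?_, C, fun x i j => ?_⟩
    · simp only [e]
      fin_cases i <;> fin_cases j <;> simp <;> exact hg _ _
    · rw [e]
      fin_cases i <;> fin_cases j <;> simp <;> exact hC _ _ _

/-- The subgroup of the currents with values in the group of lower triangular matrices. -/
def triangularCurrents : Subgroup (currents X) where
  carrier := {g | ∀ x, g.1 x 0 1 = 0}
  one_mem' := fun x => by simp
  mul_mem' := by
    intro g g' hg hg' x
    have h1 := hg x
    have h2 := hg' x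
    simp [Matrix.mul_apply, Fin.sum_univ_two, h1, h2]
  inv_mem' := by
    intro g hg x
    have h1 := hg x
    simp [Matrix.SpecialLinearGroup.coe_inv, Matrix.adjugate_fin_two, h1]

/-- The measurable maps of `X` into the upper half-plane which are bounded with respect to the
hyperbolic metric. -/
def HalfPlaneMaps : Type _ := {z : X → ℍ // Measurable z ∧ Bornology.IsBounded (Set.range z)}

variable {X}

theorem bounded_act (g : currents X) (z : HalfPlaneMaps X) :
    Bornology.IsBounded (Set.range fun x => act (g.1 x) (z.1 x)) := by
  obtain ⟨-, C, hC⟩ := g.2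
  obtain ⟨D, hD⟩ := (Metric.isBounded_iff_subset_closedBall UpperHalfPlane.I).1 z.2.2
  refine (Metric.isBounded_iff_subset_closedBall UpperHalfPlane.I).2
    ⟨D + (1 + 4 * C ^ 2), ?_⟩
  rintro _ ⟨x, rfl⟩
  have h1 : dist (act (g.1 x) (z.1 x)) (act (g.1 x) UpperHalfPlane.I) ≤ D := by
    unfold act
    rw [dist_smul]
    exact hD ⟨x, rfl⟩
  have h2 : dist (act (g.1 x) UpperHalfPlane.I) UpperHalfPlane.I ≤ 1 + 4 * C ^ 2 := by
    have h3 := Real.self_le_sinh_iff.2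
      (dist_nonneg (x := act (g.1 x) UpperHalfPlane.I) (y := UpperHalfPlane.I))
    have h4 := (Real.sinh_lt_cosh (dist (act (g.1 x) UpperHalfPlane.I) UpperHalfPlane.I)).le
    rw [dist_act_I] at h4
    have h5 : ∀ i j, g.1 x i j ^ 2 ≤ C ^ 2 := fun i j => by
      rw [← sq_abs]
      exact pow_le_pow_left₀ (abs_nonneg _) (hC x i j) 2
    linarith [h5 0 0, h5 0 1, h5 1 0, h5 1 1, sq_nonneg C]
  exact (dist_triangle _ _ _).trans (add_le_add h1 h2)

/-- The pointwise action of the currents on the maps into the upper half-plane. -/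
def currentAct (g : currents X) (z : HalfPlaneMaps X) : HalfPlaneMaps X :=
  ⟨fun x => act (g.1 x) (z.1 x), by
    rw [measurable_comap_iff]
    have hz : Measurable fun x => (z.1 x : ℂ) :=
      (measurable_comap_iff.1 z.2.1)
    have hg := fun i j => Complex.measurable_ofReal.comp (g.2.1 i j)
    have h := (((hg 1 1).mul hz).add (hg 1 0)).div (((hg 0 1).mul hz).add (hg 0 0))
    convert h using 1
    funext x
    exact coe_act _ _, bounded_act g z⟩

end Currents

/-! ### The integral model for the triangular subgroup -/

section IntegralModel

variable {X : Type*} [MeasurableSpace X]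

/-- The countable tensor product of copies of the two-dimensional real space `H⁰` of the vectors
`(f, f̄)`, `f ∈ ℂ`, with the stabilizing vector `2^{-1/2} (1, 1)`. The space `H⁰` is identified
with `ℂ`, as a Euclidean plane, by the isometry `2^{-1/2} (f, f̄) ↦ f`. -/
abbrev TensorH0 : Type := CountableTensor (1 : ℂ) norm_one

/-- The direct integral of the tensor products `H⁰_ξ = ⊗ H⁰_{r_k}` with respect to the
infinite-dimensional Lebesgue measure. As `H⁰_r = H⁰` for all `r`, its elements are the classes
of square integrable maps with values in `TensorH0`. -/
abbrev IntH0 (m : Measure X) : Type _ := Lp TensorH0 2 (infLebesgue m)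

/-- The operator of `(1, γ)` in the representation `T⁰_r`, that is,
`(f, f̄) ↦ (e^{i r² γ} f, e^{- i r² γ} f̄)`. -/
def rotT0 (r γ : ℝ) : ℂ ≃ₗᵢ[ℝ] ℂ := rotation (Circle.exp (r ^ 2 * γ))

/-- The action `(U(1, γ) F)(ξ) = (⊗ T⁰_{r_k}(1, γ(x_k))) F(ξ)` on sections. -/
def unipotentAct (γ : X → ℝ) (F : Config X → TensorH0) : Config X → TensorH0 := fun ξ =>
  tensMap 1 norm_one (fun k => rotT0 (ξ k).1 (γ (ξ k).2)) (F ξ)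

/-- The permutation that arranges the weights `a(x_k) r_k` in decreasing order. -/
def multPerm (a : X → ℝ) (ξ : Config X) : Equiv.Perm ℕ :=
  sortPerm fun k => a (ξ k).2 * (ξ k).1

/-- The multiplicator `∑ r_k δ_{x_k} ↦ ∑ a(x_k) r_k δ_{x_k}`. -/
def multiplicator (a : X → ℝ) (ξ : Config X) : Config X := fun k =>
  (a (ξ (multPerm a ξ k)).2 * (ξ (multPerm a ξ k)).1, (ξ (multPerm a ξ k)).2)

/-- The action `(U(a, 0) F)(ξ) = e^{½ ∫ log a dm} F(a ξ)` on sections. The spaces `H⁰_{aξ}` and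
`H⁰_ξ` are identified by matching the factors which belong to the same point `x_k`. -/
def scaleAct (m : Measure X) (a : X → ℝ) (F : Config X → TensorH0) : Config X → TensorH0 :=
  fun ξ => Real.exp ((∫ x, Real.log (a x) ∂m) / 2) •
    tensPerm 1 norm_one (multPerm a ξ).symm (F (multiplicator a ξ))

/-- The operator of a triangular current with rows `(ε⁻¹, 0)` and `(γ, ε)` in the representation
`INT T⁰`, according to the factorization `(ε, γ) = (|ε|, 0) · (sgn ε, 0) · (1, ε⁻¹ γ)`, where
`(± 1, 0)` acts identically. -/
def intT0 (m : Measure X) (g : currents X) (F : Config X → TensorH0) : Config X → TensorH0 :=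
  scaleAct m (fun x => |g.1 x 1 1|) (unipotentAct (fun x => g.1 x 1 0 / g.1 x 1 1) F)

/-- The functional `F⁰_z(ξ) = ⊗ 2^{-1/2} (e^{i r_k² z(x_k)}, e^{- i r_k² z̄(x_k)})`. -/
def functional (z : HalfPlaneMaps X) : Config X → TensorH0 := fun ξ =>
  tens 1 norm_one fun k =>
    Complex.exp (Complex.I * ((ξ k).1 : ℂ) ^ 2 * (z.1 (ξ k).2 : ℂ))

/-- The function `c(z₁, z₂) = log (- i (z₁ - z̄₂))`. -/
def cFun (z₁ z₂ : ℍ) : ℂ :=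
  Complex.log (-Complex.I * ((z₁ : ℂ) - starRingEnd ℂ (z₂ : ℂ)))

/-- The function `u⁺(g, z)`, with `z₀ = i`; its real part is also the real part of `u⁻(g, z)`. -/
def uPlus (g : SL2) (z : ℍ) : ℂ :=
  cFun (act g z) (act g UpperHalfPlane.I) - cFun z UpperHalfPlane.I
    - (cFun (act g UpperHalfPlane.I) (act g UpperHalfPlane.I)
        - cFun UpperHalfPlane.I UpperHalfPlane.I) / 2

/-- The factor `e^{½ Re ∫ u(g(x), z(x)) dm(x)}`. -/
def multiplier (m : Measure X) (g : currents X) (z : HalfPlaneMaps X) : ℝ :=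
  Real.exp ((∫ x, uPlus (g.1 x) (z.1 x) ∂m).re / 2)

end IntegralModel

/-! ### The Fock representation -/

section FockRep

/-- The Lebesgue measure of the upper half-plane. -/
def halfPlaneVol : Measure ℂ := volume.restrict {w : ℂ | 0 < w.im}

/-- The space of the square integrable holomorphic functions on the upper half-plane, regarded as
a real Hilbert space. -/
def Bergman : Submodule ℝ (Lp ℂ 2 halfPlaneVol) where
  carrier := {f | ∃ F : ℂ → ℂ, DifferentiableOn ℂ F {w : ℂ | 0 < w.im} ∧ f =ᵐ[halfPlaneVol] F}
  zero_mem' := ⟨0, differentiableOn_const 0, Lp.coeFn_zero _ _ _⟩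
  add_mem' := by
    rintro f f' ⟨F, hF, hf⟩ ⟨F', hF', hf'⟩
    exact ⟨F + F', hF.add hF', (Lp.coeFn_add f f').trans (hf.add hf')⟩
  smul_mem' := by
    rintro c f ⟨F, hF, hf⟩
    exact ⟨c • F, hF.const_smul c, (Lp.coeFn_smul c f).trans (hf.const_smul c)⟩

/-- The special orthogonal representation of `SL(2, ℝ)` in the space `Bergman`:
`(T(g) f)(w) = f(g⁻¹ w) (g⁻¹)'(w)`. -/
def specialAct (g : SL2) (f : ℂ → ℂ) : ℂ → ℂ := fun w =>
  f (((g 0 0 : ℂ) * w - g 1 0) / ((g 1 1 : ℂ) - g 0 1 * w)) / ((g 1 1 : ℂ) - g 0 1 * w) ^ 2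

/-- A nontrivial `1`-cocycle of the special representation,
`b(g)(w) = (2π)^{-1/2} (d/dw) log ((w - p̄) / (w + i))` with `p = g i`. -/
def specialCocycle (g : SL2) : ℂ → ℂ := fun w =>
  ((Real.sqrt (2 * Real.pi))⁻¹ : ℝ) *
    (1 / (w - starRingEnd ℂ (act g UpperHalfPlane.I : ℂ)) - 1 / (w + Complex.I))

variable {X : Type*} [MeasurableSpace X]

/-- The one-particle space, the direct integral over `(X, m)` of copies of `Bergman`. -/
abbrev OneParticle (m : Measure X) : Type _ := Lp Bergman 2 m

/-- `v' = T(g) v` for the direct integral of the special representations. -/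
def IsSpecialAct (m : Measure X) (g : currents X) (v v' : OneParticle m) : Prop :=
  ∀ᵐ x ∂m, ((v' x : Lp ℂ 2 halfPlaneVol) : ℂ → ℂ)
    =ᵐ[halfPlaneVol] specialAct (g.1 x) ((v x : Lp ℂ 2 halfPlaneVol) : ℂ → ℂ)

/-- `b = b(g)` for the direct integral of the cocycles. -/
def IsSpecialCocycle (m : Measure X) (g : currents X) (b : OneParticle m) : Prop :=
  ∀ᵐ x ∂m, ((b x : Lp ℂ 2 halfPlaneVol) : ℂ → ℂ) =ᵐ[halfPlaneVol] specialCocycle (g.1 x)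

/-- `V` is the Fock representation of the current group associated with the special
representation and its cocycle:
`V(g) EXP v = e^{- ½ ‖b(g)‖² - ⟪T(g) v, b(g)⟫} EXP (T(g) v + b(g))`. -/
def IsFockRep (m : Measure X)
    (V : currents X →* (Fock (OneParticle m) ≃ₗᵢ[ℝ] Fock (OneParticle m))) : Prop :=
  ∀ (g : currents X) (v : OneParticle m), ∃ v' b : OneParticle m,
    IsSpecialAct m g v v' ∧ IsSpecialCocycle m g b ∧
      V g (expVec v) = Real.exp (-‖b‖ ^ 2 / 2 - inner ℝ v' b) • expVec (v' + b)

end FockRep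

end CurrentGroup

end

noncomputable section

set_option linter.unusedSectionVars false

namespace CurrentGroup

/-! ### Isometries determined by Gram matrices -/

section Gram

variable {ι H₁ H₂ : Type*} [NormedAddCommGroup H₁] [InnerProductSpace ℝ H₁]
  [NormedAddCommGroup H₂] [InnerProductSpace ℝ H₂]

/-! The theorem is a comparison of Gram matrices. Each Hilbert space involved has a total family of
vectors with explicit inner products, and an assignment between families that preserves inner
products extends to an isometry (`exists_isometry_of_gram`). Operators, intertwiners and uniqueness
then come down to scalar identities and totality.

In the integral model, `⟪F_z(ξ), F_w(ξ)⟫` is the product over the points of `ξ` of `Re exp(-ρ r_k²)`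
with `ρ = -i(w - z̄)` taken at `x_k`. Campbell's formula for Poisson processes (`campbell`,
`lebesgue_campbell`) turns the integral of a product `∏ ψ(r_k, x_k)` into `exp ∫∫ (ψ(r,x) - e^{-r})
r⁻¹ dr dm(x)`, and a Frullani integral for the Gaussian (`re_gaussFrullani`) evaluates the exponent:
`⟪F_z, F_w⟫ = exp(C - ½ ∫ log|z - w̄| dm)` with a constant `C`. Put `j(g,z) = βz + α`. Then the
modulus of `gz - (gw)‾` is `|z - w̄| / (|j(g,z)| |j(g,w)|)`, and `Re u(g,z) = -log|j(g,z)|`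
(`re_uPlus`). Hence the multiplier in `(*)` compensates exactly the change of the Gram matrix under
`z ↦ gz`, and the chain rule for `j` makes the resulting operators a representation.

On the Fock side, the functions `v_p(w) = (2π)^{-1/2} (1/(w - p̄) - 1/(w + i))` satisfy `T(g) v_p +
b(g) = v_{gp}`, and the reproducing kernel gives `⟪v_q, v_p⟫ = -½ (log|q - p̄| - log|q + i| - log|p
+ i| + log 2)`. So suitable scalar multiples of `EXP v_z` have the Gram matrix of the `F_z`. The
isometry `W` obtained in this way transports `U⁰` to a representation which agrees with the formula
for `V` on a total family, hence everywhere; the multiplicativity of `V` is inherited from `U⁰`.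

What remains is totality. In the integral model (`eq_zero_of_inner_functionalLp`), adding `i t` to
`z` multiplies `F_z` by the scalar `e^{-∑ r_k² t(x_k)}`. These scalars determine `ξ`, so a vector
orthogonal to all `F_z` is orthogonal in almost every fibre, and there the phases at finitely many
points can be chosen independently. In the Fock space (`eq_zero_of_inner_expVec_step`), the absence
of atoms allows a linear combination of values to be replaced by a signed average over ever finer
partitions.

For triangular currents the formula of `INT T⁰` is checked on the `F_z`. It passes to all vectors
because multiplicators preserve null sets (`ae_multiplicator`), which is read off from the Laplace
transform of `ℒ`. -/

theorem norm_linearCombination_eq_of_gram {f : ι → H₁} {g : ι → H₂}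
    (h : ∀ i j, inner ℝ (g i) (g j) = inner ℝ (f i) (f j)) (c : ι →₀ ℝ) :
    ‖Finsupp.linearCombination ℝ g c‖ = ‖Finsupp.linearCombination ℝ f c‖ := by
  have h1 : ‖Finsupp.linearCombination ℝ g c‖ ^ 2 = ‖Finsupp.linearCombination ℝ f c‖ ^ 2 := by
    rw [← real_inner_self_eq_norm_sq, ← real_inner_self_eq_norm_sq]
    simp only [Finsupp.linearCombination_apply, Finsupp.sum, sum_inner, inner_sum,
      real_inner_smul_left, real_inner_smul_right, h]
  exact (sq_eq_sq₀ (norm_nonneg _) (norm_nonneg _)).1 h1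

theorem denseRange_linearCombination {f : ι → H₁}
    (hf : Dense (Submodule.span ℝ (Set.range f) : Set H₁)) :
    DenseRange (Finsupp.linearCombination ℝ f) := by
  rw [← Finsupp.range_linearCombination] at hf
  rwa [LinearMap.coe_range] at hf

/-- The Gram matrix fixes the norm of every finite combination. Hence the two maps from formal
combinations have equal norms, and the second factors isometrically through the first, whose range
is dense. No linear independence is required. -/
theorem exists_isometry_of_gram [CompleteSpace H₂] {f : ι → H₁} {g : ι → H₂}
    (hf : Dense (Submodule.span ℝ (Set.range f) : Set H₁))
    (h : ∀ i j, inner ℝ (g i) (g j) = inner ℝ (f i) (f j)) :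
    ∃ L : H₁ →ₗᵢ[ℝ] H₂, ∀ i, L (f i) = g i := by
  have hd := denseRange_linearCombination hf
  have hn := norm_linearCombination_eq_of_gram h
  have hb : ∃ C, ∀ c, ‖Finsupp.linearCombination ℝ g c‖
      ≤ C * ‖Finsupp.linearCombination ℝ f c‖ := ⟨1, fun c => by rw [hn, one_mul]⟩
  let A := (Finsupp.linearCombination ℝ g).extendOfNorm (Finsupp.linearCombination ℝ f)
  refine ⟨⟨A.toLinearMap, fun x => ?_⟩, fun i => ?_⟩
  · refine hd.induction (P := fun x => ‖A x‖ = ‖x‖) ?_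
      (isClosed_eq A.continuous.norm continuous_norm) x
    rintro _ ⟨c, rfl⟩
    rw [LinearMap.extendOfNorm_eq hd hb, hn]
  · have := LinearMap.extendOfNorm_eq hd hb (Finsupp.single i 1)
    simpa using this

theorem exists_isometryEquiv_of_gram [CompleteSpace H₁] [CompleteSpace H₂]
    {f : ι → H₁} {g : ι → H₂}
    (hf : Dense (Submodule.span ℝ (Set.range f) : Set H₁))
    (hg : Dense (Submodule.span ℝ (Set.range g) : Set H₂))
    (h : ∀ i j, inner ℝ (g i) (g j) = inner ℝ (f i) (f j)) :
    ∃ L : H₁ ≃ₗᵢ[ℝ] H₂, ∀ i, L (f i) = g i := by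
  obtain ⟨L, hL⟩ := exists_isometry_of_gram hf h
  obtain ⟨M, hM⟩ := exists_isometry_of_gram hg fun i j => (h i j).symm
  have hLM : ∀ y, L (M y) = y := fun y => by
    have := Continuous.ext_on hg (L.continuous.comp M.continuous) continuous_id (fun y hy => by
      refine Submodule.span_induction (p := fun y _ => (L ∘ M) y = id y) ?_ ?_ ?_ ?_ hy
      · rintro _ ⟨i, rfl⟩; simp [hL, hM]
      · simp
      · intro x y _ _ hx hy
        simp only [Function.comp_apply, id_eq, map_add] at hx hy ⊢
        rw [hx, hy]
      · intro c x _ hx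
        simp only [Function.comp_apply, id_eq, map_smul] at hx ⊢
        rw [hx])
    exact congrFun this y
  exact ⟨LinearIsometryEquiv.ofSurjective L fun y => ⟨M y, hLM y⟩, hL⟩

theorem eq_zero_of_inner_dense {f : ι → H₁}
    (hf : Dense (Submodule.span ℝ (Set.range f) : Set H₁)) {x : H₁}
    (h : ∀ i, inner ℝ (f i) x = 0) : x = 0 := by
  refine hf.eq_zero_of_inner_right (𝕜 := ℝ) fun {v} hv => ?_
  refine Submodule.span_induction (p := fun v _ => inner ℝ v x = 0) ?_ ?_ ?_ ?_ hv
  · rintro _ ⟨i, rfl⟩; exact h i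
  · simp
  · intro a b _ _ ha hb; rw [inner_add_left, ha, hb, add_zero]
  · intro c a _ ha; rw [real_inner_smul_left, ha, mul_zero]

theorem dense_span_of_inner_eq_zero [CompleteSpace H₁] {f : ι → H₁}
    (h : ∀ x, (∀ i, inner ℝ (f i) x = 0) → x = 0) :
    Dense (Submodule.span ℝ (Set.range f) : Set H₁) := by
  rw [Submodule.dense_iff_topologicalClosure_eq_top, Submodule.topologicalClosure_eq_top_iff,
    Submodule.eq_bot_iff]
  intro x hx
  refine h x fun i => ?_
  exact (Submodule.mem_orthogonal _ _).1 hx _ (Submodule.subset_span ⟨i, rfl⟩)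

theorem eq_of_eqOn_total {F : Type*} [TopologicalSpace F] [T2Space F] [AddCommGroup F] [Module ℝ F]
    {f : ι → H₁} (hf : Dense (Submodule.span ℝ (Set.range f) : Set H₁))
    {A B : H₁ →ₗ[ℝ] F} (hA : Continuous A) (hB : Continuous B) (h : ∀ i, A (f i) = B (f i))
    (x : H₁) : A x = B x := by
  have := Continuous.ext_on hf hA hB (fun y hy => by
    refine LinearMap.eqOn_span (s := Set.range f) ?_ hy
    rintro _ ⟨i, rfl⟩
    exact h i)
  exact congrFun this x

end Gram

/-! ### Decomposable vectors of countable tensor products -/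

section Tens

/-- The factor is split off without dividing by `a k`, so the identity survives when `a k = 0`. It
is the source of the linearity of `tens` in each factor. -/
theorem tprod_update {a : ℕ → ℝ} (ha : Summable fun k => ‖a k - 1‖) (k : ℕ) (c : ℝ) :
    ∏' j, Function.update a k c j = c * ∏' j, Function.update a k 1 j := by
  have h1 : Multipliable (Function.update a k 1) := by
    have : Summable fun j => ‖Function.update a k 1 j - 1‖ := by
      refine Summable.of_nonneg_of_le (fun _ => norm_nonneg _) (fun j => ?_) ha
      rcases eq_or_ne j k with rfl | hj <;> simp [*]
    simpa using multipliable_one_add_of_summable this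
  have h2 := Multipliable.tprod_eq_mul_tprod_ite' (f := Function.update a k c) k (by simpa using h1)
  rw [h2]
  simp only [Function.update_self]
  congr 1
  refine tprod_congr fun j => ?_
  rcases eq_or_ne j k with rfl | hj <;> simp [*]

variable {H : Type*} [NormedAddCommGroup H] [InnerProductSpace ℝ H] {h : H}

theorem norm_inner_sub_one_le (hh : ‖h‖ = 1) (x y : H) :
    ‖inner ℝ x y - 1‖ ≤ ‖x - h‖ * (1 + ‖y - h‖) + ‖y - h‖ := by
  have h1 : inner ℝ x y - 1 = inner ℝ (x - h) y + inner ℝ h (y - h) := by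
    rw [inner_sub_left, inner_sub_right, real_inner_self_eq_norm_sq, hh]
    ring
  have h2 : ‖y‖ ≤ 1 + ‖y - h‖ := by
    have := norm_add_le h (y - h)
    rw [hh] at this
    simpa using this
  rw [h1]
  refine (norm_add_le _ _).trans (add_le_add ?_ ?_)
  · exact (norm_inner_le_norm _ _).trans (mul_le_mul_of_nonneg_left h2 (norm_nonneg _))
  · simpa [hh] using norm_inner_le_norm (𝕜 := ℝ) h (y - h)

theorem summable_inner_bound {b : ℕ → ℝ} (hb : Summable b) (hb0 : ∀ k, 0 ≤ b k) :
    Summable fun k => b k * (1 + b k) + b k := by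
  obtain ⟨C, hC⟩ := hb.tendsto_atTop_zero.bddAbove_range
  refine Summable.of_nonneg_of_le (fun k => ?_) (fun k => ?_) (hb.mul_left (1 + C + 1))
  · have := hb0 k; positivity
  · have h1 : b k ≤ C := hC ⟨k, rfl⟩
    nlinarith [hb0 k]

theorem summable_inner_sub_one (hh : ‖h‖ = 1) {f g : ℕ → H} (hf : Summable fun k => ‖f k - h‖)
    (hg : Summable fun k => ‖g k - h‖) : Summable fun k => ‖inner ℝ (f k) (g k) - 1‖ := by
  have hs := summable_inner_bound (hf.add hg) (fun k => by positivity)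
  refine Summable.of_nonneg_of_le (fun _ => norm_nonneg _) (fun k => ?_) hs
  refine (norm_inner_sub_one_le hh (f k) (g k)).trans ?_
  nlinarith [norm_nonneg (f k - h), norm_nonneg (g k - h)]

theorem tens_of_summable (hh : ‖h‖ = 1) {f : ℕ → H} (hf : Summable fun k => ‖f k - h‖) :
    tens h hh f = (tensorKernel h hh).gen ⟨f, hf⟩ := by
  simp [tens, hf]

theorem inner_tens (hh : ‖h‖ = 1) {f g : ℕ → H} (hf : Summable fun k => ‖f k - h‖)
    (hg : Summable fun k => ‖g k - h‖) :
    inner ℝ (tens h hh f) (tens h hh g) = ∏' k, inner ℝ (f k) (g k) := by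
  rw [tens_of_summable hh hf, tens_of_summable hh hg]
  exact PosKernel.inner_gen _ _ _

theorem eq_zero_of_inner_tens (hh : ‖h‖ = 1) {x : CountableTensor h hh}
    (hx : ∀ f : ℕ → H, (Summable fun k => ‖f k - h‖) → inner ℝ (tens h hh f) x = 0) : x = 0 := by
  refine eq_zero_of_inner_dense (tensorKernel h hh).dense_span_gen fun i => ?_
  have := hx i.1 i.2
  rwa [tens_of_summable hh i.2] at this

theorem summable_update {H : Type*} [NormedAddCommGroup H] {h : H} {f : ℕ → H} (hf : Summable fun k => ‖f k - h‖) (k : ℕ) (x : H) :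
    Summable fun j => ‖Function.update f k x j - h‖ := by
  refine (summable_congr_cofinite ?_).1 hf
  filter_upwards [(Set.finite_singleton k).compl_mem_cofinite] with j hj
  rw [Function.update_of_ne (by simpa using hj)]

theorem inner_tens_update (hh : ‖h‖ = 1) {f g : ℕ → H} (hf : Summable fun k => ‖f k - h‖)
    (hg : Summable fun k => ‖g k - h‖) (k : ℕ) (x : H) :
    inner ℝ (tens h hh g) (tens h hh (Function.update f k x)) = inner ℝ (g k) x *
      ∏' j, Function.update (fun j => inner ℝ (g j) (f j)) k 1 j := by
  rw [inner_tens hh hg (summable_update hf k x),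
    ← tprod_update (summable_inner_sub_one hh hg hf)]
  refine tprod_congr fun j => ?_
  rcases eq_or_ne j k with rfl | hj <;> simp [*]

/-- Decomposable vectors are abstract generators known only through their inner products. Relations
between them are therefore tested against all decomposable vectors, where this one is the linearity
of a single factor of an infinite product. -/
theorem tens_update_linear (hh : ‖h‖ = 1) {f : ℕ → H} (hf : Summable fun k => ‖f k - h‖) (k : ℕ)
    (a b : ℝ) (x y : H) :
    tens h hh (Function.update f k (a • x + b • y)) =
      a • tens h hh (Function.update f k x) + b • tens h hh (Function.update f k y) := by
  rw [← sub_eq_zero]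
  refine eq_zero_of_inner_tens hh fun g hg => ?_
  rw [inner_sub_right, inner_add_right, real_inner_smul_right, real_inner_smul_right,
    inner_tens_update hh hf hg, inner_tens_update hh hf hg, inner_tens_update hh hf hg,
    inner_add_right, real_inner_smul_right, real_inner_smul_right]
  ring

theorem tens_smul (hh : ‖h‖ = 1) {f : ℕ → H} (hf : Summable fun k => ‖f k - h‖) {c : ℕ → ℝ}
    (hc : Summable fun k => ‖c k - 1‖) :
    tens h hh (fun k => c k • f k) = (∏' k, c k) • tens h hh f := by
  have hs : Summable fun k => ‖c k • f k - h‖ := by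
    have := summable_inner_bound (hf.add hc) (fun k => by positivity)
    refine Summable.of_nonneg_of_le (fun _ => norm_nonneg _) (fun k => ?_) this
    have e : c k • f k - h = (c k - 1) • (f k - h) + (c k - 1) • h + (f k - h) := by
      rw [sub_smul, sub_smul, smul_sub]; simp only [one_smul]; abel
    rw [e]
    refine (norm_add₃_le).trans ?_
    rw [norm_smul, norm_smul, hh]
    nlinarith [norm_nonneg (f k - h), norm_nonneg (c k - 1)]
  rw [← sub_eq_zero]
  refine eq_zero_of_inner_tens hh fun g hg => ?_
  rw [inner_sub_right, real_inner_smul_right, inner_tens hh hg hs, inner_tens hh hg hf]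
  simp only [real_inner_smul_right]
  rw [Multipliable.tprod_mul, sub_self]
  · simpa using multipliable_one_add_of_summable hc
  · exact multipliable_inner h hh ⟨g, hg⟩ ⟨f, hf⟩

/-- The squared distance expands into three infinite products. Dominated convergence for products
sends the ones that depend on `n` to `∏ ‖f k‖²`, so the expansion tends to `x - 2x + x = 0`. -/
theorem tendsto_tens (hh : ‖h‖ = 1) {α : Type*} {l : Filter α} {F : α → ℕ → H} {f : ℕ → H}
    {b : ℕ → ℝ} (hb : Summable b) (hF : ∀ k, Tendsto (fun n => F n k) l (nhds (f k)))
    (hFb : ∀ n k, ‖F n k - h‖ ≤ b k) (hfb : ∀ k, ‖f k - h‖ ≤ b k) :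
    Tendsto (fun n => tens h hh (F n)) l (nhds (tens h hh f)) := by
  have hb0 : ∀ k, 0 ≤ b k := fun k => (norm_nonneg _).trans (hfb k)
  have hsf : Summable fun k => ‖f k - h‖ :=
    Summable.of_nonneg_of_le (fun _ => norm_nonneg _) hfb hb
  have hsF : ∀ n, Summable fun k => ‖F n k - h‖ := fun n =>
    Summable.of_nonneg_of_le (fun _ => norm_nonneg _) (hFb n) hb
  have key : ∀ {G K : α → ℕ → H}, (∀ n k, ‖G n k - h‖ ≤ b k) → (∀ n k, ‖K n k - h‖ ≤ b k) →
      (∀ k, Tendsto (fun n => G n k) l (nhds (f k))) →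
      (∀ k, Tendsto (fun n => K n k) l (nhds (f k))) →
      Tendsto (fun n => ∏' k, inner ℝ (G n k) (K n k)) l
        (nhds (∏' k, inner ℝ (f k) (f k))) := by
    intro G K hG hK hGf hKf
    have := tendsto_tprod_one_add_of_dominated_convergence (𝓕 := l)
      (f := fun n k => inner ℝ (G n k) (K n k) - 1) (g := fun k => inner ℝ (f k) (f k) - 1)
      (summable_inner_bound hb hb0) (fun k => ((hGf k).inner (hKf k)).sub_const 1)
      (Eventually.of_forall fun n k => (norm_inner_sub_one_le hh _ _).trans (by
        have h1 := hG n k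
        have h2 := hK n k
        have := hb0 k
        gcongr))
    simpa using this
  rw [tendsto_iff_norm_sub_tendsto_zero]
  have h0 : ∀ n, ‖tens h hh (F n) - tens h hh f‖ = Real.sqrt ((∏' k, inner ℝ (F n k) (F n k))
      - 2 * (∏' k, inner ℝ (F n k) (f k)) + ∏' k, inner ℝ (f k) (f k)) := by
    intro n
    rw [← inner_tens hh (hsF n) (hsF n), ← inner_tens hh (hsF n) hsf, ← inner_tens hh hsf hsf,
      real_inner_self_eq_norm_sq, real_inner_self_eq_norm_sq, ← norm_sub_sq_real,
      Real.sqrt_sq (norm_nonneg _)]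
  simp only [h0]
  have h1 := key hFb hFb hF hF
  have h2 := key (K := fun _ => f) hFb (fun _ => hfb) hF (fun k => tendsto_const_nhds)
  have h3 := ((h1.sub (h2.const_mul 2)).add_const (∏' k, inner ℝ (f k) (f k))).sqrt
  convert h3 using 2
  rw [show ∀ x : ℝ, x - 2 * x + x = 0 by intro x; ring, Real.sqrt_zero]

theorem tensMap_tens (hh : ‖h‖ = 1) {R : ℕ → H ≃ₗᵢ[ℝ] H} (hR : Summable fun k => ‖R k h - h‖)
    {f : ℕ → H} (hf : Summable fun k => ‖f k - h‖) :
    tensMap h hh R (tens h hh f) = tens h hh fun k => R k (f k) := by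
  have hs : Summable fun k => ‖R k (f k) - h‖ := by
    refine Summable.of_nonneg_of_le (fun k => norm_nonneg _) (fun k => ?_) (hf.add hR)
    have h1 : R k (f k) - h = R k (f k - h) + (R k h - h) := by
      rw [map_sub]; abel
    rw [h1]
    refine (norm_add_le _ _).trans (le_of_eq ?_)
    rw [LinearIsometryEquiv.norm_map]
  rw [tens_of_summable hh hf, tens_of_summable hh hs, tensMap, dif_pos hR]
  exact PosKernel.map_gen _ _ _ _

theorem tensPerm_tens (hh : ‖h‖ = 1) (τ : Equiv.Perm ℕ)
    {f : ℕ → H} (hf : Summable fun k => ‖f k - h‖) :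
    tensPerm h hh τ (tens h hh f) = tens h hh fun k => f (τ k) := by
  have hs : Summable fun k => ‖f (τ k) - h‖ := (τ.summable_iff).2 hf
  rw [tens_of_summable hh hf, tens_of_summable hh hs, tensPerm]
  exact PosKernel.map_gen _ _ _ _

end Tens

/-! ### Totality, separability and measurability in the tensor product of planes -/

section TensorH0

/-- Since `w k` is not real, `1` and `w k` form a real basis of the plane. Multilinearity thus
reaches every decomposable vector that is eventually `1`, and truncation reaches the others. -/
theorem eq_zero_of_inner_tens_ite {w : ℕ → ℂ} (hw : ∀ k, (w k).im ≠ 0) {v : TensorH0}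
    (hv : ∀ s : Finset ℕ, inner ℝ (tens 1 norm_one fun k => if k ∈ s then w k else 1) v = 0) :
    v = 0 := by
  have hsum : ∀ f : ℕ → ℂ, (∃ n, ∀ k ≥ n, f k = 1) → Summable fun k => ‖f k - 1‖ := by
    rintro f ⟨n, hn⟩
    refine summable_of_ne_finset_zero (s := Finset.range n) fun k hk => ?_
    simp [hn k (by simpa using hk)]
  -- Induction on the number of initial factors that are arbitrary; the later ones are `1` or `w k`.
  have key : ∀ n : ℕ, ∀ f : ℕ → ℂ, (∀ k ≥ n, f k = 1 ∨ f k = w k) → (∃ n, ∀ k ≥ n, f k = 1) →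
      inner ℝ (tens 1 norm_one f) v = 0 := by
    intro n
    induction n with
    | zero =>
      rintro f hf ⟨N, hN⟩
      convert hv ((Finset.range N).filter fun k => f k = w k) with k
      by_cases hk : k < N
      · by_cases hfk : f k = w k
        · simp [hk, hfk]
        · simpa [hk, hfk] using (hf k (Nat.zero_le _)).resolve_right hfk
      · simp [hk, hN k (by omega)]
    | succ n ih =>
      intro f hf hN
      have hup : ∀ x : ℂ, (∃ m, ∀ k ≥ m, Function.update f n x k = 1) := by
        intro x
        obtain ⟨N, hN⟩ := hN
        refine ⟨max N (n + 1), fun k hk => ?_⟩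
        rw [Function.update_of_ne (by have := le_of_max_le_right hk; omega)]
        exact hN k (le_of_max_le_left hk)
      have hup2 : ∀ x : ℂ, (x = 1 ∨ x = w n) → ∀ k ≥ n, Function.update f n x k = 1 ∨
          Function.update f n x k = w k := by
        intro x hx k hk
        rcases eq_or_ne k n with rfl | hkn
        · simpa using hx
        · rw [Function.update_of_ne hkn]; exact hf k (by omega)
      -- The coordinates of `f n` in the basis `1, w n`.
      have e : f n = ((f n).re - (f n).im * (w n).re / (w n).im) • (1 : ℂ)
          + ((f n).im / (w n).im) • w n := by
        have := hw n
        apply Complex.ext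
        · simp; ring
        · simp; field_simp
      have h1 := tens_update_linear (h := (1 : ℂ)) norm_one (hsum f hN) n
        ((f n).re - (f n).im * (w n).re / (w n).im) ((f n).im / (w n).im) 1 (w n)
      rw [← e, Function.update_eq_self] at h1
      rw [h1, inner_add_left, real_inner_smul_left, real_inner_smul_left,
        ih _ (hup2 1 (Or.inl rfl)) (hup 1), ih _ (hup2 _ (Or.inr rfl)) (hup _)]
      simp
  refine eq_zero_of_inner_tens norm_one fun f hf => ?_
  have hlim : Tendsto (fun n => tens (1 : ℂ) norm_one fun k => if k < n then f k else 1) atTop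
      (nhds (tens 1 norm_one f)) := by
    refine tendsto_tens norm_one hf (fun k => ?_) (fun n k => ?_) (fun k => le_rfl)
    · refine tendsto_const_nhds.congr' ?_
      filter_upwards [eventually_gt_atTop k] with n hn
      simp [hn]
    · split_ifs <;> simp
  have h0 := (hlim.inner (𝕜 := ℝ) (tendsto_const_nhds (x := v)))
  refine tendsto_nhds_unique h0 (tendsto_const_nhds.congr fun n => ?_)
  symm
  refine key n _ (fun k hk => Or.inl ?_) ⟨n, fun k hk => ?_⟩ <;> simp [not_lt.2 hk]

instance : TopologicalSpace.SeparableSpace TensorH0 := by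
  have hd : Dense (Submodule.span ℝ (Set.range fun s : Finset ℕ =>
      tens (1 : ℂ) norm_one fun k => if k ∈ s then Complex.I else 1) : Set TensorH0) :=
    dense_span_of_inner_eq_zero fun x hx =>
      eq_zero_of_inner_tens_ite (w := fun _ => Complex.I) (by simp) hx
  have h1 := ((Set.countable_range fun s : Finset ℕ =>
      tens (1 : ℂ) norm_one fun k => if k ∈ s then Complex.I else 1).isSeparable.span (R := ℝ))
  have h2 := h1.closure
  rw [hd.closure_eq] at h2
  exact TopologicalSpace.isSeparable_univ_iff.1 h2

/-- A form of Pettis' theorem. Inner products with a total family, together with the norm, make the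
distance to every fixed vector measurable. By separability open sets are countable unions of balls
with rational radii, so their preimages are measurable. -/
theorem stronglyMeasurable_of_inner {Ω : Type*} [MeasurableSpace Ω] {E ι : Type*}
    [NormedAddCommGroup E] [InnerProductSpace ℝ E] [TopologicalSpace.SeparableSpace E] {f : ι → E}
    (hf : Dense (Submodule.span ℝ (Set.range f) : Set E)) {F : Ω → E}
    (hF : ∀ i, Measurable fun ω => inner ℝ (f i) (F ω)) (hn : Measurable fun ω => ‖F ω‖) :
    StronglyMeasurable F := by
  borelize E
  have : SecondCountableTopology E := UniformSpace.secondCountable_of_separable E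
  have h1 : ∀ v : E, Measurable fun ω => inner ℝ v (F ω) := by
    intro v
    obtain ⟨u, hu, huv⟩ := mem_closure_iff_seq_limit.1 (hf v)
    refine measurable_of_tendsto_metrizable (f := fun n ω => inner ℝ (u n) (F ω)) (fun n => ?_) ?_
    · refine Submodule.span_induction (p := fun v _ => Measurable fun ω => inner ℝ v (F ω))
        ?_ ?_ ?_ ?_ (hu n)
      · rintro _ ⟨i, rfl⟩; exact hF i
      · simp
      · intro a b _ _ ha hb
        simp only [inner_add_left]
        exact ha.add hb
      · intro c a _ ha
        simp only [real_inner_smul_left]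
        exact ha.const_mul c
    · rw [tendsto_pi_nhds]
      intro ω
      exact huv.inner tendsto_const_nhds
  have h2 : ∀ v : E, Measurable fun ω => dist (F ω) v := by
    intro v
    have : (fun ω => dist (F ω) v) = fun ω => Real.sqrt (‖F ω‖ ^ 2 - 2 * inner ℝ v (F ω)
        + ‖v‖ ^ 2) := by
      funext ω
      rw [real_inner_comm, ← norm_sub_sq_real, Real.sqrt_sq (norm_nonneg _), dist_eq_norm]
    rw [this]
    exact (((hn.pow_const 2).sub ((h1 v).const_mul 2)).add_const _).sqrt
  refine Measurable.stronglyMeasurable ?_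
  refine measurable_of_isOpen fun U hU => ?_
  obtain ⟨D, hDc, hDd⟩ := TopologicalSpace.exists_countable_dense E
  have hU2 : U = ⋃ p ∈ {p : E × ℚ | p.1 ∈ D ∧ Metric.ball p.1 p.2 ⊆ U},
      Metric.ball p.1 (p.2 : ℝ) := by
    apply Set.Subset.antisymm
    · intro x hx
      obtain ⟨ε, hε, hb⟩ := Metric.isOpen_iff.1 hU x hx
      obtain ⟨d, hd, hxd⟩ := hDd.exists_dist_lt x (half_pos (half_pos hε))
      obtain ⟨q, hq1, hq2⟩ := exists_rat_btwn (show ε / 4 < ε / 2 by linarith)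
      refine Set.mem_biUnion (x := (d, q)) ⟨hd, fun y hy => hb ?_⟩ ?_
      · rw [Metric.mem_ball] at hy ⊢
        have := dist_triangle y d x
        rw [dist_comm d x] at this
        simp only at hy
        linarith
      · rw [Metric.mem_ball]; simp only; linarith
    · exact Set.iUnion₂_subset fun p hp => hp.2
  rw [hU2, Set.preimage_iUnion₂]
  refine MeasurableSet.biUnion ?_ fun p _ => ?_
  · exact (hDc.prod (Set.countable_univ)).mono fun p hp => Set.mem_prod.2 ⟨hp.1, Set.mem_univ _⟩
  · exact measurableSet_lt (h2 p.1) measurable_const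

end TensorH0

/-! ### Exponential vectors of the Fock space -/

section Fock

variable {E : Type*} [NormedAddCommGroup E] [InnerProductSpace ℝ E]

theorem inner_symKernel_gen (k : ℕ) (v w : E) :
    inner ℝ ((symKernel E k).gen v) ((symKernel E k).gen w) = (inner ℝ v w) ^ k :=
  PosKernel.inner_gen _ _ _

theorem inner_expVec (v w : E) : inner ℝ (expVec v) (expVec w) = Real.exp (inner ℝ v w) := by
  rw [lp.inner_eq_tsum, Real.exp_eq_exp_ℝ, NormedSpace.exp_eq_tsum_div]
  refine tsum_congr fun k => ?_
  change inner ℝ ((Real.sqrt (k.factorial : ℝ))⁻¹ • (symKernel E k).gen v)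
    ((Real.sqrt (k.factorial : ℝ))⁻¹ • (symKernel E k).gen w) = _
  rw [real_inner_smul_left, real_inner_smul_right, inner_symKernel_gen, ← mul_assoc, ← mul_inv,
    Real.mul_self_sqrt (Nat.cast_nonneg _)]
  ring

theorem symKernel_gen_smul (k : ℕ) (t : ℝ) (v : E) :
    (symKernel E k).gen (t • v) = t ^ k • (symKernel E k).gen v := by
  rw [← sub_eq_zero]
  refine eq_zero_of_inner_dense (symKernel E k).dense_span_gen fun w => ?_
  rw [inner_sub_right, real_inner_smul_right, inner_symKernel_gen, inner_symKernel_gen,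
    real_inner_smul_right]
  ring

/-- Along the ray `t ↦ expVec (t • v)` the inner product with `Φ` is a power series in `t`. It
vanishes identically, so each coefficient does, and the coefficients are the pairings of `Φ` with
the powers `v ⊗ ⋯ ⊗ v` up to a nonzero factor. -/
theorem eq_zero_of_inner_expVec {Φ : Fock E} (h : ∀ v : E, inner ℝ (expVec v) Φ = 0) : Φ = 0 := by
  ext k : 2
  refine eq_zero_of_inner_dense (symKernel E k).dense_span_gen fun v => ?_
  let a : ℕ → ℝ := fun k => (Real.sqrt (k.factorial : ℝ))⁻¹ *
    inner ℝ ((symKernel E k).gen v) (Φ.1 k)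
  have hs : HasFPowerSeriesAt (0 : ℝ → ℝ) (FormalMultilinearSeries.ofScalars ℝ a) 0 := by
    rw [hasFPowerSeriesAt_iff]
    refine Eventually.of_forall fun t => ?_
    have h1 := lp.hasSum_inner (𝕜 := ℝ) (expVec (t • v)) Φ
    rw [h (t • v)] at h1
    have e : (fun n => t ^ n • (FormalMultilinearSeries.ofScalars ℝ a).coeff n)
        = fun n => inner ℝ ((expVec (t • v)).1 n) (Φ.1 n) := by
      funext n
      change _ = inner ℝ ((Real.sqrt (n.factorial : ℝ))⁻¹ • (symKernel E n).gen (t • v)) (Φ.1 n)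
      rw [FormalMultilinearSeries.coeff_ofScalars, symKernel_gen_smul, real_inner_smul_left,
        real_inner_smul_left, smul_eq_mul]
      ring
    rw [e]
    exact h1
  have h2 := congrArg (fun p => FormalMultilinearSeries.coeff p k) hs.eq_zero
  simp only [FormalMultilinearSeries.coeff_ofScalars] at h2
  have h3 : a k = 0 := h2.trans rfl
  exact (mul_eq_zero.1 h3).resolve_left (by positivity)

theorem continuous_expVec : Continuous (expVec : E → Fock E) := by
  rw [continuous_iff_continuousAt]
  intro v
  rw [ContinuousAt, tendsto_iff_norm_sub_tendsto_zero]
  have h0 : ∀ w : E, ‖expVec w - expVec v‖ = Real.sqrt (Real.exp (inner ℝ w w)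
      - 2 * Real.exp (inner ℝ w v) + Real.exp (inner ℝ v v)) := by
    intro w
    rw [← inner_expVec, ← inner_expVec, ← inner_expVec, real_inner_self_eq_norm_sq,
      real_inner_self_eq_norm_sq, ← norm_sub_sq_real, Real.sqrt_sq (norm_nonneg _)]
  simp only [h0]
  have h1 : Continuous fun w : E => Real.sqrt (Real.exp (inner ℝ w w)
      - 2 * Real.exp (inner ℝ w v) + Real.exp (inner ℝ v v)) := by fun_prop
  convert h1.tendsto v using 2
  rw [show ∀ x : ℝ, x - 2 * x + x = 0 by intro x; ring, Real.sqrt_zero]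

end Fock

/-! ### Finite partitions of a standard Borel space -/

section Bits

variable (X : Type*) [MeasurableSpace X] [StandardBorelSpace X]

/-- The first `N` binary digits of a point, with respect to a generating sequence of sets. -/
def bits (N : ℕ) (x : X) : Fin N → Bool := fun j => MeasurableSpace.mapNatBool X x j

theorem measurable_bits (N : ℕ) : Measurable (bits X N) :=
  measurable_pi_iff.2 fun j => measurable_pi_iff.1 (MeasurableSpace.measurable_mapNatBool (α := X)) j

variable {X}

theorem integral_comp_fintype {X J : Type*} [MeasurableSpace X] [Fintype J] [MeasurableSpace J]
    [MeasurableSingletonClass J] (m : Measure X) [IsFiniteMeasure m] {τ : X → J}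
    (hτ : Measurable τ) (f : J → ℝ) : ∫ x, f (τ x) ∂m = ∑ j, m.real (τ ⁻¹' {j}) * f j := by
  rw [← integral_map hτ.aemeasurable (StronglyMeasurable.of_discrete).aestronglyMeasurable,
    integral_fintype (Integrable.of_finite)]
  refine Finset.sum_congr rfl fun j _ => ?_
  rw [map_measureReal_apply hτ (measurableSet_singleton j), smul_eq_mul]

theorem eq_of_bits_eq {x y : X} (h : ∀ N, bits X N x = bits X N y) : x = y := by
  refine MeasurableSpace.injective_mapNatBool (α := X) (funext fun n => ?_)
  exact congrFun (h (n + 1)) ⟨n, Nat.lt_succ_self n⟩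

theorem bits_eq_of_le {x y : X} {M N : ℕ} (hMN : M ≤ N) (h : bits X N x = bits X N y) :
    bits X M x = bits X M y :=
  funext fun j => congrFun h ⟨j.1, j.2.trans_le hMN⟩

theorem eventually_bits_ne {x y : X} (h : x ≠ y) : ∀ᶠ N in atTop, bits X N x ≠ bits X N y := by
  by_contra hc
  refine h (eq_of_bits_eq fun N => ?_)
  rw [eventually_atTop] at hc
  push Not at hc
  obtain ⟨M, hM, hMe⟩ := hc N
  exact bits_eq_of_le hM hMe

/-- The sum is the average over `x` of the mass of the cell that contains `x`. The cells shrink to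
the point `x`, which is null; this is where the absence of atoms enters the totality in the Fock
space. -/
theorem tendsto_sum_sq_measure {J : Type*} [Fintype J] [MeasurableSpace J]
    [MeasurableSingletonClass J] (m : Measure X) [IsProbabilityMeasure m] [NullSingletonClass m]
    {τ : X → J} (hτ : Measurable τ) :
    Tendsto (fun N => ∑ p : J × (Fin N → Bool),
      m.real ((fun x => (τ x, bits X N x)) ⁻¹' {p}) ^ 2) atTop (nhds 0) := by
  have h1 : ∀ N, ∑ p : J × (Fin N → Bool), m.real ((fun x => (τ x, bits X N x)) ⁻¹' {p}) ^ 2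
      = ∫ x, m.real ((fun y => (τ y, bits X N y)) ⁻¹' {(τ x, bits X N x)}) ∂m := by
    intro N
    rw [integral_comp_fintype m (hτ.prodMk (measurable_bits X N))
      (fun p => m.real ((fun y => (τ y, bits X N y)) ⁻¹' {p}))]
    exact Finset.sum_congr rfl fun p _ => sq _
  simp only [h1]
  rw [← integral_zero X ℝ (μ := m)]
  refine tendsto_integral_of_dominated_convergence (fun _ => 1) (fun N => ?_)
    (integrable_const _) (fun N => Eventually.of_forall fun x => ?_)
    (Eventually.of_forall fun x => ?_)
  · exact ((StronglyMeasurable.of_discrete (f := fun p : J × (Fin N → Bool) =>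
      m.real ((fun y => (τ y, bits X N y)) ⁻¹' {p}))).comp_measurable
        (hτ.prodMk (measurable_bits X N))).aestronglyMeasurable
  · rw [Real.norm_of_nonneg measureReal_nonneg]
    exact measureReal_le_one
  · have h2 : Tendsto (fun N => m {y | bits X N y = bits X N x}) atTop (nhds 0) := by
      have h3 : ⋂ N, {y | bits X N y = bits X N x} = {x} := by
        ext y
        simp only [Set.mem_iInter, Set.mem_ofPred_eq, Set.mem_singleton_iff]
        exact ⟨fun h => eq_of_bits_eq h, fun h N => by rw [h]⟩
      have h4 := tendsto_measure_iInter_atTop (μ := m)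
        (s := fun N => {y | bits X N y = bits X N x})
        (fun N => (measurable_bits X N (measurableSet_singleton (bits X N x))).nullMeasurableSet)
        (fun M N hMN y hy => bits_eq_of_le hMN hy) ⟨0, measure_ne_top _ _⟩
      rw [h3, measure_singleton] at h4
      exact h4
    have h5 := (ENNReal.tendsto_toReal ENNReal.zero_ne_top).comp h2
    refine squeeze_zero (fun _ => measureReal_nonneg) (fun N => ?_) h5
    refine measureReal_mono (fun y hy => ?_) (measure_ne_top _ _)
    exact congrArg Prod.snd hy

end Bits

/-! ### Totality of exponential vectors of step functions -/

section Totality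

/-- The factors are exchanged one at a time. Each exchange costs an error of second order in `t i`,
while the exponential bounds keep the product of the other factors below `exp (D ∑ t i)`. -/
theorem abs_prod_sub_prod_le {ι : Type*} (s : Finset ι) {a c t : ι → ℝ} {D : ℝ} (hD : 0 ≤ D)
    (h : ∀ i ∈ s, |a i - c i| ≤ D * t i ^ 2) (ht : ∀ i ∈ s, 0 ≤ t i)
    (ha : ∀ i ∈ s, |a i| ≤ Real.exp (D * t i)) (hc : ∀ i ∈ s, |c i| ≤ Real.exp (D * t i)) :
    |∏ i ∈ s, a i - ∏ i ∈ s, c i| ≤ Real.exp (D * ∑ i ∈ s, t i) * (D * ∑ i ∈ s, t i ^ 2) := by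
  classical
  induction s using Finset.induction_on with
  | empty => simp
  | insert i s his ih =>
    simp only [Finset.mem_insert, forall_eq_or_imp] at h ht ha hc
    rw [Finset.prod_insert his, Finset.prod_insert his, Finset.sum_insert his,
      Finset.sum_insert his]
    have h1 := ih h.2 ht.2 ha.2 hc.2
    have h2 : |∏ j ∈ s, c j| ≤ Real.exp (D * ∑ j ∈ s, t j) := by
      rw [Finset.abs_prod, Finset.mul_sum, Real.exp_sum]
      exact Finset.prod_le_prod (fun _ _ => abs_nonneg _) hc.2
    have e : a i * ∏ j ∈ s, a j - c i * ∏ j ∈ s, c j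
        = a i * (∏ j ∈ s, a j - ∏ j ∈ s, c j) + (a i - c i) * ∏ j ∈ s, c j := by ring
    rw [e, mul_add D, Real.exp_add]
    refine (abs_add_le _ _).trans ?_
    rw [abs_mul, abs_mul]
    have h3 : |a i| * |∏ j ∈ s, a j - ∏ j ∈ s, c j| ≤ Real.exp (D * t i) *
        (Real.exp (D * ∑ j ∈ s, t j) * (D * ∑ j ∈ s, t j ^ 2)) :=
      mul_le_mul ha.1 h1 (abs_nonneg _) (Real.exp_pos _).le
    have h4 : |a i - c i| * |∏ j ∈ s, c j| ≤ (D * t i ^ 2) * Real.exp (D * ∑ j ∈ s, t j) :=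
      mul_le_mul h.1 h2 (abs_nonneg _) (by positivity)
    have h5 : (1 : ℝ) ≤ Real.exp (D * t i) := Real.one_le_exp (mul_nonneg hD ht.1)
    have h6 : (D * t i ^ 2) * Real.exp (D * ∑ j ∈ s, t j) ≤
        Real.exp (D * t i) * ((D * t i ^ 2) * Real.exp (D * ∑ j ∈ s, t j)) :=
      le_mul_of_one_le_left (by positivity) h5
    linarith

theorem abs_exp_sub_one_sub_le (x : ℝ) : |Real.exp x - 1 - x| ≤ x ^ 2 * Real.exp |x| := by
  have := Complex.norm_exp_sub_sum_le_norm_mul_exp (x : ℂ) 2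
  rw [Complex.norm_real, Real.norm_eq_abs, sq_abs] at this
  refine le_trans (le_of_eq ?_) this
  rw [← Real.norm_eq_abs, ← Complex.norm_real]
  congr 1
  push_cast [Finset.sum_range_succ]
  simp
  ring

/-- A finite exponential sum with the first order behaviour of `exp (q t)` at `t = 0`. -/
theorem exists_expSum_bound {κ : Type*} (s : Finset κ) (c x : κ → ℝ) (q : ℝ)
    (hc : ∑ i ∈ s, c i = 1) (hq : ∑ i ∈ s, c i * x i = q) :
    ∃ D, 0 ≤ D ∧ ∀ t, 0 ≤ t → t ≤ 1 →
      |∑ i ∈ s, c i * Real.exp (t * x i) - Real.exp (t * q)| ≤ D * t ^ 2 ∧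
      |∑ i ∈ s, c i * Real.exp (t * x i)| ≤ Real.exp (D * t) ∧
      |Real.exp (t * q)| ≤ Real.exp (D * t) := by
  set D₁ := ∑ i ∈ s, |c i| * (x i ^ 2 * Real.exp |x i|) with hD₁
  have hD₁0 : 0 ≤ D₁ := Finset.sum_nonneg fun i _ => by positivity
  have h1 : ∀ y t : ℝ, 0 ≤ t → t ≤ 1 →
      |Real.exp (t * y) - 1 - t * y| ≤ (y ^ 2 * Real.exp |y|) * t ^ 2 := by
    intro y t ht0 ht1
    refine (abs_exp_sub_one_sub_le (t * y)).trans ?_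
    have : Real.exp |t * y| ≤ Real.exp |y| := by
      rw [Real.exp_le_exp, abs_mul, abs_of_nonneg ht0]
      exact mul_le_of_le_one_left (abs_nonneg _) ht1
    calc (t * y) ^ 2 * Real.exp |t * y| ≤ (t * y) ^ 2 * Real.exp |y| := by gcongr
      _ = _ := by ring
  have h2 : ∀ t : ℝ, 0 ≤ t → t ≤ 1 →
      |∑ i ∈ s, c i * Real.exp (t * x i) - 1 - t * q| ≤ D₁ * t ^ 2 := by
    intro t ht0 ht1
    have e : ∑ i ∈ s, c i * Real.exp (t * x i) - 1 - t * q
        = ∑ i ∈ s, c i * (Real.exp (t * x i) - 1 - t * x i) := by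
      simp only [mul_sub, Finset.sum_sub_distrib, mul_one, hc, ← hq, Finset.mul_sum]
      congr 1
      exact Finset.sum_congr rfl fun i _ => by ring
    rw [e, hD₁, Finset.sum_mul]
    refine (Finset.abs_sum_le_sum_abs _ _).trans (Finset.sum_le_sum fun i _ => ?_)
    rw [abs_mul, mul_assoc]
    exact mul_le_mul_of_nonneg_left (h1 _ _ ht0 ht1) (abs_nonneg _)
  set D₂ := q ^ 2 * Real.exp |q| with hD₂
  have hD₂0 : 0 ≤ D₂ := by positivity
  -- `D₁` and `D₂` bound the second order remainders of the two functions, and `|q|` absorbs their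
  -- common first order term in the exponential bounds.
  refine ⟨D₁ + D₂ + |q|, by positivity, fun t ht0 ht1 => ⟨?_, ?_, ?_⟩⟩
  · have h3 := h2 t ht0 ht1
    have h4 := h1 q t ht0 ht1
    have e : ∑ i ∈ s, c i * Real.exp (t * x i) - Real.exp (t * q)
        = (∑ i ∈ s, c i * Real.exp (t * x i) - 1 - t * q) - (Real.exp (t * q) - 1 - t * q) := by
      ring
    rw [e]
    refine (abs_sub _ _).trans ?_
    nlinarith [mul_nonneg (abs_nonneg q) (sq_nonneg t)]
  · have h3 := (abs_le.1 (h2 t ht0 ht1))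
    have h4 := Real.add_one_le_exp ((D₁ + D₂ + |q|) * t)
    have h5 : t ^ 2 ≤ t := by nlinarith
    have h6 := neg_abs_le (t * q)
    have h7 := le_abs_self (t * q)
    rw [abs_mul, abs_of_nonneg ht0] at h6 h7
    have h8 : D₁ * t ^ 2 ≤ D₁ * t := mul_le_mul_of_nonneg_left h5 hD₁0
    have h9 : 0 ≤ D₂ * t := by positivity
    rw [abs_le]
    constructor <;> nlinarith
  · rw [abs_of_pos (Real.exp_pos _), Real.exp_le_exp]
    have h7 := le_abs_self (t * q)
    rw [abs_mul, abs_of_nonneg ht0] at h7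
    nlinarith [mul_nonneg hD₁0 ht0, mul_nonneg hD₂0 ht0]

variable {X : Type*} [MeasurableSpace X] {K : Type*} [NormedAddCommGroup K]
  [InnerProductSpace ℝ K] (m : Measure X)

theorem memLp_step {K : Type*} [NormedAddCommGroup K] [IsFiniteMeasure m] {J : Type*} [Finite J] [MeasurableSpace J]
    [MeasurableSingletonClass J] {τ : X → J} (hτ : Measurable τ) (v : J → K) :
    MemLp (fun x => v (τ x)) 2 m := by
  obtain ⟨C, hC⟩ := (Set.finite_range fun j => ‖v j‖).bddAbove
  exact MemLp.of_bound ((StronglyMeasurable.of_discrete (f := v)).comp_measurable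
    hτ).aestronglyMeasurable C (Eventually.of_forall fun x => hC ⟨τ x, rfl⟩)

/-- The class of a step function. -/
def stepVec [IsFiniteMeasure m] {J : Type*} [Finite J] [MeasurableSpace J]
    [MeasurableSingletonClass J] {τ : X → J} (hτ : Measurable τ) (v : J → K) : Lp K 2 m :=
  (memLp_step m hτ v).toLp _

theorem inner_stepVec [IsFiniteMeasure m] {J : Type*} [Fintype J]
    [MeasurableSpace J] [MeasurableSingletonClass J] {τ : X → J} (hτ : Measurable τ)
    (v w : J → K) : inner ℝ (stepVec m hτ v) (stepVec m hτ w)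
      = ∑ j, m.real (τ ⁻¹' {j}) * inner ℝ (v j) (w j) := by
  rw [L2.inner_def, ← integral_comp_fintype m hτ fun j => inner ℝ (v j) (w j)]
  refine integral_congr_ae ?_
  filter_upwards [(memLp_step m hτ v).coeFn_toLp, (memLp_step m hτ w).coeFn_toLp] with x h1 h2
  rw [stepVec, stepVec, h1, h2]

/-- The signed average of exponential vectors of step functions approximates the exponential
vector of the averaged step function. -/
theorem norm_sq_average_sub [IsFiniteMeasure m] {J : Type*} [Fintype J]
    [DecidableEq J] [MeasurableSpace J] [MeasurableSingletonClass J] {τ : X → J}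
    (hτ : Measurable τ) {P : Type*} (k : P → K) (s : Finset P) (c : J → P → ℝ) (v : J → K) :
    ‖∑ σ ∈ Fintype.piFinset (fun _ : J => s), (∏ j, c j (σ j)) •
        expVec (stepVec m hτ fun j => k (σ j)) - expVec (stepVec m hτ v)‖ ^ 2
      = ∏ j, (∑ p ∈ s ×ˢ s, c j p.1 * c j p.2 *
          Real.exp (m.real (τ ⁻¹' {j}) * inner ℝ (k p.1) (k p.2)))
        - 2 * ∏ j, (∑ p ∈ s, c j p * Real.exp (m.real (τ ⁻¹' {j}) * inner ℝ (k p) (v j)))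
        + ∏ j, Real.exp (m.real (τ ⁻¹' {j}) * inner ℝ (v j) (v j)) := by
  -- Inner products of exponential vectors of step functions factor over the cells, so the sum over
  -- all choices `σ` becomes a product over cells of sums.
  have h1 : ∀ w : J → K, inner ℝ (∑ σ ∈ Fintype.piFinset (fun _ : J => s), (∏ j, c j (σ j)) •
        expVec (stepVec m hτ fun j => k (σ j))) (expVec (stepVec m hτ w))
      = ∏ j, (∑ p ∈ s, c j p * Real.exp (m.real (τ ⁻¹' {j}) * inner ℝ (k p) (w j))) := by
    intro w
    rw [sum_inner, Finset.prod_univ_sum]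
    refine Finset.sum_congr rfl fun σ _ => ?_
    rw [real_inner_smul_left, inner_expVec, inner_stepVec, Real.exp_sum, Finset.prod_mul_distrib]
  rw [norm_sub_sq_real, h1, ← real_inner_self_eq_norm_sq (expVec _), inner_expVec, inner_stepVec,
    Real.exp_sum, ← real_inner_self_eq_norm_sq, inner_sum]
  congr 2
  simp only [real_inner_smul_right, h1]
  simp only [← Finset.prod_mul_distrib]
  rw [← Finset.prod_univ_sum (fun _ => s) (fun j q => c j q * ∑ p ∈ s, c j p *
    Real.exp (m.real (τ ⁻¹' {j}) * inner ℝ (k p) (k q)))]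
  refine Finset.prod_congr rfl fun j _ => ?_
  rw [Finset.sum_product_right]
  refine Finset.sum_congr rfl fun q _ => ?_
  rw [Finset.mul_sum]
  exact Finset.sum_congr rfl fun p _ => by ring


/-- Write each value as `v j = ∑ c_p k p` with `∑ c_p = 1`. Divide the cells into small pieces and
choose in each piece, independently, the value `k p` with signed weight `c_p`. A piece of mass `t`
contributes to the averaged inner products a factor `exp (t ‖v j‖²) + O(t²)`. As the sum of the `t²`
tends to `0`, the signed averages converge to the exponential vector of `v`. -/
theorem eq_zero_of_inner_expVec_step_span [StandardBorelSpace X] [IsProbabilityMeasure m]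
    [NullSingletonClass m] {P : Type*} {k : P → K} {p₀ : P} (hp₀ : k p₀ = 0) {Φ : Fock (Lp K 2 m)}
    (h : ∀ (J : Type) [Fintype J] [MeasurableSpace J] [MeasurableSingletonClass J] (τ : X → J)
      (hτ : Measurable τ) (σ : J → P), inner ℝ (expVec (stepVec m hτ fun j => k (σ j))) Φ = 0)
    (J : Type) [Fintype J] [MeasurableSpace J] [MeasurableSingletonClass J] {τ : X → J}
    (hτ : Measurable τ) (v : J → K) (hv : ∀ j, v j ∈ Submodule.span ℝ (Set.range k)) :
    inner ℝ (expVec (stepVec m hτ v)) Φ = 0 := by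
  classical
  have h1 : ∀ j, ∃ (c : P →₀ ℝ), Finsupp.linearCombination ℝ k c = v j := fun j =>
    (Finsupp.mem_span_range_iff_exists_finsupp (v := k)).1 (hv j)
  choose c₀ hc₀ using h1
  set s : Finset P := insert p₀ (Finset.univ.biUnion fun j => (c₀ j).support) with hs
  have hsup : ∀ j, (c₀ j).support ⊆ s := fun j =>
    (Finset.subset_biUnion_of_mem (fun j => (c₀ j).support) (Finset.mem_univ j)).trans
      (Finset.subset_insert _ _)
  have hps : p₀ ∈ s := Finset.mem_insert_self _ _
  -- The missing weight is put on `p₀`, where `k` vanishes: the total weight becomes `1` and the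
  -- combination does not change.
  set c : J → P → ℝ := fun j p => c₀ j p + if p = p₀ then 1 - ∑ q ∈ s, c₀ j q else 0 with hc
  have hc1 : ∀ j, ∑ p ∈ s, c j p = 1 := fun j => by
    simp only [hc, Finset.sum_add_distrib, Finset.sum_ite_eq', hps, if_true]
    ring
  have hcv : ∀ j, ∑ p ∈ s, c j p • k p = v j := fun j => by
    rw [← hc₀ j, Finsupp.linearCombination_apply, Finsupp.sum_of_support_subset _ (hsup j) _
      (by simp)]
    refine Finset.sum_congr rfl fun p _ => ?_
    by_cases hp : p = p₀
    · rw [hp, hp₀, smul_zero, smul_zero]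
    · simp [hc, hp]
  have hA := fun j => exists_expSum_bound (s ×ˢ s) (fun p => c j p.1 * c j p.2)
    (fun p => inner ℝ (k p.1) (k p.2)) (inner ℝ (v j) (v j))
    (by rw [Finset.sum_product, ← Finset.sum_mul_sum, hc1, one_mul])
    (by
      rw [Finset.sum_product, ← hcv j, sum_inner]
      refine Finset.sum_congr rfl fun p _ => ?_
      rw [inner_sum]
      refine Finset.sum_congr rfl fun q _ => ?_
      rw [real_inner_smul_left, real_inner_smul_right, mul_assoc])
  have hB := fun j => exists_expSum_bound s (c j) (fun p => inner ℝ (k p) (v j))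
    (inner ℝ (v j) (v j)) (hc1 j)
    (by
      conv_rhs => rw [← hcv j, sum_inner]
      refine Finset.sum_congr rfl fun p _ => ?_
      rw [real_inner_smul_left, hcv j])
  choose DA hDA0 hDA using hA
  choose DB hDB0 hDB using hB
  set D := ∑ j, (DA j + DB j) with hD
  have hDj : ∀ j, DA j + DB j ≤ D := fun j =>
    Finset.single_le_sum (f := fun j => DA j + DB j)
      (fun j _ => add_nonneg (hDA0 j) (hDB0 j)) (Finset.mem_univ j)
  have hD0 : 0 ≤ D := Finset.sum_nonneg fun j _ => add_nonneg (hDA0 j) (hDB0 j)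
  let g : ∀ N, X → J × (Fin N → Bool) := fun N x => (τ x, bits X N x)
  have hg : ∀ N, Measurable (g N) := fun N => hτ.prodMk (measurable_bits X N)
  let t : ∀ N, J × (Fin N → Bool) → ℝ := fun N p => m.real (g N ⁻¹' {p})
  have ht0 : ∀ N p, 0 ≤ t N p := fun N p => measureReal_nonneg
  have ht1 : ∀ N p, t N p ≤ 1 := fun N p => measureReal_le_one
  have hts : ∀ N, ∑ p, t N p = 1 := fun N => by
    have := integral_comp_fintype m (hg N) fun _ => (1 : ℝ)
    simpa using this.symm
  have hsq : Tendsto (fun N => ∑ p, t N p ^ 2) atTop (nhds 0) := tendsto_sum_sq_measure m hτ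
  have hlim0 : ∀ {a : J → ℝ → ℝ} {q : J → ℝ} {D' : J → ℝ}, (∀ j, 0 ≤ D' j) → (∀ j, D' j ≤ D) →
      (∀ j t, 0 ≤ t → t ≤ 1 → |a j t - Real.exp (t * q j)| ≤ D' j * t ^ 2 ∧
        |a j t| ≤ Real.exp (D' j * t) ∧ |Real.exp (t * q j)| ≤ Real.exp (D' j * t)) →
      Tendsto (fun N => ∏ p, a p.1 (t N p) - ∏ p, Real.exp (t N p * q p.1)) atTop (nhds 0) := by
    intro a q D' hD'0 hD'D ha
    have hb := (hsq.const_mul D).const_mul (Real.exp D)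
    rw [mul_zero, mul_zero] at hb
    refine squeeze_zero_norm (fun N => ?_) hb
    rw [Real.norm_eq_abs]
    have := abs_prod_sub_prod_le Finset.univ (a := fun p => a p.1 (t N p))
      (c := fun p => Real.exp (t N p * q p.1)) (t := t N) hD0
      (fun p _ => ((ha p.1 _ (ht0 N p) (ht1 N p)).1).trans
        (mul_le_mul_of_nonneg_right (hD'D _) (sq_nonneg _)))
      (fun p _ => ht0 N p)
      (fun p _ => ((ha p.1 _ (ht0 N p) (ht1 N p)).2.1).trans
        (Real.exp_le_exp.2 (mul_le_mul_of_nonneg_right (hD'D _) (ht0 N p))))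
      (fun p _ => ((ha p.1 _ (ht0 N p) (ht1 N p)).2.2).trans
        (Real.exp_le_exp.2 (mul_le_mul_of_nonneg_right (hD'D _) (ht0 N p))))
    rwa [hts, mul_one] at this
  have hlA := hlim0 hDA0 (fun j => (le_add_of_nonneg_right (hDB0 j)).trans (hDj j)) hDA
  have hlB := hlim0 hDB0 (fun j => (le_add_of_nonneg_left (hDA0 j)).trans (hDj j)) hDB
  let Avg : ℕ → Fock (Lp K 2 m) := fun N =>
    ∑ σ ∈ Fintype.piFinset (fun _ : J × (Fin N → Bool) => s), (∏ j, c j.1 (σ j)) •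
      expVec (stepVec m (hg N) fun j => k (σ j))
  -- Refining the partition does not change the function `x ↦ v (τ x)`.
  have hstep : ∀ N, stepVec m (hg N) (fun p => v p.1) = stepVec m hτ v := fun N => rfl
  have hAvg : Tendsto Avg atTop (nhds (expVec (stepVec m hτ v))) := by
    rw [tendsto_iff_norm_sub_tendsto_zero]
    have h2 : Tendsto (fun N => ‖Avg N - expVec (stepVec m hτ v)‖ ^ 2) atTop (nhds 0) := by
      have h3 := hlA.sub (hlB.const_mul 2)
      rw [mul_zero, sub_zero] at h3
      refine h3.congr fun N => ?_
      rw [← hstep N, norm_sq_average_sub m (hg N) k s (fun j => c j.1) (fun p => v p.1)]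
      ring
    have h4 := h2.sqrt
    simpa [Real.sqrt_sq] using h4
  have h5 := hAvg.inner (𝕜 := ℝ) (tendsto_const_nhds (x := Φ))
  refine tendsto_nhds_unique h5 (tendsto_const_nhds.congr fun N => ?_)
  rw [sum_inner]
  refine (Finset.sum_eq_zero fun σ _ => ?_).symm
  rw [real_inner_smul_left, h, mul_zero]

theorem stepVec_dense [IsFiniteMeasure m] {S : Submodule ℝ K} (hS : Dense (S : Set K))
    (f : Lp K 2 m) : f ∈ closure {f : Lp K 2 m | ∃ (n : ℕ) (τ : X → Fin n) (hτ : Measurable τ)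
      (v : Fin n → K), (∀ j, v j ∈ S) ∧ f = stepVec m hτ v} := by
  set D := {f : Lp K 2 m | ∃ (n : ℕ) (τ : X → Fin n) (hτ : Measurable τ)
      (v : Fin n → K), (∀ j, v j ∈ S) ∧ f = stepVec m hτ v} with hD
  have hadd : ∀ f ∈ D, ∀ g ∈ D, f + g ∈ D := by
    rintro _ ⟨n, τ, hτ, v, hv, rfl⟩ _ ⟨n', τ', hτ', v', hv', rfl⟩
    refine ⟨n * n', fun x => finProdFinEquiv (τ x, τ' x),
      (measurable_of_finite _).comp (hτ.prodMk hτ'),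
      fun j => v (finProdFinEquiv.symm j).1 + v' (finProdFinEquiv.symm j).2,
      fun j => S.add_mem (hv _) (hv' _), ?_⟩
    rw [stepVec, stepVec, ← MemLp.toLp_add]
    refine MemLp.toLp_congr _ _ (Eventually.of_forall fun x => ?_)
    simp
  refine Lp.induction (by norm_num) (fun f : Lp K 2 m => f ∈ closure D) ?_ ?_ isClosed_closure f
  · intro c s hs hμs
    rw [Lp.simpleFunc.coe_indicatorConst]
    classical
    have hτ : Measurable fun x => if x ∈ s then (1 : Fin 2) else 0 :=
      Measurable.ite hs measurable_const measurable_const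
    have e : ∀ c' : K, indicatorConstLp 2 hs hμs.ne c' = stepVec m hτ ![0, c'] := fun c' => by
      rw [stepVec, indicatorConstLp]
      refine MemLp.toLp_congr _ _ (Eventually.of_forall fun x => ?_)
      by_cases hx : x ∈ s <;> simp [hx]
    have hcont : Continuous fun c' : K => indicatorConstLp 2 hs hμs.ne (μ := m) c' := by
      refine (LipschitzWith.of_dist_le' (K := m.real s ^ (1 / (2 : ℝ≥0∞).toReal))
        fun a b => ?_).continuous
      rw [dist_eq_norm, dist_eq_norm, indicatorConstLp_sub,
        norm_indicatorConstLp (by norm_num) (by norm_num), mul_comm]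
    refine map_mem_closure hcont (hS c) fun c' hc' => ?_
    rw [e]
    refine ⟨2, _, hτ, _, fun j => ?_, rfl⟩
    fin_cases j
    · exact S.zero_mem
    · exact hc'
  · intro f g hf hg _ hfD hgD
    exact map_mem_closure₂ continuous_add hfD hgD hadd

/-- Exponential vectors of step functions with values in a total set which contains `0` are
total in the Fock space. -/
theorem eq_zero_of_inner_expVec_step [StandardBorelSpace X] [IsProbabilityMeasure m]
    [NullSingletonClass m] {P : Type*} {k : P → K} {p₀ : P} (hp₀ : k p₀ = 0)
    (hk : Dense (Submodule.span ℝ (Set.range k) : Set K)) {Φ : Fock (Lp K 2 m)}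
    (h : ∀ (J : Type) [Fintype J] [MeasurableSpace J] [MeasurableSingletonClass J] (τ : X → J)
      (hτ : Measurable τ) (σ : J → P), inner ℝ (expVec (stepVec m hτ fun j => k (σ j))) Φ = 0) :
    Φ = 0 := by
  refine eq_zero_of_inner_expVec fun f => ?_
  have hcl : IsClosed {f : Lp K 2 m | inner ℝ (expVec f) Φ = 0} :=
    isClosed_eq (continuous_expVec.inner continuous_const) continuous_const
  refine closure_minimal (s := {f : Lp K 2 m | ∃ (n : ℕ) (τ : X → Fin n) (hτ : Measurable τ)
      (v : Fin n → K), (∀ j, v j ∈ Submodule.span ℝ (Set.range k)) ∧ f = stepVec m hτ v})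
      ?_ hcl (stepVec_dense m hk f)
  rintro _ ⟨n, τ, hτ, v, hv, rfl⟩
  exact eq_zero_of_inner_expVec_step_span m hp₀ h (Fin n) hτ v hv

end Totality

/-! ### Infinite product measures -/

section InfiniteProduct

variable {Y : Type*} [MeasurableSpace Y] (μ : Measure Y) [IsProbabilityMeasure μ]

/-- The sequence with first term `p.1` followed by the sequence `p.2`. -/
def consSeq (p : Y × (ℕ → Y)) : ℕ → Y
  | 0 => p.1
  | n + 1 => p.2 n

theorem measurable_consSeq : Measurable (consSeq (Y := Y)) := by
  refine measurable_pi_iff.2 fun n => ?_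
  cases n with
  | zero => exact measurable_fst
  | succ n => exact (measurable_pi_apply n).comp measurable_snd

/-- An independent first term may be split off from an independent sequence; this is the renewal
step in the recursion for Poisson expectations. -/
theorem map_consSeq : (μ.prod (Measure.infinitePi fun _ : ℕ => μ)).map consSeq
    = Measure.infinitePi fun _ : ℕ => μ := by
  classical
  refine Measure.eq_infinitePi _ fun s t ht => ?_
  -- Padding with the whole space turns the cylinder over `s` into one over an initial segment,
  -- which is compatible with the shift.
  set t' : ℕ → Set Y := fun i => if i ∈ s then t i else Set.univ with ht'
  have ht'm : ∀ i, MeasurableSet (t' i) := fun i => by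
    simp only [ht']; split_ifs
    exacts [ht i, MeasurableSet.univ]
  obtain ⟨n, hn⟩ : ∃ n, s ⊆ Finset.range (n + 1) := by
    obtain ⟨n, hn⟩ := s.exists_nat_subset_range
    exact ⟨n, hn.trans (Finset.range_mono (Nat.le_succ n))⟩
  have h1 : consSeq ⁻¹' (Set.pi s t) = t' 0 ×ˢ
      Set.pi (Finset.range n : Set ℕ) (fun k => t' (k + 1)) := by
    ext ⟨a, ω⟩
    simp only [Set.mem_preimage, Set.mem_pi, Finset.mem_coe, Set.mem_prod, Finset.mem_range, ht']
    constructor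
    · intro h
      refine ⟨?_, fun k hk => ?_⟩
      · split_ifs with h0
        exacts [h 0 h0, trivial]
      · split_ifs with h0
        exacts [h (k + 1) h0, trivial]
    · rintro ⟨h0, hk⟩ i hi
      cases i with
      | zero => simpa [hi, consSeq] using h0
      | succ k =>
        have := hk k (by have := hn hi; simpa using this)
        simpa [hi, consSeq] using this
  rw [Measure.map_apply measurable_consSeq (MeasurableSet.pi s.countable_toSet fun i _ => ht i),
    h1, Measure.prod_prod, Measure.infinitePi_pi _ (fun i _ => ht'm _), mul_comm,
    ← Finset.prod_range_succ' (fun k => μ (t' k)), ← Finset.prod_subset hn]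
  · exact Finset.prod_congr rfl fun i hi => by simp [ht', hi]
  · intro i _ hi
    simp [ht', hi]

theorem map_update_infinitePi (j : ℕ) :
    ((Measure.infinitePi fun _ : ℕ => μ).prod μ).map (fun p => Function.update p.1 j p.2)
      = Measure.infinitePi fun _ : ℕ => μ := by
  classical
  refine Measure.eq_infinitePi _ fun s t ht => ?_
  have h1 : (fun p : (ℕ → Y) × Y => Function.update p.1 j p.2) ⁻¹' (Set.pi s t)
      = Set.pi (s.erase j : Finset ℕ) t ×ˢ (if j ∈ s then t j else Set.univ) := by
    ext ⟨ω, y⟩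
    simp only [Set.mem_preimage, Set.mem_pi, Finset.mem_coe, Set.mem_prod, Finset.mem_erase]
    constructor
    · intro h
      refine ⟨fun i hi => by simpa [hi.1] using h i hi.2, ?_⟩
      split_ifs with hj
      · simpa using h j hj
      · trivial
    · rintro ⟨h, hy⟩ i hi
      rcases eq_or_ne i j with rfl | hij
      · simpa [hi] using hy
      · simpa [hij] using h i ⟨hij, hi⟩
  have hm : Measurable (fun p : (ℕ → Y) × Y => Function.update p.1 j p.2) := by
    refine measurable_pi_iff.2 fun i => ?_
    rcases eq_or_ne i j with rfl | hij
    · simpa using measurable_snd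
    · simp only [Function.update_of_ne hij]
      exact (measurable_pi_apply i).comp measurable_fst
  rw [Measure.map_apply hm (MeasurableSet.pi s.countable_toSet fun i _ => ht i), h1,
    Measure.prod_prod, Measure.infinitePi_pi _ (fun i _ => ht i)]
  by_cases hj : j ∈ s
  · rw [if_pos hj, Finset.prod_erase_mul _ _ hj]
  · rw [if_neg hj, measure_univ, mul_one, Finset.erase_eq_of_notMem hj]

/-- Resampling the `j`-th coordinate independently preserves the law, so Fubini reduces a null set
to its slices in that coordinate with all the others frozen. -/
theorem infinitePi_null_of_slices (j : ℕ) {D : Set (ℕ → Y)} (hD : MeasurableSet D)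
    (h : ∀ ω, μ {y | Function.update ω j y ∈ D} = 0) :
    Measure.infinitePi (fun _ : ℕ => μ) D = 0 := by
  have hm : Measurable (fun p : (ℕ → Y) × Y => Function.update p.1 j p.2) := by
    refine measurable_pi_iff.2 fun i => ?_
    rcases eq_or_ne i j with rfl | hij
    · simpa using measurable_snd
    · simp only [Function.update_of_ne hij]
      exact (measurable_pi_apply i).comp measurable_fst
  rw [← map_update_infinitePi μ j, Measure.map_apply hm hD, Measure.prod_apply (hm hD)]
  simp only [lintegral_eq_zero_iff' (measurable_measure_prodMk_left (hm hD)).aemeasurable]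
  exact Eventually.of_forall fun ω => h ω

theorem lintegral_infinitePi_cons {f : (ℕ → Y) → ℝ≥0∞} (hf : Measurable f) :
    ∫⁻ ω, f ω ∂(Measure.infinitePi fun _ : ℕ => μ)
      = ∫⁻ y, ∫⁻ ω, f (consSeq (y, ω)) ∂(Measure.infinitePi fun _ : ℕ => μ) ∂μ := by
  conv_lhs => rw [← map_consSeq μ]
  rw [lintegral_map hf measurable_consSeq,
    lintegral_prod (fun p => f (consSeq p)) (hf.comp measurable_consSeq).aemeasurable]

theorem integral_infinitePi_cons {f : (ℕ → Y) → ℝ}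
    (hf : Integrable f (Measure.infinitePi fun _ : ℕ => μ)) :
    ∫ ω, f ω ∂(Measure.infinitePi fun _ : ℕ => μ)
      = ∫ y, ∫ ω, f (consSeq (y, ω)) ∂(Measure.infinitePi fun _ : ℕ => μ) ∂μ := by
  conv_lhs => rw [← map_consSeq μ]
  rw [← map_consSeq μ] at hf
  rw [integral_map measurable_consSeq.aemeasurable hf.1, integral_prod]
  exact (integrable_map_measure hf.1 measurable_consSeq.aemeasurable).1 hf

end InfiniteProduct

/-! ### Expectations of products over the points of a Poisson process -/

section Poisson

theorem expMeasure_one : expMeasure 1 =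
    (volume.restrict (Set.Ioi 0)).withDensity fun s => ENNReal.ofReal (Real.exp (-s)) := by
  have h0 : expMeasure 1 = volume.withDensity (exponentialPDF 1) := rfl
  rw [h0, ← withDensity_indicator measurableSet_Ioi]
  refine withDensity_congr_ae ?_
  have h1 : ∀ᵐ s : ℝ, s ≠ 0 := by simp [ae_iff, measure_singleton]
  filter_upwards [h1] with s hs
  rcases lt_or_gt_of_ne hs with h | h
  · rw [exponentialPDF_of_neg h, Set.indicator_of_notMem (by simpa using h.le)]
  · rw [exponentialPDF_of_nonneg h.le, Set.indicator_of_mem (by simpa using h)]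
    simp

instance : IsProbabilityMeasure (expMeasure 1) := isProbabilityMeasure_expMeasure one_pos

theorem ae_expMeasure_pos : ∀ᵐ s ∂(expMeasure 1), 0 < s := by
  rw [expMeasure_one]
  exact (withDensity_absolutelyContinuous _ _).ae_le (ae_restrict_mem measurableSet_Ioi)

theorem integral_expMeasure (f : ℝ → ℝ) :
    ∫ s, f s ∂(expMeasure 1) = ∫ s in Set.Ioi 0, Real.exp (-s) * f s := by
  rw [expMeasure_one, integral_withDensity_eq_integral_toReal_smul (by fun_prop)
    (Eventually.of_forall fun _ => ENNReal.ofReal_lt_top)]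
  simp [ENNReal.toReal_ofReal (Real.exp_pos _).le]

variable {X : Type*} [MeasurableSpace X] (m : Measure X) [IsProbabilityMeasure m]

/-- The law of the independent waiting times and marks. -/
abbrev markLaw : Measure (ℕ → ℝ × X) := Measure.infinitePi fun _ : ℕ => (expMeasure 1).prod m

theorem ae_mark_pos : ∀ᵐ p ∂((expMeasure 1).prod m), 0 < p.1 :=
  Measure.quasiMeasurePreserving_fst.ae ae_expMeasure_pos

theorem ae_markLaw_pos : ∀ᵐ ω ∂(markLaw m), ∀ k, 0 < (ω k).1 := by
  rw [ae_all_iff]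
  intro k
  have h := Measure.infinitePi_map_eval (fun _ : ℕ => (expMeasure 1).prod m) k
  have h1 := ae_mark_pos m
  rw [← h] at h1
  exact ae_of_ae_map (measurable_pi_apply k).aemeasurable h1

/-- The `n`-th arrival time. -/
def arrival (ω : ℕ → ℝ × X) (n : ℕ) : ℝ := ∑ j ∈ Finset.range n, (ω j).1

theorem arrival_zero (ω : ℕ → ℝ × X) : arrival ω 0 = 0 := rfl

theorem arrival_succ (ω : ℕ → ℝ × X) (n : ℕ) : arrival ω (n + 1) = arrival ω n + (ω n).1 :=
  Finset.sum_range_succ _ _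

theorem arrival_consSeq (p : ℝ × X) (ω : ℕ → ℝ × X) (n : ℕ) :
    arrival (consSeq (p, ω)) (n + 1) = p.1 + arrival ω n := by
  unfold arrival
  rw [Finset.sum_range_succ', add_comm]
  rfl

theorem measurable_arrival (n : ℕ) : Measurable fun ω : ℕ → ℝ × X => arrival ω n :=
  Finset.measurable_sum _ fun j _ => measurable_fst.comp (measurable_pi_apply j)

theorem arrival_nonneg {ω : ℕ → ℝ × X} (h : ∀ k, 0 < (ω k).1) (n : ℕ) : 0 ≤ arrival ω n :=
  Finset.sum_nonneg fun j _ => (h j).le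

theorem arrival_succ_pos {ω : ℕ → ℝ × X} (h : ∀ k, 0 < (ω k).1) (n : ℕ) :
    0 < arrival ω (n + 1) := by
  rw [arrival_succ]
  exact add_pos_of_nonneg_of_pos (arrival_nonneg h n) (h n)

theorem arrival_strictMono {ω : ℕ → ℝ × X} (h : ∀ k, 0 < (ω k).1) : StrictMono (arrival ω) :=
  strictMono_nat_of_lt_succ fun n => by rw [arrival_succ]; linarith [h n]

/-- The hypothesis says that `w` is invariant under one step. Splitting off the first mark restarts
the process at `t + p.1` with one factor less, which is why the starting time `t` is arbitrary in
the induction. -/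
theorem lintegral_prod_arrival {Ψ : ℝ → X → ℝ≥0∞} (hΨ : Measurable (Function.uncurry Ψ))
    {w : ℝ → ℝ≥0∞} (hw : Measurable w)
    (h : ∀ t, 0 ≤ t → ∫⁻ p, Ψ (t + p.1) p.2 * w (t + p.1) ∂((expMeasure 1).prod m) = w t)
    (n : ℕ) {t : ℝ} (ht : 0 ≤ t) :
    ∫⁻ ω, (∏ k ∈ Finset.range n, Ψ (t + arrival ω (k + 1)) (ω k).2) * w (t + arrival ω n)
      ∂(markLaw m) = w t := by
  induction n generalizing t with
  | zero => simp [arrival_zero]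
  | succ n ih =>
    have hm : ∀ n t, Measurable fun ω : ℕ → ℝ × X =>
        (∏ k ∈ Finset.range n, Ψ (t + arrival ω (k + 1)) (ω k).2) * w (t + arrival ω n) := by
      intro n t
      refine (Finset.measurable_fun_prod _ fun k _ => ?_).mul
        (hw.comp ((measurable_arrival n).const_add t))
      exact hΨ.comp (((measurable_arrival (k + 1)).const_add t).prodMk
        (measurable_snd.comp (measurable_pi_apply k)))
    rw [lintegral_infinitePi_cons _ (hm (n + 1) t), ← h t ht]
    refine lintegral_congr_ae ?_
    filter_upwards [ae_mark_pos m] with p hp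
    rw [← ih (add_nonneg ht hp.le), ← lintegral_const_mul _ (hm n _)]
    refine lintegral_congr fun ω => ?_
    rw [Finset.prod_range_succ', arrival_consSeq]
    simp only [arrival_consSeq, arrival_zero, add_zero, ← add_assoc]
    simp only [consSeq]
    ring

theorem integral_prod_arrival {Ψ : ℝ → X → ℝ} {w : ℝ → ℝ}
    (h : ∀ t, 0 ≤ t → ∫ p, Ψ (t + p.1) p.2 * w (t + p.1) ∂((expMeasure 1).prod m) = w t)
    (hi : ∀ n t, 0 ≤ t → Integrable (fun ω : ℕ → ℝ × X =>
      (∏ k ∈ Finset.range n, Ψ (t + arrival ω (k + 1)) (ω k).2) * w (t + arrival ω n)) (markLaw m))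
    (n : ℕ) {t : ℝ} (ht : 0 ≤ t) :
    ∫ ω, (∏ k ∈ Finset.range n, Ψ (t + arrival ω (k + 1)) (ω k).2) * w (t + arrival ω n)
      ∂(markLaw m) = w t := by
  induction n generalizing t with
  | zero => simp [arrival_zero]
  | succ n ih =>
    rw [integral_infinitePi_cons _ (hi (n + 1) t ht), ← h t ht]
    refine integral_congr_ae ?_
    filter_upwards [ae_mark_pos m] with p hp
    rw [← ih (add_nonneg ht hp.le), ← integral_const_mul]
    refine integral_congr_ae (Eventually.of_forall fun ω => ?_)
    simp only
    rw [Finset.prod_range_succ', arrival_consSeq]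
    simp only [arrival_consSeq, arrival_zero, add_zero, ← add_assoc]
    simp only [consSeq]
    ring

/-- The exponential of the integral of `B` over `(t, ∞)`. -/
def tailExp (B : ℝ → ℝ) (t : ℝ) : ℝ := Real.exp (∫ s in Set.Ioi (max t 0), B s)

theorem tailExp_pos (B : ℝ → ℝ) (t : ℝ) : 0 < tailExp B t := Real.exp_pos _

/-! ### The solution of the one-step equation -/

section TailExp

variable {B : ℝ → ℝ}

theorem continuous_tailExp (hB : IntegrableOn B (Set.Ioi 0)) : Continuous (tailExp B) := by
  have h1 : ContinuousOn (fun t => ∫ s in Set.Ioi t, B s) (Set.Ici 0) := by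
    have h2 : ContinuousOn (fun t => (∫ s in Set.Ioi 0, B s) - ∫ s in (0 : ℝ)..t,
        (Set.Ioi 0).indicator B s) (Set.Ici 0) :=
      (continuous_const.sub (intervalIntegral.continuous_primitive (fun a b =>
        ((integrable_indicator_iff measurableSet_Ioi).2 hB).intervalIntegrable) 0)).continuousOn
    refine h2.congr fun t ht => ?_
    have h3 := intervalIntegral.integral_interval_add_Ioi hB
      (hB.mono_set (Set.Ioi_subset_Ioi ht))
    have h4 : ∫ s in (0 : ℝ)..t, (Set.Ioi 0).indicator B s = ∫ s in (0 : ℝ)..t, B s := by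
      rw [intervalIntegral.integral_of_le ht, intervalIntegral.integral_of_le ht]
      exact setIntegral_congr_fun measurableSet_Ioc fun s hs => Set.indicator_of_mem hs.1 _
    simp only [h4]
    linarith
  exact Real.continuous_exp.comp (h1.comp_continuous (continuous_id.max continuous_const)
    fun t => Set.mem_Ici.2 (le_max_right _ _))

theorem hasDerivAt_tailExp (hB : IntegrableOn B (Set.Ioi 0)) (hBc : ContinuousOn B (Set.Ioi 0)) {t : ℝ} (ht : 0 < t) :
    HasDerivAt (tailExp B) (-B t * tailExp B t) t := by
  have h1 : HasDerivAt (fun t => ∫ s in (0 : ℝ)..t, B s) (B t) t := by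
    refine intervalIntegral.integral_hasDerivAt_right ?_ ?_
      (hBc.continuousAt (Ioi_mem_nhds ht))
    · exact (intervalIntegrable_iff_integrableOn_Ioc_of_le ht.le).2
        (hB.mono_set Set.Ioc_subset_Ioi_self)
    · exact hBc.stronglyMeasurableAtFilter isOpen_Ioi t ht
  have h2 := (h1.const_sub (∫ s in Set.Ioi 0, B s)).exp
  have h3 : tailExp B =ᶠ[nhds t] fun t => Real.exp ((∫ s in Set.Ioi 0, B s)
      - ∫ s in (0 : ℝ)..t, B s) := by
    filter_upwards [Ioi_mem_nhds ht] with u hu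
    have hu : 0 < u := hu
    have h3 := intervalIntegral.integral_interval_add_Ioi hB
      (hB.mono_set (Set.Ioi_subset_Ioi hu.le))
    rw [tailExp, max_eq_left hu.le]
    congr 1
    linarith
  have h4 := h2.congr_of_eventuallyEq h3
  rw [← h3.eq_of_nhds] at h4
  exact h4.congr_deriv (by ring)

theorem tailExp_le (hB : IntegrableOn B (Set.Ioi 0)) (t : ℝ) : tailExp B t ≤ Real.exp (∫ s in Set.Ioi 0, |B s|) := by
  refine Real.exp_le_exp.2 ((le_abs_self _).trans ?_)
  refine (abs_integral_le_integral_abs).trans ?_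
  exact setIntegral_mono_set hB.abs (Eventually.of_forall fun _ => abs_nonneg _)
    (Set.Ioi_subset_Ioi (le_max_right _ _)).eventuallyLE

theorem tendsto_tailExp (hB : IntegrableOn B (Set.Ioi 0)) : Tendsto (tailExp B) atTop (nhds 1) := by
  have h1 := intervalIntegral_tendsto_integral_Ioi 0 hB tendsto_id
  have h2 := (h1.const_sub (∫ s in Set.Ioi 0, B s)).rexp
  rw [sub_self, Real.exp_zero] at h2
  refine h2.congr' ?_
  filter_upwards [eventually_ge_atTop 0] with u hu
  have h3 := intervalIntegral.integral_interval_add_Ioi hB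
    (hB.mono_set (Set.Ioi_subset_Ioi hu))
  rw [tailExp, max_eq_left hu]
  congr 1
  simp only [id]
  linarith

theorem integrableOn_tailExp (hB : IntegrableOn B (Set.Ioi 0)) (hBc : ContinuousOn B (Set.Ioi 0)) {t : ℝ} (ht : 0 ≤ t) :
    IntegrableOn (fun s => Real.exp (-s) * ((1 + B (t + s)) * tailExp B (t + s))) (Set.Ioi 0) := by
  have h0 : IntegrableOn (fun s : ℝ => Real.exp (-s)) (Set.Ioi 0) := integrableOn_exp_neg_Ioi 0
  have h1 : IntegrableOn (fun s => B (t + s)) (Set.Ioi 0) := by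
    have h2 := hB.mono_set (Set.Ioi_subset_Ioi ht)
    have h3 := (measurePreserving_add_left volume t).integrableOn_comp_preimage
      (MeasurableEquiv.addLeft t).measurableEmbedding (f := B) (s := Set.Ioi t)
    have h4 := h3.2 h2
    have h5 : (fun x => t + x) ⁻¹' Set.Ioi t = Set.Ioi 0 := by ext x; simp
    rwa [h5] at h4
  have hc : ContinuousOn (fun s => Real.exp (-s) * ((1 + B (t + s)) * tailExp B (t + s)))
      (Set.Ioi 0) := by
    refine ContinuousOn.mul (by fun_prop) (ContinuousOn.mul (continuousOn_const.add
      (hBc.comp (by fun_prop) fun s hs => ?_))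
      ((continuous_tailExp hB).comp (by fun_prop)).continuousOn)
    exact add_pos_of_nonneg_of_pos ht hs
  refine ((h0.add h1.abs).mul_const (Real.exp (∫ s in Set.Ioi 0, |B s|))).mono'
    (hc.aestronglyMeasurable measurableSet_Ioi) ?_
  filter_upwards [ae_restrict_mem measurableSet_Ioi] with s hs
  have hs : 0 < s := hs
  rw [norm_mul, norm_mul, Real.norm_of_nonneg (Real.exp_pos _).le,
    Real.norm_of_nonneg (tailExp_pos _ _).le, ← mul_assoc]
  refine mul_le_mul ?_ (tailExp_le hB _) (tailExp_pos _ _).le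
    (add_nonneg (Real.exp_pos _).le (abs_nonneg _))
  have h6 : Real.exp (-s) ≤ 1 := Real.exp_le_one_iff.2 (by linarith)
  have h7 : ‖1 + B (t + s)‖ ≤ 1 + |B (t + s)| := by
    simpa using norm_add_le (1 : ℝ) (B (t + s))
  calc Real.exp (-s) * ‖1 + B (t + s)‖ ≤ Real.exp (-s) * (1 + |B (t + s)|) := by gcongr
    _ ≤ Real.exp (-s) + |B (t + s)| := by nlinarith [abs_nonneg (B (t + s))]

/-- With `G = tailExp B` one has `G' = -B G`, so the integrand is the derivative of `-e^{-s} G(t +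
s)`, which runs from `-G(t)` to `0`. Thus `G` is invariant under a step with mean factor `1 + B`. -/
theorem integral_tailExp (hB : IntegrableOn B (Set.Ioi 0)) (hBc : ContinuousOn B (Set.Ioi 0)) {t : ℝ} (ht : 0 ≤ t) :
    ∫ s in Set.Ioi 0, Real.exp (-s) * ((1 + B (t + s)) * tailExp B (t + s)) = tailExp B t := by
  have h1 := integral_Ioi_of_hasDerivAt_of_tendsto (a := 0) (m := 0)
    (f := fun s => -(Real.exp (-s) * tailExp B (t + s)))
    (f' := fun s => Real.exp (-s) * ((1 + B (t + s)) * tailExp B (t + s))) ?_ ?_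
    (integrableOn_tailExp hB hBc ht) ?_
  · rw [h1]; simp
  · have := continuous_tailExp hB
    exact Continuous.continuousWithinAt (by fun_prop)
  · intro s hs
    have hs : 0 < s := hs
    have h2 := (hasDerivAt_tailExp hB hBc (add_pos_of_nonneg_of_pos ht hs))
    have h3 := h2.comp s ((hasDerivAt_id s).const_add t)
    have h4 := ((hasDerivAt_neg s).exp.mul h3).neg
    exact h4.congr_deriv (by simp only [Function.comp_apply]; ring)
  · have h2 : Tendsto (fun s => Real.exp (-s)) atTop (nhds 0) :=
      Real.tendsto_exp_neg_atTop_nhds_zero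
    have h3 := (tendsto_tailExp hB).comp (tendsto_atTop_add_const_left atTop t tendsto_id)
    simpa using (h2.mul h3).neg

end TailExp

theorem integral_mark (f : ℝ → X → ℝ)
    (hf : Integrable (Function.uncurry f) ((expMeasure 1).prod m)) :
    ∫ p, f p.1 p.2 ∂((expMeasure 1).prod m)
      = ∫ s in Set.Ioi 0, Real.exp (-s) * ∫ x, f s x ∂m := by
  rw [← integral_expMeasure fun s => ∫ x, f s x ∂m]
  exact integral_prod (fun p : ℝ × X => f p.1 p.2) hf

theorem integrable_expMeasure_iff {f : ℝ → ℝ} :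
    Integrable f (expMeasure 1) ↔ IntegrableOn (fun s => Real.exp (-s) * f s) (Set.Ioi 0) := by
  rw [expMeasure_one, integrable_withDensity_iff_integrable_smul' (by fun_prop)
    (Eventually.of_forall fun _ => ENNReal.ofReal_lt_top)]
  simp [ENNReal.toReal_ofReal (Real.exp_pos _).le, IntegrableOn]

theorem lintegral_mark_tailExp {B : ℝ → ℝ} (hB : IntegrableOn B (Set.Ioi 0))
    (hBc : ContinuousOn B (Set.Ioi 0)) (hBm : Measurable B) (hB0 : ∀ s, 0 < s → 0 ≤ B s) {t : ℝ}
    (ht : 0 ≤ t) :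
    ∫⁻ p, ENNReal.ofReal (1 + B (t + p.1)) * ENNReal.ofReal (tailExp B (t + p.1))
      ∂((expMeasure 1).prod m) = ENNReal.ofReal (tailExp B t) := by
  have hm : Measurable fun s => ENNReal.ofReal (1 + B (t + s)) *
      ENNReal.ofReal (tailExp B (t + s)) := by
    have := (continuous_tailExp hB).measurable
    fun_prop
  rw [lintegral_prod (fun p : ℝ × X => ENNReal.ofReal (1 + B (t + p.1)) *
    ENNReal.ofReal (tailExp B (t + p.1))) (hm.comp measurable_fst).aemeasurable]
  simp only [lintegral_const, measure_univ, mul_one]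
  rw [← integral_tailExp hB hBc ht, ofReal_integral_eq_lintegral_ofReal
    (integrableOn_tailExp hB hBc ht), expMeasure_one,
    lintegral_withDensity_eq_lintegral_mul _ (by fun_prop) hm]
  · refine setLIntegral_congr_fun measurableSet_Ioi fun s hs => ?_
    have hs : 0 < s := hs
    have := hB0 _ (add_pos_of_nonneg_of_pos ht hs)
    simp only [Pi.mul_apply]
    rw [ENNReal.ofReal_mul (Real.exp_pos _).le, ENNReal.ofReal_mul (by linarith)]
  · filter_upwards [ae_restrict_mem measurableSet_Ioi] with s hs
    have hs : 0 < s := hs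
    have := hB0 _ (add_pos_of_nonneg_of_pos ht hs)
    have := tailExp_pos B (t + s)
    change 0 ≤ Real.exp (-s) * ((1 + B (t + s)) * tailExp B (t + s))
    positivity

/-- If `S_n` denotes the arrival times, then `e^{-S_n}` has expectation `2^{-n}`, by the recursion
with the constant factor `2` and `w(t) = e^{-t}`. These numbers are summable, so `e^{-S_n} → 0`
almost surely. -/
theorem tendsto_arrival : ∀ᵐ ω ∂(markLaw m), Tendsto (arrival ω) atTop atTop := by
  have h1 : ∀ n, ∫⁻ ω, ENNReal.ofReal (Real.exp (-arrival ω n)) ∂(markLaw m) = (2 : ℝ≥0∞)⁻¹ ^ n := by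
    intro n
    have hfix : ∀ t : ℝ, 0 ≤ t → ∫⁻ p : ℝ × X, 2 * ENNReal.ofReal (Real.exp (-(t + p.1)))
        ∂((expMeasure 1).prod m) = ENNReal.ofReal (Real.exp (-t)) := by
      intro t _
      have hm : Measurable fun s : ℝ => 2 * ENNReal.ofReal (Real.exp (-(t + s))) := by fun_prop
      rw [lintegral_prod (fun p : ℝ × X => 2 * ENNReal.ofReal (Real.exp (-(t + p.1))))
        (hm.comp measurable_fst).aemeasurable]
      simp only [lintegral_const, measure_univ, mul_one]
      rw [expMeasure_one, lintegral_withDensity_eq_lintegral_mul _ (by fun_prop) hm]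
      have e : ∀ s : ℝ, ((fun s => ENNReal.ofReal (Real.exp (-s))) *
          fun s => 2 * ENNReal.ofReal (Real.exp (-(t + s)))) s
          = ENNReal.ofReal (2 * Real.exp (-t) * Real.exp (-2 * s)) := by
        intro s
        simp only [Pi.mul_apply]
        rw [show (2 : ℝ≥0∞) = ENNReal.ofReal 2 by simp, ← ENNReal.ofReal_mul (by norm_num),
          ← ENNReal.ofReal_mul (Real.exp_pos _).le]
        congr 1
        rw [mul_left_comm, mul_assoc, ← Real.exp_add, ← Real.exp_add]
        ring_nf
      simp only [e]
      rw [← ofReal_integral_eq_lintegral_ofReal]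
      · rw [integral_const_mul, integral_exp_mul_Ioi (by norm_num)]
        simp
        congr 1
        ring
      · exact (integrableOn_exp_mul_Ioi (by norm_num) 0).const_mul _
      · exact Eventually.of_forall fun s => by positivity
    have h2 := lintegral_prod_arrival m (Ψ := fun _ _ => 2)
      (w := fun t => ENNReal.ofReal (Real.exp (-t))) measurable_const (by fun_prop) hfix n le_rfl
    have hm2 : Measurable fun ω : ℕ → ℝ × X => ENNReal.ofReal (Real.exp (-arrival ω n)) := by
      have := measurable_arrival (X := X) n
      fun_prop
    simp only [Finset.prod_const, Finset.card_range, zero_add, neg_zero, Real.exp_zero,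
      ENNReal.ofReal_one] at h2
    rw [lintegral_const_mul _ hm2] at h2
    rw [← ENNReal.inv_pow]
    exact ENNReal.eq_inv_of_mul_eq_one_left (by rw [mul_comm]; exact h2)
  have h2 : ∫⁻ ω, ∑' n, ENNReal.ofReal (Real.exp (-arrival ω n)) ∂(markLaw m) ≠ ⊤ := by
    rw [lintegral_tsum]
    · simp only [h1, ENNReal.tsum_geometric]
      simp
    · intro n
      have := measurable_arrival (X := X) n
      fun_prop
  have hm : Measurable fun ω : ℕ → ℝ × X => ∑' n, ENNReal.ofReal (Real.exp (-arrival ω n)) := by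
    refine Measurable.tsum fun n => ?_
    have := measurable_arrival (X := X) n
    fun_prop
  filter_upwards [ae_lt_top hm h2] with ω hω
  have h3 := ENNReal.tendsto_atTop_zero_of_tsum_ne_top hω.ne
  have h4 := (ENNReal.tendsto_toReal ENNReal.zero_ne_top).comp h3
  have h5 : Tendsto (fun n => Real.exp (-arrival ω n)) atTop (nhds 0) := by
    simpa [Function.comp_def, ENNReal.toReal_ofReal (Real.exp_pos _).le] using h4
  have h6 := Real.tendsto_exp_comp_nhds_zero.1 h5
  simpa [Function.comp_def] using tendsto_neg_atBot_atTop.comp h6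

theorem one_add_sum_le_prod (s : Finset ℕ) {b : ℕ → ℝ} (hb : ∀ i, 0 ≤ b i) :
    1 + ∑ i ∈ s, b i ≤ ∏ i ∈ s, (1 + b i) := by
  classical
  induction s using Finset.induction_on with
  | empty => simp
  | insert i s his ih =>
    rw [Finset.sum_insert his, Finset.prod_insert his]
    have h1 : 0 ≤ ∑ i ∈ s, b i := Finset.sum_nonneg fun i _ => hb i
    nlinarith [hb i]

/-- The expectation of a product over the points of a marked Poisson process of unit intensity. -/
theorem campbell {θ : ℝ → X → ℝ} {B : ℝ → ℝ} (hθ : Measurable (Function.uncurry θ))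
    (hθc : ∀ x, ContinuousOn (fun s => θ s x) (Set.Ioi 0)) (hB : IntegrableOn B (Set.Ioi 0))
    (hBc : ContinuousOn B (Set.Ioi 0)) (hBm : Measurable B)
    (hθB : ∀ s, 0 < s → ∀ x, |θ s x| ≤ B s) :
    (∀ᵐ ω ∂(markLaw m), Summable fun k => B (arrival ω (k + 1))) ∧
    Integrable (fun ω => ∏' k, (1 + θ (arrival ω (k + 1)) (ω k).2)) (markLaw m) ∧
    ∫ ω, ∏' k, (1 + θ (arrival ω (k + 1)) (ω k).2) ∂(markLaw m)
      = Real.exp (∫ s in Set.Ioi 0, ∫ x, θ s x ∂m) := by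
  have : Nonempty X := nonempty_of_isProbabilityMeasure m
  have hB0 : ∀ s, 0 < s → 0 ≤ B s := fun s hs =>
    (abs_nonneg _).trans (hθB s hs (Classical.arbitrary X))
  have hBt := (continuous_tailExp hB).measurable
  have hBt1 : ∀ t, 1 ≤ tailExp B t := fun t => Real.one_le_exp
    (setIntegral_nonneg measurableSet_Ioi fun s hs => hB0 s ((le_max_right _ _).trans_lt hs))
  -- the expectations of the finite products of the dominating factors
  have hL : ∀ n t, 0 ≤ t → ∫⁻ ω, (∏ k ∈ Finset.range n,
      ENNReal.ofReal (1 + B (t + arrival ω (k + 1)))) * ENNReal.ofReal (tailExp B (t + arrival ω n))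
      ∂(markLaw m) = ENNReal.ofReal (tailExp B t) := fun n t ht =>
    lintegral_prod_arrival m (Ψ := fun s _ => ENNReal.ofReal (1 + B s))
      (w := fun s => ENNReal.ofReal (tailExp B s)) (by fun_prop) (by fun_prop)
      (fun t ht => lintegral_mark_tailExp m hB hBc hBm hB0 ht) n ht
  have harr := fun n => measurable_arrival (X := X) n
  -- The products of the factors `1 + B ≥ 1` increase with `n` and have expectations at most
  -- `tailExp B 0`. Their supremum is therefore integrable; it forces `∑ B` to converge and
  -- dominates all the products below.
  set M : (ℕ → ℝ × X) → ℝ≥0∞ := fun ω => ⨆ n, ∏ k ∈ Finset.range n,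
    ENNReal.ofReal (1 + B (0 + arrival ω (k + 1))) with hM
  have hprodm : ∀ n, Measurable fun ω : ℕ → ℝ × X => ∏ k ∈ Finset.range n,
      ENNReal.ofReal (1 + B (0 + arrival ω (k + 1))) := fun n =>
    Finset.measurable_fun_prod _ fun k _ => by
      have := harr (k + 1)
      fun_prop
  have hMm : Measurable M := Measurable.iSup hprodm
  have hML : ∫⁻ ω, M ω ∂(markLaw m) ≠ ⊤ := by
    refine ne_of_lt ?_
    calc ∫⁻ ω, M ω ∂(markLaw m) = ⨆ n, ∫⁻ ω, ∏ k ∈ Finset.range n,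
        ENNReal.ofReal (1 + B (0 + arrival ω (k + 1))) ∂(markLaw m) := by
          refine lintegral_iSup' (fun n => (hprodm n).aemeasurable) ?_
          filter_upwards [ae_markLaw_pos m] with ω hω
          refine monotone_nat_of_le_succ fun n => ?_
          rw [Finset.prod_range_succ]
          refine le_mul_of_one_le_right' ?_
          rw [ENNReal.one_le_ofReal, zero_add]
          linarith [hB0 _ (arrival_succ_pos hω n)]
      _ ≤ ENNReal.ofReal (tailExp B 0) := by
          refine iSup_le fun n => ?_
          rw [← hL n 0 le_rfl]
          refine lintegral_mono fun ω => ?_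
          refine le_mul_of_one_le_right' ?_
          rw [ENNReal.one_le_ofReal]
          exact hBt1 _
      _ < ⊤ := ENNReal.ofReal_lt_top
  have hMae := ae_lt_top hMm hML
  have hpartial : ∀ ω : ℕ → ℝ × X, (∀ k, 0 < (ω k).1) → M ω < ⊤ → ∀ n,
      ∏ k ∈ Finset.range n, (1 + B (arrival ω (k + 1))) ≤ (M ω).toReal := by
    intro ω hω hMω n
    have h1 : ENNReal.ofReal (∏ k ∈ Finset.range n, (1 + B (arrival ω (k + 1)))) ≤ M ω := by
      rw [ENNReal.ofReal_prod_of_nonneg fun k _ => by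
        linarith [hB0 _ (arrival_succ_pos hω k)]]
      refine le_trans (le_of_eq ?_) (le_iSup _ n)
      simp
    exact (ENNReal.ofReal_le_iff_le_toReal hMω.ne).1 h1
  have hsum : ∀ᵐ ω ∂(markLaw m), Summable fun k => B (arrival ω (k + 1)) := by
    filter_upwards [ae_markLaw_pos m, hMae] with ω hω hMω
    refine summable_of_sum_range_le (c := (M ω).toReal)
      (fun k => hB0 _ (arrival_succ_pos hω k)) fun n => ?_
    have h1 := one_add_sum_le_prod (Finset.range n)
      (b := fun k => B (arrival ω (k + 1))) (fun k => hB0 _ (arrival_succ_pos hω k))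
    linarith [hpartial ω hω hMω n]
  refine ⟨hsum, ?_⟩
  -- the averaged factor
  set Θ : ℝ → ℝ := fun s => ∫ x, θ s x ∂m with hΘ
  have hθs : ∀ s, Measurable (θ s) := fun s => hθ.comp measurable_prodMk_left
  have hθi : ∀ s, 0 < s → Integrable (θ s) m := fun s hs =>
    (integrable_const (B s)).mono' (hθs s).aestronglyMeasurable
      (Eventually.of_forall fun x => hθB s hs x)
  have hΘB : ∀ s, 0 < s → |Θ s| ≤ B s := fun s hs => by
    refine (abs_integral_le_integral_abs).trans ?_
    refine (integral_mono (hθi s hs).abs (integrable_const (B s)) fun x => hθB s hs x).trans ?_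
    simp
  have hΘc : ContinuousOn Θ (Set.Ioi 0) := by
    intro s hs
    refine ContinuousAt.continuousWithinAt ?_
    refine continuousAt_of_dominated (bound := fun _ => B s + 1)
      (Eventually.of_forall fun u => (hθs u).aestronglyMeasurable) ?_ (integrable_const _) ?_
    · have h1 := (hBc.continuousAt (Ioi_mem_nhds hs)).eventually_lt_const
        (show B s < B s + 1 by linarith)
      filter_upwards [h1, Ioi_mem_nhds hs] with u hu hu0
      exact Eventually.of_forall fun x => (hθB u hu0 x).trans hu.le
    · exact Eventually.of_forall fun x => (hθc x).continuousAt (Ioi_mem_nhds hs)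
  have hΘi : IntegrableOn Θ (Set.Ioi 0) := by
    refine hB.mono' (hΘc.aestronglyMeasurable measurableSet_Ioi) ?_
    filter_upwards [ae_restrict_mem measurableSet_Ioi] with s hs using hΘB s hs
  have hGB : ∀ t, 0 ≤ t → tailExp Θ t ≤ tailExp B t := fun t ht => by
    refine Real.exp_le_exp.2 (setIntegral_mono_on
      (hΘi.mono_set (Set.Ioi_subset_Ioi (le_max_right _ _)))
      (hB.mono_set (Set.Ioi_subset_Ioi (le_max_right _ _))) measurableSet_Ioi fun s hs => ?_)
    exact (le_abs_self _).trans (hΘB s ((le_max_right _ _).trans_lt hs))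
  have hGm := (continuous_tailExp hΘi).measurable
  set F : ℕ → ℝ → (ℕ → ℝ × X) → ℝ := fun n t ω =>
    (∏ k ∈ Finset.range n, (1 + θ (t + arrival ω (k + 1)) (ω k).2)) * tailExp Θ (t + arrival ω n)
    with hF
  have hFm : ∀ n t, Measurable (F n t) := by
    intro n t
    refine (Finset.measurable_fun_prod _ fun k _ => ?_).mul
      (hGm.comp ((measurable_arrival n).const_add t))
    exact (hθ.comp (((measurable_arrival (k + 1)).const_add t).prodMk
      (measurable_snd.comp (measurable_pi_apply k)))).const_add 1
  have hprodB : ∀ (ω : ℕ → ℝ × X), (∀ k, 0 < (ω k).1) → ∀ n t, 0 ≤ t →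
      |∏ k ∈ Finset.range n, (1 + θ (t + arrival ω (k + 1)) (ω k).2)|
        ≤ ∏ k ∈ Finset.range n, (1 + B (t + arrival ω (k + 1))) := by
    intro ω hω n t ht
    rw [Finset.abs_prod]
    refine Finset.prod_le_prod (fun _ _ => abs_nonneg _) fun k _ => ?_
    have h1 := hθB _ (add_pos_of_nonneg_of_pos ht (arrival_succ_pos hω k)) (ω k).2
    refine (abs_add_le _ _).trans ?_
    simpa using h1
  have hFi : ∀ n t, 0 ≤ t → Integrable (F n t) (markLaw m) := by
    intro n t ht
    refine ⟨(hFm n t).aestronglyMeasurable, ?_⟩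
    refine lt_of_le_of_lt ?_ (lt_of_eq_of_lt (hL n t ht) ENNReal.ofReal_lt_top)
    refine lintegral_mono_ae ?_
    filter_upwards [ae_markLaw_pos m] with ω hω
    have h0 : ∀ k ∈ Finset.range n, 0 ≤ 1 + B (t + arrival ω (k + 1)) := fun k _ => by
      linarith [hB0 _ (add_pos_of_nonneg_of_pos ht (arrival_succ_pos hω k))]
    rw [← ENNReal.ofReal_prod_of_nonneg h0, ← ENNReal.ofReal_mul (Finset.prod_nonneg h0),
      ← ofReal_norm]
    refine ENNReal.ofReal_le_ofReal ?_
    rw [Real.norm_eq_abs, abs_mul, abs_of_pos (tailExp_pos _ _)]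
    exact mul_le_mul (hprodB ω hω n t ht) (hGB _ (add_nonneg ht (arrival_nonneg hω n)))
      (tailExp_pos _ _).le (Finset.prod_nonneg h0)
  -- The tail factor does not depend on the point, so integrating over the point replaces `θ` by its
  -- mean `Θ`.
  have hfix : ∀ t, 0 ≤ t → ∫ p : ℝ × X, (1 + θ (t + p.1) p.2) * tailExp Θ (t + p.1)
      ∂((expMeasure 1).prod m) = tailExp Θ t := by
    intro t ht
    rw [integral_mark m (fun s x => (1 + θ (t + s) x) * tailExp Θ (t + s)),
      ← integral_tailExp hΘi hΘc ht]
    · refine setIntegral_congr_fun measurableSet_Ioi fun s hs => ?_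
      rw [integral_mul_const, integral_add (integrable_const _)
        (hθi _ (add_pos_of_nonneg_of_pos ht hs))]
      simp [hΘ]
    · have h1 : Integrable (fun s => (1 + B (t + s)) * tailExp B (t + s)) (expMeasure 1) :=
        integrable_expMeasure_iff.2 (integrableOn_tailExp hB hBc ht)
      refine (h1.comp_fst m).mono' ?_ ?_
      · refine Measurable.aestronglyMeasurable ?_
        exact ((hθ.comp ((measurable_fst.const_add t).prodMk measurable_snd)).const_add 1).mul
          (hGm.comp (measurable_fst.const_add t))
      · filter_upwards [ae_mark_pos m] with p hp
        have hp' := add_pos_of_nonneg_of_pos ht hp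
        simp only [Function.uncurry, norm_mul, Real.norm_eq_abs, abs_of_pos (tailExp_pos _ _)]
        have h2 := hθB _ hp' p.2
        have h3 : |1 + θ (t + p.1) p.2| ≤ 1 + B (t + p.1) :=
          (abs_add_le _ _).trans (by simpa using h2)
        exact mul_le_mul h3 (hGB _ hp'.le) (tailExp_pos _ _).le ((abs_nonneg _).trans h3)
  -- The finite products, compensated by the tail factor, have an expectation independent of `n`. As
  -- the arrival times tend to infinity the compensator tends to `1`, so the limit is the infinite
  -- product.
  have hFint : ∀ n, ∫ ω, F n 0 ω ∂(markLaw m) = tailExp Θ 0 := fun n =>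
    integral_prod_arrival m (Ψ := fun s x => 1 + θ s x) hfix hFi n le_rfl
  have hbi : Integrable (fun ω => (M ω).toReal * Real.exp (∫ s in Set.Ioi 0, |Θ s|))
      (markLaw m) := (integrable_toReal_of_lintegral_ne_top hMm.aemeasurable hML).mul_const _
  have hbound : ∀ n, ∀ᵐ ω ∂(markLaw m), ‖F n 0 ω‖ ≤ (M ω).toReal *
      Real.exp (∫ s in Set.Ioi 0, |Θ s|) := by
    intro n
    filter_upwards [ae_markLaw_pos m, hMae] with ω hω hMω
    have h1 := hprodB ω hω n 0 le_rfl
    simp only [zero_add] at h1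
    simp only [hF, zero_add, norm_mul, Real.norm_eq_abs, abs_of_pos (tailExp_pos _ _)]
    exact mul_le_mul (h1.trans (hpartial ω hω hMω n)) (tailExp_le hΘi _) (tailExp_pos _ _).le
      ENNReal.toReal_nonneg
  have hlim : ∀ᵐ ω ∂(markLaw m), Tendsto (fun n => F n 0 ω) atTop
      (nhds (∏' k, (1 + θ (arrival ω (k + 1)) (ω k).2))) := by
    filter_upwards [ae_markLaw_pos m, hsum, tendsto_arrival m] with ω hω hs ht
    have h1 : Multipliable fun k => 1 + θ (arrival ω (k + 1)) (ω k).2 :=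
      multipliable_one_add_of_summable (Summable.of_nonneg_of_le (fun _ => norm_nonneg _)
        (fun k => hθB _ (arrival_succ_pos hω k) _) hs)
    have h2 := h1.hasProd.tendsto_prod_nat.mul ((tendsto_tailExp hΘi).comp ht)
    simpa [hF] using h2
  have hT : Integrable (fun ω => ∏' k, (1 + θ (arrival ω (k + 1)) (ω k).2)) (markLaw m) := by
    refine hbi.mono' (aestronglyMeasurable_of_tendsto_ae atTop
      (fun n => (hFm n 0).aestronglyMeasurable) hlim) ?_
    filter_upwards [hlim, ae_all_iff.2 hbound] with ω h1 h2
    exact le_of_tendsto h1.norm (Eventually.of_forall h2)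
  refine ⟨hT, ?_⟩
  have h3 := tendsto_integral_of_dominated_convergence _
    (fun n => (hFm n 0).aestronglyMeasurable) hbi hbound hlim
  simp only [hFint] at h3
  rw [tendsto_nhds_unique h3 tendsto_const_nhds]
  simp [tailExp, hΘ]

end Poisson

/-! ### The exponential integral -/

section ExpInt

theorem integrableOn_exp_neg_div {r : ℝ} (hr : 0 < r) :
    IntegrableOn (fun t => Real.exp (-t) / t) (Set.Ioi r) := by
  have hc : ContinuousOn (fun t : ℝ => Real.exp (-t) / t) (Set.Ioi r) :=
    ContinuousOn.div (by fun_prop) continuousOn_id fun t ht => (hr.trans ht).ne'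
  refine ((integrableOn_exp_neg_Ioi r).div_const r).mono'
    (hc.aestronglyMeasurable measurableSet_Ioi) ?_
  filter_upwards [ae_restrict_mem measurableSet_Ioi] with t ht
  have ht : r < t := ht
  have h0 : 0 < t := hr.trans ht
  rw [Real.norm_of_nonneg (by positivity)]
  gcongr

theorem hasDerivAt_expInt {r : ℝ} (hr : 0 < r) :
    HasDerivAt expInt (-(Real.exp (-r) / r)) r := by
  have hr2 : 0 < r / 2 := by positivity
  have hc : ContinuousOn (fun t : ℝ => Real.exp (-t) / t) (Set.Ioi 0) :=
    ContinuousOn.div (by fun_prop) continuousOn_id fun t ht => (ne_of_gt ht)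
  have h1 : HasDerivAt (fun u => ∫ t in (r / 2)..u, Real.exp (-t) / t) (Real.exp (-r) / r) r := by
    refine intervalIntegral.integral_hasDerivAt_right ?_
      (hc.stronglyMeasurableAtFilter isOpen_Ioi r hr) (hc.continuousAt (Ioi_mem_nhds hr))
    exact (intervalIntegrable_iff_integrableOn_Ioc_of_le (by linarith)).2
      ((integrableOn_exp_neg_div hr2).mono_set Set.Ioc_subset_Ioi_self)
  refine (h1.const_sub (expInt (r / 2))).congr_of_eventuallyEq ?_
  filter_upwards [Ioi_mem_nhds (show r / 2 < r by linarith)] with u hu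
  have hu : r / 2 < u := hu
  have h3 := intervalIntegral.integral_interval_add_Ioi (integrableOn_exp_neg_div hr2)
    (integrableOn_exp_neg_div (hr2.trans hu))
  simp only [expInt]
  linarith

theorem strictAntiOn_expInt : StrictAntiOn expInt (Set.Ioi 0) := by
  refine strictAntiOn_of_deriv_neg (convex_Ioi 0)
    (fun r hr => (hasDerivAt_expInt hr).continuousAt.continuousWithinAt) fun r hr => ?_
  rw [interior_Ioi] at hr
  have hr : 0 < r := hr
  rw [(hasDerivAt_expInt hr).deriv]
  have : 0 < Real.exp (-r) / r := by positivity
  linarith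

theorem tendsto_expInt_atTop : Tendsto expInt atTop (nhds 0) := by
  have h := integrableOn_exp_neg_div one_pos
  have h1 := intervalIntegral_tendsto_integral_Ioi 1 h tendsto_id
  have h2 := h1.const_sub (∫ s in Set.Ioi 1, Real.exp (-s) / s)
  rw [sub_self] at h2
  refine h2.congr' ?_
  filter_upwards [eventually_ge_atTop 1] with u hu
  have h3 := intervalIntegral.integral_interval_add_Ioi h
    (h.mono_set (Set.Ioi_subset_Ioi hu))
  simp only [id, expInt]
  linarith

theorem expInt_pos {r : ℝ} (hr : 0 < r) : 0 < expInt r := by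
  have h1 : expInt (r + 1) < expInt r :=
    strictAntiOn_expInt hr (Set.mem_Ioi.2 (by linarith)) (by linarith)
  refine lt_of_le_of_lt ?_ h1
  exact setIntegral_nonneg measurableSet_Ioi fun t ht => by
    have : 0 < t := (by linarith : (0 : ℝ) < r + 1).trans ht
    positivity

theorem tendsto_expInt_zero : Tendsto expInt (nhdsWithin 0 (Set.Ioi 0)) atTop := by
  have h1 : Tendsto (fun r => Real.exp (-1) * (-Real.log r)) (nhdsWithin 0 (Set.Ioi 0)) atTop :=
    (tendsto_neg_atBot_atTop.comp Real.tendsto_log_nhdsGT_zero).const_mul_atTop (Real.exp_pos _)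
  refine tendsto_atTop_mono' _ ?_ h1
  filter_upwards [Ioo_mem_nhdsGT (show (0 : ℝ) < 1 by norm_num)] with r hr
  have hr0 : 0 < r := hr.1
  have h2 := intervalIntegral.integral_interval_add_Ioi (integrableOn_exp_neg_div hr0)
    (integrableOn_exp_neg_div one_pos)
  have h3 : Real.exp (-1) * (-Real.log r) = ∫ t in r..1, Real.exp (-1) / t := by
    simp only [div_eq_mul_inv]
    rw [intervalIntegral.integral_const_mul, integral_inv_of_pos hr0 one_pos, one_div, Real.log_inv]
  have h4 : ∫ t in r..1, Real.exp (-1) / t ≤ ∫ t in r..1, Real.exp (-t) / t := by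
    refine intervalIntegral.integral_mono_on hr.2.le ?_ ?_ fun t ht => ?_
    · refine ContinuousOn.intervalIntegrable_of_Icc hr.2.le ?_
      exact continuousOn_const.div continuousOn_id fun t ht => (hr0.trans_le ht.1).ne'
    · refine ContinuousOn.intervalIntegrable_of_Icc hr.2.le ?_
      exact ContinuousOn.div (by fun_prop) continuousOn_id fun t ht => (hr0.trans_le ht.1).ne'
    · have h0 : 0 < t := hr0.trans_le ht.1
      have h5 : Real.exp (-1) ≤ Real.exp (-t) := Real.exp_le_exp.2 (by linarith [ht.2])
      gcongr
  have h6 := (expInt_pos one_pos).le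
  simp only [expInt] at h6 ⊢
  linarith

theorem image_expInt : expInt '' Set.Ioi 0 = Set.Ioi 0 := by
  refine Set.Subset.antisymm ?_ ?_
  · rintro _ ⟨r, hr, rfl⟩
    exact expInt_pos hr
  · exact isPreconnected_Ioi.intermediate_value_Ioi (le_principal_iff.2 (Ioi_mem_atTop 0))
      (le_principal_iff.2 self_mem_nhdsWithin)
      (fun r hr => (hasDerivAt_expInt hr).continuousAt.continuousWithinAt)
      tendsto_expInt_atTop tendsto_expInt_zero

theorem expIntInv_expInt {r : ℝ} (hr : 0 < r) : expIntInv (expInt r) = r := by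
  have : {r' | 0 < r' ∧ expInt r' ≤ expInt r} = Set.Ici r := by
    ext r'
    simp only [Set.mem_ofPred_eq, Set.mem_Ici]
    constructor
    · rintro ⟨h0, h⟩
      exact (strictAntiOn_expInt.le_iff_ge (Set.mem_Ioi.2 h0) (Set.mem_Ioi.2 hr)).1 h
    · intro h
      have h0 : 0 < r' := hr.trans_le h
      exact ⟨h0, (strictAntiOn_expInt.le_iff_ge (Set.mem_Ioi.2 h0) (Set.mem_Ioi.2 hr)).2 h⟩
  rw [expIntInv, this, csInf_Ici]

theorem exists_expInt_eq {s : ℝ} (hs : 0 < s) : ∃ r, 0 < r ∧ expInt r = s := by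
  have : s ∈ expInt '' Set.Ioi 0 := by rw [image_expInt]; exact hs
  exact this

theorem expIntInv_pos {s : ℝ} (hs : 0 < s) : 0 < expIntInv s := by
  obtain ⟨r, hr, rfl⟩ := exists_expInt_eq hs
  rwa [expIntInv_expInt hr]

theorem strictAntiOn_expIntInv : StrictAntiOn expIntInv (Set.Ioi 0) := by
  intro s hs t ht hst
  obtain ⟨r, hr, rfl⟩ := exists_expInt_eq hs
  obtain ⟨r', hr', rfl⟩ := exists_expInt_eq ht
  rw [expIntInv_expInt hr, expIntInv_expInt hr']
  exact (strictAntiOn_expInt.lt_iff_gt (Set.mem_Ioi.2 hr) (Set.mem_Ioi.2 hr')).1 hst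

theorem image_expIntInv : expIntInv '' Set.Ioi 0 = Set.Ioi 0 := by
  refine Set.Subset.antisymm ?_ fun r hr => ⟨expInt r, expInt_pos hr, expIntInv_expInt hr⟩
  rintro _ ⟨s, hs, rfl⟩
  exact expIntInv_pos hs

theorem continuousOn_expIntInv : ContinuousOn expIntInv (Set.Ioi 0) := by
  intro s hs
  refine ContinuousAt.continuousWithinAt ?_
  have h1 : ContinuousAt (fun s => -expIntInv s) s := by
    refine continuousAt_of_monotoneOn_of_image_mem_nhds (s := Set.Ioi 0)
      (fun a ha b hb hab => neg_le_neg (strictAntiOn_expIntInv.antitoneOn ha hb hab))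
      (Ioi_mem_nhds hs) ?_
    have h2 : (fun s => -expIntInv s) '' Set.Ioi 0 = Set.Iio 0 := by
      rw [← Set.image_image (fun x : ℝ => -x) expIntInv, image_expIntInv]
      simp
    rw [h2]
    exact Iio_mem_nhds (neg_lt_zero.2 (expIntInv_pos hs))
  exact h1.neg.congr (Eventually.of_forall fun u => neg_neg _)

theorem measurable_expIntInv : Measurable expIntInv := by
  have h1 : expIntInv = Set.piecewise (Set.Ioi 0) expIntInv fun _ => 0 := by
    funext s
    by_cases hs : s ∈ Set.Ioi (0 : ℝ)
    · rw [Set.piecewise_eq_of_mem _ _ _ hs]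
    · rw [Set.piecewise_eq_of_notMem _ _ _ hs]
      -- For `s ≤ 0` no `r` qualifies, because `expInt` is positive on `(0, ∞)`; the infimum of the
      -- empty set is `0` by default.
      have : {r | 0 < r ∧ expInt r ≤ s} = ∅ := by
        ext r
        simp only [Set.mem_ofPred_eq, Set.mem_empty_iff_false, iff_false, not_and, not_le]
        intro hr
        exact (not_lt.1 (by simpa using hs)).trans_lt (expInt_pos hr)
      rw [expIntInv, this, Real.sInf_empty]
  rw [h1]
  exact continuousOn_expIntInv.measurable_piecewise continuousOn_const measurableSet_Ioi

/-- The substitution `s = expInt r` turns the unit intensity of the arrival times into the intensity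
`r⁻¹ e^{-r} dr` of the gamma process. -/
theorem integral_comp_expIntInv (h : ℝ → ℝ) :
    ∫ s in Set.Ioi 0, h (expIntInv s) = ∫ r in Set.Ioi 0, Real.exp (-r) / r * h r := by
  conv_lhs => rw [← image_expInt]
  rw [integral_image_eq_integral_abs_deriv_smul measurableSet_Ioi
    (fun r hr => (hasDerivAt_expInt hr).hasDerivWithinAt) strictAntiOn_expInt.injOn]
  refine setIntegral_congr_fun measurableSet_Ioi fun r hr => ?_
  have hr : 0 < r := hr
  rw [abs_neg, abs_of_pos (by positivity), expIntInv_expInt hr, smul_eq_mul]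

theorem integrableOn_comp_expIntInv {h : ℝ → ℝ}
    (hh : IntegrableOn (fun r => Real.exp (-r) / r * h r) (Set.Ioi 0)) :
    IntegrableOn (fun s => h (expIntInv s)) (Set.Ioi 0) := by
  rw [← image_expInt]
  rw [integrableOn_image_iff_integrableOn_abs_deriv_smul measurableSet_Ioi
    (fun r hr => (hasDerivAt_expInt hr).hasDerivWithinAt) strictAntiOn_expInt.injOn]
  refine hh.congr_fun (fun r hr => ?_) measurableSet_Ioi
  have hr : 0 < r := hr
  rw [abs_neg, abs_of_pos (by positivity), expIntInv_expInt hr, smul_eq_mul]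

end ExpInt

/-! ### Expectations with respect to the infinite-dimensional Lebesgue measure -/

section LebesgueMeasure

variable {X : Type*} [MeasurableSpace X] (m : Measure X) [IsProbabilityMeasure m]

/-- The configuration with given waiting times and marks. -/
def gammaConfig (ω : ℕ → ℝ × X) : Config X := fun k => (expIntInv (arrival ω (k + 1)), (ω k).2)

theorem measurable_gammaConfig : Measurable (gammaConfig (X := X)) :=
  measurable_pi_iff.2 fun k => (measurable_expIntInv.comp (measurable_arrival (k + 1))).prodMk
    (measurable_snd.comp (measurable_pi_apply k))

theorem gammaLaw_eq : gammaLaw m = (markLaw m).map gammaConfig := rfl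

theorem measurable_weight (k : ℕ) : Measurable fun ξ : Config X => (ξ k).1 :=
  measurable_fst.comp (measurable_pi_apply k)

theorem measurable_point (k : ℕ) : Measurable fun ξ : Config X => (ξ k).2 :=
  measurable_snd.comp (measurable_pi_apply k)

theorem measurable_totalMass : Measurable fun ξ : Config X => ∑' k, (ξ k).1 :=
  Measurable.tsum fun k => measurable_weight k

theorem ae_infLebesgue {p : Config X → Prop} (hp : MeasurableSet {ξ | p ξ})
    (h : ∀ᵐ ω ∂(markLaw m), p (gammaConfig ω)) : ∀ᵐ ξ ∂(infLebesgue m), p ξ := by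
  refine (withDensity_absolutelyContinuous _ _).ae_le ?_
  rw [gammaLaw_eq]
  exact (ae_map_iff measurable_gammaConfig.aemeasurable hp).2 h

theorem integral_infLebesgue {f : Config X → ℝ} (hf : Measurable f) :
    ∫ ξ, f ξ ∂(infLebesgue m) = ∫ ω, Real.exp (∑' k, (gammaConfig ω k).1) * f (gammaConfig ω)
      ∂(markLaw m) := by
  have hm := measurable_totalMass (X := X)
  rw [infLebesgue, integral_withDensity_eq_integral_toReal_smul (by fun_prop)
    (Eventually.of_forall fun _ => ENNReal.ofReal_lt_top), gammaLaw_eq,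
    integral_map measurable_gammaConfig.aemeasurable]
  · simp [ENNReal.toReal_ofReal (Real.exp_pos _).le]
  · exact Measurable.aestronglyMeasurable (by fun_prop)

theorem integrable_infLebesgue {f : Config X → ℝ} (hf : Measurable f)
    (hi : Integrable (fun ω => Real.exp (∑' k, (gammaConfig ω k).1) * f (gammaConfig ω))
      (markLaw m)) : Integrable f (infLebesgue m) := by
  have hm := measurable_totalMass (X := X)
  rw [infLebesgue, integrable_withDensity_iff_integrable_smul' (by fun_prop)
    (Eventually.of_forall fun _ => ENNReal.ofReal_lt_top), gammaLaw_eq,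
    integrable_map_measure (Measurable.aestronglyMeasurable (by fun_prop))
      measurable_gammaConfig.aemeasurable]
  simpa [Function.comp_def, ENNReal.toReal_ofReal (Real.exp_pos _).le] using hi

theorem ae_summable_of_integrable {b : ℝ → ℝ} (hbm : Measurable b)
    (hbc : ContinuousOn b (Set.Ioi 0)) (hb0 : ∀ r, 0 < r → 0 ≤ b r)
    (hbi : IntegrableOn (fun r => Real.exp (-r) / r * b r) (Set.Ioi 0)) :
    ∀ᵐ ω ∂(markLaw m), Summable fun k => b (gammaConfig ω k).1 := by
  -- Only the summability of the dominating function is used, so `θ` can be zero.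
  refine (campbell m (θ := fun _ _ => 0) (B := fun s => b (expIntInv s)) measurable_const
    (fun x => continuousOn_const) (integrableOn_comp_expIntInv hbi)
    (hbc.comp continuousOn_expIntInv fun s hs => expIntInv_pos hs)
    (hbm.comp measurable_expIntInv) fun s hs x => ?_).1
  simpa using hb0 _ (expIntInv_pos hs)

theorem ae_summable_weights : ∀ᵐ ω ∂(markLaw m), Summable fun k => (gammaConfig ω k).1 := by
  refine ae_summable_of_integrable m (b := fun r => r) measurable_id continuousOn_id
    (fun r hr => hr.le) ?_
  refine (integrableOn_exp_neg_Ioi 0).congr_fun (fun r hr => ?_) measurableSet_Ioi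
  exact (div_mul_cancel₀ _ (ne_of_gt hr)).symm

/-- Integrals of products over the points of a configuration. -/
theorem lebesgue_campbell {ψ : ℝ → X → ℝ} {b : ℝ → ℝ} (hψ : Measurable (Function.uncurry ψ))
    (hψc : ∀ x, ContinuousOn (fun r => ψ r x) (Set.Ioi 0)) (hbm : Measurable b)
    (hbc : ContinuousOn b (Set.Ioi 0)) (hbi : IntegrableOn (fun r => b r / r) (Set.Ioi 0))
    (hψb : ∀ r, 0 < r → ∀ x, |ψ r x - Real.exp (-r)| ≤ b r) :
    Integrable (fun ξ : Config X => ∏' k, ψ (ξ k).1 (ξ k).2) (infLebesgue m) ∧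
    ∫ ξ : Config X, ∏' k, ψ (ξ k).1 (ξ k).2 ∂(infLebesgue m)
      = Real.exp (∫ x, (∫ r in Set.Ioi 0, (ψ r x - Real.exp (-r)) / r) ∂m) := by
  have hbi' : IntegrableOn (fun r => Real.exp (-r) / r * (Real.exp r * b r)) (Set.Ioi 0) := by
    refine hbi.congr_fun (fun r _ => ?_) measurableSet_Ioi
    simp only [Real.exp_neg]
    field_simp
  have hR := measurable_expIntInv
  -- The density `e^{∑ r_k}` is distributed over the points, so that each factor becomes `e^r ψ`.
  -- Its deviation from `1` is `e^r (ψ - e^{-r})`, and the intensity `e^{-r}/r` turns this into `(ψ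
  -- - e^{-r})/r`.
  obtain ⟨hs, hi, he⟩ := campbell m
    (θ := fun s x => Real.exp (expIntInv s) * ψ (expIntInv s) x - 1)
    (B := fun s => Real.exp (expIntInv s) * b (expIntInv s))
    (((Real.measurable_exp.comp (hR.comp measurable_fst)).mul
      (hψ.comp ((hR.comp measurable_fst).prodMk measurable_snd))).sub_const 1)
    (fun x => ((Real.continuous_exp.comp_continuousOn continuousOn_expIntInv).mul
      ((hψc x).comp continuousOn_expIntInv fun s hs => expIntInv_pos hs)).sub continuousOn_const)
    (integrableOn_comp_expIntInv hbi')
    ((Real.continuous_exp.comp_continuousOn continuousOn_expIntInv).mul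
      (hbc.comp continuousOn_expIntInv fun s hs => expIntInv_pos hs))
    ((Real.measurable_exp.comp hR).mul (hbm.comp hR))
    (fun s hs x => by
      have h1 := hψb _ (expIntInv_pos hs) x
      have h2 : Real.exp (expIntInv s) * ψ (expIntInv s) x - 1
          = Real.exp (expIntInv s) * (ψ (expIntInv s) x - Real.exp (-expIntInv s)) := by
        rw [mul_sub, ← Real.exp_add]; simp
      rw [h2, abs_mul, abs_of_pos (Real.exp_pos _)]
      exact mul_le_mul_of_nonneg_left h1 (Real.exp_pos _).le)
  have hm : Measurable fun ξ : Config X => ∏' k, ψ (ξ k).1 (ξ k).2 :=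
    Measurable.tprod fun k => hψ.comp ((measurable_weight k).prodMk (measurable_point k))
  have hfac : (fun ω => ∏' k, (1 + (Real.exp (expIntInv (arrival ω (k + 1))) *
      ψ (expIntInv (arrival ω (k + 1))) (ω k).2 - 1))) =ᵐ[markLaw m] fun ω =>
      Real.exp (∑' k, (gammaConfig ω k).1) *
        ∏' k, ψ (gammaConfig ω k).1 (gammaConfig ω k).2 := by
    filter_upwards [ae_summable_weights m, hs, ae_markLaw_pos m] with ω hω hs hpos
    have hmul : Multipliable fun k => Real.exp (gammaConfig ω k).1 *
        ψ (gammaConfig ω k).1 (gammaConfig ω k).2 := by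
      have := multipliable_one_add_of_summable (R := ℝ)
        (f := fun k => Real.exp (gammaConfig ω k).1 *
          ψ (gammaConfig ω k).1 (gammaConfig ω k).2 - 1)
        (Summable.of_nonneg_of_le (fun _ => norm_nonneg _) (fun k => ?_) hs)
      · simpa using this
      · have h1 := hψb _ (expIntInv_pos (arrival_succ_pos hpos k)) (ω k).2
        have h2 : Real.exp (gammaConfig ω k).1 * ψ (gammaConfig ω k).1 (gammaConfig ω k).2 - 1
            = Real.exp (gammaConfig ω k).1 * (ψ (gammaConfig ω k).1 (gammaConfig ω k).2
              - Real.exp (-(gammaConfig ω k).1)) := by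
          rw [mul_sub, ← Real.exp_add]; simp
        rw [h2, norm_mul, Real.norm_of_nonneg (Real.exp_pos _).le]
        exact mul_le_mul_of_nonneg_left h1 (Real.exp_pos _).le
    have he1 : HasProd (fun k => Real.exp (-(gammaConfig ω k).1))
        (Real.exp (∑' k, -(gammaConfig ω k).1)) := hω.neg.hasSum.rexp
    have he2 : HasProd (fun k => Real.exp (gammaConfig ω k).1)
        (Real.exp (∑' k, (gammaConfig ω k).1)) := hω.hasSum.rexp
    have hmul2 : Multipliable fun k => ψ (gammaConfig ω k).1 (gammaConfig ω k).2 := by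
      refine (he1.multipliable.mul hmul).congr fun k => ?_
      rw [← mul_assoc, ← Real.exp_add]; simp
    rw [← he2.tprod_eq, ← Multipliable.tprod_mul he2.multipliable hmul2]
    refine tprod_congr fun k => ?_
    simp [gammaConfig]
  refine ⟨integrable_infLebesgue m hm (hi.congr hfac), ?_⟩
  rw [integral_infLebesgue m hm, ← integral_congr_ae hfac, he]
  congr 1
  rw [integral_comp_expIntInv fun r => ∫ x, (Real.exp r * ψ r x - 1) ∂m]
  have hpi : Integrable (Function.uncurry fun r x => (ψ r x - Real.exp (-r)) / r)
      ((volume.restrict (Set.Ioi 0)).prod m) := by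
    refine (hbi.integrable.comp_fst m).mono' ?_ ?_
    · exact ((hψ.sub (Real.measurable_exp.comp measurable_fst.neg)).div
        measurable_fst).aestronglyMeasurable
    · have h1 : ∀ᵐ r ∂(volume.restrict (Set.Ioi (0 : ℝ))), 0 < r :=
        ae_restrict_mem measurableSet_Ioi
      filter_upwards [Measure.quasiMeasurePreserving_fst.ae h1] with p hp
      simp only [Function.uncurry, norm_div, Real.norm_eq_abs, abs_of_pos hp]
      exact div_le_div_of_nonneg_right (hψb _ hp _) hp.le
  rw [← integral_integral_swap hpi]
  refine setIntegral_congr_fun measurableSet_Ioi fun r hr => ?_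
  rw [← integral_const_mul]
  refine integral_congr_ae (Eventually.of_forall fun x => ?_)
  simp only [Real.exp_neg]
  field_simp

end LebesgueMeasure

/-! ### Integrals of Frullani type -/

section Frullani

/-- Mean value inequality on the convex half-plane of the `z` with `Re z ≥ min (Re a) (Re b)`, where
the derivative is bounded by the larger of the two exponentials. -/
theorem norm_exp_neg_sub_le (a b : ℂ) :
    ‖Complex.exp (-a) - Complex.exp (-b)‖ ≤ ‖a - b‖ * (Real.exp (-a.re) + Real.exp (-b.re)) := by
  have hconv : Convex ℝ {z : ℂ | min a.re b.re ≤ z.re} := convex_halfSpace_re_ge _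
  have h1 := hconv.norm_image_sub_le_of_norm_hasDerivWithin_le (f := fun z => Complex.exp (-z))
    (f' := fun z => Complex.exp (-z) * (-1)) (C := Real.exp (-a.re) + Real.exp (-b.re))
    (x := b) (y := a)
    (fun z _ => ((hasDerivAt_neg z).cexp).hasDerivWithinAt) (fun z hz => ?_)
    (show min a.re b.re ≤ b.re from min_le_right _ _)
    (show min a.re b.re ≤ a.re from min_le_left _ _)
  · rw [mul_comm]; exact h1
  · have hz : min a.re b.re ≤ z.re := hz
    rw [norm_mul, Complex.norm_exp]
    simp only [Complex.neg_re, norm_neg, norm_one, mul_one]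
    rcases min_le_iff.1 hz with h | h
    · exact (Real.exp_le_exp.2 (neg_le_neg h)).trans (le_add_of_nonneg_right (Real.exp_pos _).le)
    · exact (Real.exp_le_exp.2 (neg_le_neg h)).trans (le_add_of_nonneg_left (Real.exp_pos _).le)

/-- A bound for the differences `e^{-ρ r ^ p} - e^{-r}` with `c ≤ Re ρ` and `|ρ| ≤ C`. -/
def expDiffBound (p : ℕ) (c C r : ℝ) : ℝ :=
  (C * r ^ p + r) * (Real.exp (-(c * r ^ p)) + Real.exp (-r))

theorem continuous_expDiffBound (p : ℕ) (c C : ℝ) : Continuous (expDiffBound p c C) := by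
  unfold expDiffBound
  fun_prop

theorem integrableOn_expDiffBound_one {c C : ℝ} (hc : 0 < c) :
    IntegrableOn (fun r => expDiffBound 1 c C r / r) (Set.Ioi 0) := by
  have h1 : IntegrableOn (fun r => (C + 1) * (Real.exp (-c * r) + Real.exp (-r))) (Set.Ioi 0) :=
    ((integrableOn_exp_mul_Ioi (by linarith) 0).add (integrableOn_exp_neg_Ioi 0)).const_mul _
  refine h1.congr_fun (fun r hr => ?_) measurableSet_Ioi
  have hr : 0 < r := hr
  simp only [expDiffBound, pow_one]
  field_simp

theorem integrableOn_expDiffBound_two {c C : ℝ} (hc : 0 < c) :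
    IntegrableOn (fun r => expDiffBound 2 c C r / r) (Set.Ioi 0) := by
  have h0 : IntegrableOn (fun r => Real.exp (-r) * r) (Set.Ioi 0) := by
    have := Real.GammaIntegral_convergent (s := 2) (by norm_num)
    refine this.congr_fun (fun r _ => ?_) measurableSet_Ioi
    norm_num
  have h1 : IntegrableOn (fun r => C * (r * Real.exp (-c * r ^ 2)) + C * (Real.exp (-r) * r) +
      (Real.exp (-c * r ^ 2) + Real.exp (-r))) (Set.Ioi 0) :=
    (((integrable_mul_exp_neg_mul_sq hc).integrableOn.const_mul C).add (h0.const_mul C)).add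
      ((integrable_exp_neg_mul_sq hc).integrableOn.add (integrableOn_exp_neg_Ioi 0))
  refine h1.congr_fun (fun r hr => ?_) measurableSet_Ioi
  have hr : 0 < r := hr
  simp only [expDiffBound, neg_mul]
  field_simp

theorem norm_exp_neg_pow_sub_le (p : ℕ) {c C : ℝ} {ρ : ℂ} (hc : c ≤ ρ.re) (hC : ‖ρ‖ ≤ C) {r : ℝ}
    (hr : 0 < r) :
    ‖Complex.exp (-(ρ * (r : ℂ) ^ p)) - Complex.exp (-(r : ℂ))‖ ≤ expDiffBound p c C r := by
  refine (norm_exp_neg_sub_le _ _).trans ?_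
  have h1 : (ρ * (r : ℂ) ^ p).re = ρ.re * r ^ p := by
    rw [← Complex.ofReal_pow, Complex.re_mul_ofReal]
  have h2 : ‖ρ * (r : ℂ) ^ p - r‖ ≤ C * r ^ p + r := by
    refine (norm_sub_le _ _).trans ?_
    rw [norm_mul, norm_pow, Complex.norm_real, Real.norm_of_nonneg hr.le]
    gcongr
  rw [h1, Complex.ofReal_re]
  have h3 : Real.exp (-(ρ.re * r ^ p)) ≤ Real.exp (-(c * r ^ p)) :=
    Real.exp_le_exp.2 (neg_le_neg (mul_le_mul_of_nonneg_right hc (by positivity)))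
  unfold expDiffBound
  have h4 : 0 ≤ C := (norm_nonneg _).trans hC
  gcongr

/-- The Frullani integral of the Gaussian. -/
def gaussFrullani (ρ : ℂ) : ℂ :=
  ∫ r in Set.Ioi (0 : ℝ), (Complex.exp (-(ρ * (r : ℂ) ^ 2)) - Complex.exp (-(r : ℂ))) / r

theorem integrableOn_gaussFrullani {ρ : ℂ} (hρ : 0 < ρ.re) : IntegrableOn (fun r : ℝ =>
    (Complex.exp (-(ρ * (r : ℂ) ^ 2)) - Complex.exp (-(r : ℂ))) / r) (Set.Ioi 0) := by
  refine (integrableOn_expDiffBound_two (C := ‖ρ‖) hρ).mono' (Measurable.aestronglyMeasurable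
    (by fun_prop)) ?_
  filter_upwards [ae_restrict_mem measurableSet_Ioi] with r hr
  have hr : 0 < r := hr
  rw [norm_div, Complex.norm_real, Real.norm_of_nonneg hr.le]
  exact div_le_div_of_nonneg_right (norm_exp_neg_pow_sub_le 2 le_rfl le_rfl hr) hr.le

/-- Differentiation under the integral cancels the factor `1/r` and leaves `-∫ r e^{-ρ r²} dr`. -/
theorem hasDerivAt_gaussFrullani {ρ : ℂ} (hρ : 0 < ρ.re) :
    HasDerivAt gaussFrullani (-(2 * ρ)⁻¹) ρ := by
  have hs : {z : ℂ | ρ.re / 2 < z.re} ∈ nhds ρ :=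
    (isOpen_lt continuous_const Complex.continuous_re).mem_nhds (show ρ.re / 2 < ρ.re by linarith)
  have h := (hasDerivAt_integral_of_dominated_loc_of_deriv_le
    (μ := volume.restrict (Set.Ioi (0 : ℝ))) (𝕜 := ℂ)
    (F := fun (z : ℂ) (r : ℝ) =>
      (Complex.exp (-(z * (r : ℂ) ^ 2)) - Complex.exp (-(r : ℂ))) / r)
    (F' := fun (z : ℂ) (r : ℝ) => -(r * Complex.exp (-z * (r : ℂ) ^ 2)))
    (bound := fun r => r * Real.exp (-(ρ.re / 2) * r ^ 2)) hs
    (Eventually.of_forall fun z => Measurable.aestronglyMeasurable (by fun_prop))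
    (integrableOn_gaussFrullani hρ) (Measurable.aestronglyMeasurable (by fun_prop)) ?_
    (integrable_mul_exp_neg_mul_sq (by linarith)).integrableOn ?_).2
  · rw [integral_neg, integral_mul_cexp_neg_mul_sq hρ] at h
    exact h
  · filter_upwards [ae_restrict_mem measurableSet_Ioi] with r hr z hz
    have hr : 0 < r := hr
    have hz : ρ.re / 2 < z.re := hz
    rw [norm_neg, norm_mul, Complex.norm_real, Real.norm_of_nonneg hr.le, Complex.norm_exp]
    have : (-z * (r : ℂ) ^ 2).re = -(z.re * r ^ 2) := by
      rw [← Complex.ofReal_pow, Complex.re_mul_ofReal, Complex.neg_re, neg_mul]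
    rw [this]
    refine mul_le_mul_of_nonneg_left (Real.exp_le_exp.2 ?_) hr.le
    nlinarith [sq_nonneg r]
  · filter_upwards [ae_restrict_mem measurableSet_Ioi] with r hr z _
    have hr : (r : ℂ) ≠ 0 := by exact_mod_cast (ne_of_gt hr)
    have h1 := (((((hasDerivAt_id z).mul_const ((r : ℂ) ^ 2)).neg).cexp).sub_const
      (Complex.exp (-(r : ℂ)))).div_const (r : ℂ)
    refine h1.congr_deriv ?_
    simp only [id, neg_mul, Pi.neg_apply]
    field_simp

/-- By the derivative just found, `gaussFrullani + ½ log` is constant on the right half-plane. Real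
parts suffice, since the inner products are real. -/
theorem re_gaussFrullani {ρ : ℂ} (hρ : 0 < ρ.re) :
    (gaussFrullani ρ).re = (gaussFrullani 1).re - Real.log ‖ρ‖ / 2 := by
  have hopen : IsOpen {z : ℂ | 0 < z.re} := isOpen_lt continuous_const Complex.continuous_re
  have hd : ∀ z : ℂ, 0 < z.re →
      HasDerivAt (fun z => gaussFrullani z + Complex.log z / 2) 0 z := by
    intro z hz
    have hz0 : z ≠ 0 := fun h => by simp [h] at hz
    have h1 := (hasDerivAt_gaussFrullani hz).add
      ((Complex.hasDerivAt_log (Or.inl hz)).div_const 2)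
    refine h1.congr_deriv ?_
    field_simp
    ring
  have h1 := hopen.is_const_of_deriv_eq_zero (𝕜 := ℂ) (convex_halfSpace_re_gt 0).isPreconnected
    (fun z hz => (hd z hz).differentiableAt.differentiableWithinAt)
    (fun z hz => (hd z hz).deriv) (x := ρ) (y := 1) hρ (by simp)
  have h2 := congrArg Complex.re h1
  simp only [Complex.add_re, Complex.log_one, zero_div, add_zero] at h2
  have h3 : (Complex.log ρ / 2).re = Real.log ‖ρ‖ / 2 := by
    rw [show (2 : ℂ) = ((2 : ℝ) : ℂ) by norm_num, Complex.div_ofReal_re, Complex.log_re]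
  linarith

/-- The constant `∫_0^∞ (e^{-r²} - e^{-r}) r⁻¹ dr`. -/
def frullaniConst : ℝ := (gaussFrullani 1).re

theorem integral_re_gauss {ρ : ℂ} (hρ : 0 < ρ.re) :
    ∫ r in Set.Ioi (0 : ℝ), ((Complex.exp (-(ρ * (r : ℂ) ^ 2))).re - Real.exp (-r)) / r
      = frullaniConst - Real.log ‖ρ‖ / 2 := by
  rw [frullaniConst, ← re_gaussFrullani hρ, gaussFrullani]
  have := integral_re (𝕜 := ℂ) (integrableOn_gaussFrullani hρ)
  simp only [RCLike.re_eq_complex_re] at this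
  rw [← this]
  refine integral_congr_ae (Eventually.of_forall fun r => ?_)
  simp only
  rw [Complex.div_ofReal_re, Complex.sub_re, ← Complex.ofReal_neg, Complex.exp_ofReal_re]

theorem integral_exp_frullani {a : ℝ} (ha : 0 < a) :
    ∫ r in Set.Ioi (0 : ℝ), (Real.exp (-(a * r)) - Real.exp (-r)) / r = -Real.log a := by
  have hint : IntegrableOn (fun r : ℝ => (Real.exp (-(a * r)) - Real.exp (-r)) / r)
      (Set.Ioi 0) := by
    refine (integrableOn_expDiffBound_one (C := a) ha).mono' (Measurable.aestronglyMeasurable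
      (by fun_prop)) ?_
    filter_upwards [ae_restrict_mem measurableSet_Ioi] with r hr
    have hr : 0 < r := hr
    rw [norm_div, Real.norm_of_nonneg hr.le]
    refine div_le_div_of_nonneg_right ?_ hr.le
    have := norm_exp_neg_pow_sub_le 1 (ρ := (a : ℂ)) (c := a) (C := a) (by simp)
      (by simp [abs_of_pos ha]) hr
    rw [← Complex.norm_real]
    push_cast
    simpa using this
  have h := Frullani.integral_Ioi_eq (f := fun x : ℝ => Real.exp (-x)) (a := a) (b := 1) (L := 1)
    (R := 0) ((by fun_prop : Continuous fun x : ℝ => Real.exp (-x)).locallyIntegrable.locallyIntegrableOn _)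
    ha one_pos
    (((by fun_prop : Continuous fun x : ℝ => Real.exp (-x)).tendsto' 0 1 (by simp)).mono_left
      nhdsWithin_le_nhds) Real.tendsto_exp_neg_atTop_nhds_zero ?_
  · simp only [smul_eq_mul, one_mul, sub_zero, mul_one, one_div, Real.log_inv] at h
    rw [← h]
    refine integral_congr_ae (Eventually.of_forall fun r => ?_)
    simp only
    ring
  · refine hint.congr_fun (fun r _ => ?_) measurableSet_Ioi
    simp only [smul_eq_mul, one_mul]
    ring

end Frullani

/-! ### The configurations of the gamma process -/

section Configurations

variable {X : Type*} [MeasurableSpace X] [StandardBorelSpace X] (m : Measure X)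
  [IsProbabilityMeasure m] [NullSingletonClass m]

theorem measurableSet_eq_points {Ω : Type*} [MeasurableSpace Ω] {f g : Ω → X} (hf : Measurable f)
    (hg : Measurable g) : MeasurableSet {ω | f ω = g ω} := by
  have : {ω | f ω = g ω} = ⋂ N, {ω | bits X N (f ω) = bits X N (g ω)} := by
    ext ω
    simp only [Set.mem_ofPred_eq, Set.mem_iInter]
    exact ⟨fun h N => by rw [h], fun h => eq_of_bits_eq h⟩
  rw [this]
  exact MeasurableSet.iInter fun N => measurableSet_eq_fun ((measurable_bits X N).comp hf)
    ((measurable_bits X N).comp hg)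

theorem measurableSet_summable_weights :
    MeasurableSet {ξ : Config X | Summable fun k => (ξ k).1} :=
  measurableSet_exists_tendsto (l := (SummationFilter.unconditional ℕ).filter)
    (f := fun (s : Finset ℕ) (ξ : Config X) => ∑ k ∈ s, (ξ k).1)
    fun _ => Finset.measurable_sum _ fun k _ => measurable_weight k

theorem measurableSet_l1plus : MeasurableSet (l1plus X) := by
  have h1 : MeasurableSet {ξ : Config X | StrictAnti fun k => (ξ k).1} := by
    have : {ξ : Config X | StrictAnti fun k => (ξ k).1} = ⋂ n, {ξ | (ξ (n + 1)).1 < (ξ n).1} := by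
      ext ξ
      simp only [Set.mem_ofPred_eq, Set.mem_iInter]
      exact ⟨fun h n => h (Nat.lt_succ_self n), fun h => strictAnti_nat_of_succ_lt h⟩
    rw [this]
    exact MeasurableSet.iInter fun n => measurableSet_lt (measurable_weight _) (measurable_weight _)
  have h2 : MeasurableSet {ξ : Config X | ∀ k, 0 < (ξ k).1} := by
    rw [Set.ofPred_forall]
    exact MeasurableSet.iInter fun k => measurableSet_lt measurable_const (measurable_weight k)
  have h3 : MeasurableSet {ξ : Config X | Function.Injective fun k => (ξ k).2} := by
    have : {ξ : Config X | Function.Injective fun k => (ξ k).2}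
        = ⋂ i, ⋂ j, {ξ | (ξ i).2 = (ξ j).2 → i = j} := by
      ext ξ
      simp only [Set.mem_ofPred_eq, Set.mem_iInter]
      exact ⟨fun h i j hij => h hij, fun h i j hij => h i j hij⟩
    rw [this]
    refine MeasurableSet.iInter fun i => MeasurableSet.iInter fun j => ?_
    exact (measurableSet_eq_points (measurable_point i) (measurable_point j)).imp
      (MeasurableSet.const _)
  exact h1.inter (h2.inter (measurableSet_summable_weights.inter h3))

theorem ae_markLaw_injective : ∀ᵐ ω ∂(markLaw m), Function.Injective fun k => (ω k).2 := by
  have h : ∀ i j : ℕ, i < j → ∀ᵐ ω ∂(markLaw m), (ω i).2 ≠ (ω j).2 := by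
    intro i j hij
    rw [ae_iff]
    simp only [ne_eq, not_not]
    refine infinitePi_null_of_slices _ j (measurableSet_eq_points
      (measurable_snd.comp (measurable_pi_apply i)) (measurable_snd.comp (measurable_pi_apply j)))
      fun ω => ?_
    have h1 : {y : ℝ × X | Function.update ω j y ∈ {ω : ℕ → ℝ × X | (ω i).2 = (ω j).2}}
        = Prod.snd ⁻¹' {(ω i).2} := by
      ext y
      simp [Function.update_of_ne hij.ne, eq_comm]
    rw [h1]
    exact Measure.quasiMeasurePreserving_snd.preimage_null (measure_singleton _)
  have h2 : ∀ᵐ ω ∂(markLaw m), ∀ i j : ℕ, i < j → (ω i).2 ≠ (ω j).2 := by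
    rw [ae_all_iff]; intro i
    rw [ae_all_iff]; intro j
    by_cases hij : i < j
    · filter_upwards [h i j hij] with ω hω _ using hω
    · exact Eventually.of_forall fun ω h => absurd h hij
  filter_upwards [h2] with ω hω i j hij
  rcases lt_trichotomy i j with h | h | h
  · exact absurd hij (hω i j h)
  · exact h
  · exact absurd hij.symm (hω j i h)

theorem ae_gammaConfig_mem : ∀ᵐ ω ∂(markLaw m), gammaConfig ω ∈ l1plus X := by
  filter_upwards [ae_markLaw_pos m, ae_summable_weights m, ae_markLaw_injective m] with ω h1 h2 h3
  refine ⟨fun i j hij => ?_, fun k => expIntInv_pos (arrival_succ_pos h1 k), h2, h3⟩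
  exact strictAntiOn_expIntInv (arrival_succ_pos h1 i) (arrival_succ_pos h1 j)
    (arrival_strictMono h1 (Nat.succ_lt_succ hij))

theorem ae_mem_l1plus : ∀ᵐ ξ ∂(infLebesgue m), ξ ∈ l1plus X :=
  ae_infLebesgue m measurableSet_l1plus (ae_gammaConfig_mem m)

instance : NullSingletonClass (expMeasure 1) :=
  ⟨fun x => (withDensity_absolutelyContinuous volume _) (measure_singleton x)⟩

/-- Almost surely the weights remain distinct under a multiplicator. -/
theorem ae_scaled_weights_injective {a : X → ℝ} (ha : Measurable a) (ha0 : ∀ x, 0 < a x) :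
    ∀ᵐ ξ ∂(infLebesgue m), Function.Injective fun k => a (ξ k).2 * (ξ k).1 := by
  have hm : ∀ i, Measurable fun ξ : Config X => a (ξ i).2 * (ξ i).1 := fun i =>
    (ha.comp (measurable_point i)).mul (measurable_weight i)
  have hset : MeasurableSet {ξ : Config X | Function.Injective fun k => a (ξ k).2 * (ξ k).1} := by
    have : {ξ : Config X | Function.Injective fun k => a (ξ k).2 * (ξ k).1}
        = ⋂ i, ⋂ j, {ξ | a (ξ i).2 * (ξ i).1 = a (ξ j).2 * (ξ j).1 → i = j} := by
      ext ξ
      simp only [Set.mem_ofPred_eq, Set.mem_iInter]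
      exact ⟨fun h i j hij => h hij, fun h i j hij => h i j hij⟩
    rw [this]
    refine MeasurableSet.iInter fun i => MeasurableSet.iInter fun j => ?_
    exact (measurableSet_eq_fun (hm i) (hm j)).imp (MeasurableSet.const _)
  refine ae_infLebesgue m hset ?_
  have h : ∀ i j : ℕ, i < j → ∀ᵐ ω ∂(markLaw m), a (gammaConfig ω i).2 * (gammaConfig ω i).1 ≠
      a (gammaConfig ω j).2 * (gammaConfig ω j).1 := by
    intro i j hij
    -- Positivity of the waiting times is built into the event because the slices are examined for
    -- every `ω`, not only for almost every one.
    have h0 : markLaw m {ω | (∀ k, 0 < (ω k).1) ∧ a (gammaConfig ω i).2 * (gammaConfig ω i).1 =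
        a (gammaConfig ω j).2 * (gammaConfig ω j).1} = 0 := by
      have hpos : MeasurableSet {ω : ℕ → ℝ × X | ∀ k, 0 < (ω k).1} := by
        rw [Set.ofPred_forall]
        exact MeasurableSet.iInter fun k => measurableSet_lt measurable_const
          (measurable_fst.comp (measurable_pi_apply k))
      refine infinitePi_null_of_slices _ j (hpos.inter (measurableSet_eq_fun
        ((hm i).comp measurable_gammaConfig) ((hm j).comp measurable_gammaConfig))) fun ω => ?_
      by_cases hω : ∀ k < j, 0 < (ω k).1
      · have hS : 0 ≤ arrival ω j :=
          Finset.sum_nonneg fun k hk => (hω k (Finset.mem_range.1 hk)).le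
        set c := a (ω i).2 * expIntInv (arrival ω (i + 1)) with hc
        -- With the other marks frozen the value at `i < j` is a constant `c`. As `expIntInv` is
        -- strictly decreasing on `(0, ∞)`, the coincidence leaves at most one waiting time for each
        -- point, and the exponential law has no atoms.
        refine measure_mono_null (t := {y : ℝ × X | 0 < y.1 ∧
          a y.2 * expIntInv (arrival ω j + y.1) = c}) ?_ ?_
        · rintro y ⟨hy1, hy2⟩
          have e1 : arrival (Function.update ω j y) (j + 1) = arrival ω j + y.1 := by
            rw [arrival_succ, Function.update_self, arrival, arrival]
            congr 1
            exact Finset.sum_congr rfl fun k hk => by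
              rw [Function.update_of_ne (Finset.mem_range.1 hk).ne]
          have e2 : arrival (Function.update ω j y) (i + 1) = arrival ω (i + 1) := by
            rw [arrival, arrival]
            exact Finset.sum_congr rfl fun k hk => by
              rw [Function.update_of_ne (by have := Finset.mem_range.1 hk; omega)]
          refine ⟨by simpa using hy1 j, ?_⟩
          have hy2 : a (Function.update ω j y i).2 *
              expIntInv (arrival (Function.update ω j y) (i + 1)) = a (Function.update ω j y j).2 *
              expIntInv (arrival (Function.update ω j y) (j + 1)) := hy2
          rw [e1, e2, Function.update_self, Function.update_of_ne hij.ne] at hy2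
          exact hy2.symm
        · have hms : MeasurableSet {y : ℝ × X | 0 < y.1 ∧
              a y.2 * expIntInv (arrival ω j + y.1) = c} :=
            (measurableSet_lt measurable_const measurable_fst).inter (measurableSet_eq_fun
              ((ha.comp measurable_snd).mul (measurable_expIntInv.comp
                (measurable_fst.const_add _))) measurable_const)
          rw [Measure.prod_apply_symm hms, lintegral_eq_zero_iff'
            (measurable_measure_prodMk_right hms).aemeasurable]
          refine Eventually.of_forall fun x => ?_
          refine Set.Subsingleton.measure_zero ?_ _
          rintro s ⟨hs0, hs⟩ t ⟨ht0, ht⟩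
          simp only at hs0 hs ht0 ht
          have h1 : expIntInv (arrival ω j + s) = expIntInv (arrival ω j + t) :=
            mul_left_cancel₀ (ha0 x).ne' (hs.trans ht.symm)
          have h2 := strictAntiOn_expIntInv.injOn (add_pos_of_nonneg_of_pos hS hs0)
            (add_pos_of_nonneg_of_pos hS ht0) h1
          linarith
      · refine measure_mono_null (t := ∅) ?_ measure_empty
        rintro y ⟨hy1, -⟩
        refine hω fun k hk => ?_
        have := hy1 k
        rwa [Function.update_of_ne hk.ne] at this
    have h1 : ∀ᵐ ω ∂(markLaw m), ¬ ((∀ k, 0 < (ω k).1) ∧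
        a (gammaConfig ω i).2 * (gammaConfig ω i).1 =
        a (gammaConfig ω j).2 * (gammaConfig ω j).1) := by
      rw [ae_iff]
      simpa only [not_not] using h0
    filter_upwards [h1, ae_markLaw_pos m] with ω hω hp h
    exact hω ⟨hp, h⟩
  have h2 : ∀ᵐ ω ∂(markLaw m), ∀ i j : ℕ, i < j → a (gammaConfig ω i).2 * (gammaConfig ω i).1 ≠
      a (gammaConfig ω j).2 * (gammaConfig ω j).1 := by
    rw [ae_all_iff]; intro i
    rw [ae_all_iff]; intro j
    by_cases hij : i < j
    · filter_upwards [h i j hij] with ω hω _ using hω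
    · exact Eventually.of_forall fun ω h => absurd h hij
  filter_upwards [h2] with ω hω i j hij
  rcases lt_trichotomy i j with h | h | h
  · exact absurd hij (hω i j h)
  · exact h
  · exact absurd hij.symm (hω j i h)

/-- The Laplace transform of the infinite-dimensional Lebesgue measure. -/
theorem laplace_infLebesgue {f : X → ℝ} (hf : Measurable f) {c C : ℝ} (hc : 0 < c)
    (hfc : ∀ x, c ≤ f x ∧ f x ≤ C) :
    Integrable (fun ξ : Config X => Real.exp (-∑' k, (ξ k).1 * f (ξ k).2)) (infLebesgue m) ∧
    ∫ ξ : Config X, Real.exp (-∑' k, (ξ k).1 * f (ξ k).2) ∂(infLebesgue m)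
      = Real.exp (-∫ x, Real.log (f x) ∂m) := by
  obtain ⟨h1, h2⟩ := lebesgue_campbell m (ψ := fun r x => Real.exp (-(f x * r)))
    (b := expDiffBound 1 c C)
    (Real.measurable_exp.comp ((hf.comp measurable_snd).mul measurable_fst).neg)
    (fun x => Continuous.continuousOn (by fun_prop)) (continuous_expDiffBound 1 c C).measurable
    (continuous_expDiffBound 1 c C).continuousOn (integrableOn_expDiffBound_one hc)
    (fun r hr x => by
      have := norm_exp_neg_pow_sub_le 1 (ρ := (f x : ℂ)) (c := c) (C := C) (by simpa using (hfc x).1)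
        (by rw [Complex.norm_real, Real.norm_of_nonneg (hc.le.trans (hfc x).1)]; exact (hfc x).2) hr
      rw [← Real.norm_eq_abs, ← Complex.norm_real]
      push_cast
      simpa using this)
  have h3 : (fun ξ : Config X => ∏' k, Real.exp (-(f (ξ k).2 * (ξ k).1))) =ᵐ[infLebesgue m]
      fun ξ => Real.exp (-∑' k, (ξ k).1 * f (ξ k).2) := by
    filter_upwards [ae_mem_l1plus m] with ξ hξ
    obtain ⟨-, hpos, hsum, -⟩ := hξ
    have hs : Summable fun k => (ξ k).1 * f (ξ k).2 :=
      Summable.of_nonneg_of_le (fun k => mul_nonneg (hpos k).le (hc.le.trans (hfc _).1))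
        (fun k => mul_le_mul_of_nonneg_left (hfc _).2 (hpos k).le) (hsum.mul_right C)
    rw [← tsum_neg, ← hs.neg.hasSum.rexp.tprod_eq]
    refine tprod_congr fun k => ?_
    simp [mul_comm]
  refine ⟨h1.congr h3, ?_⟩
  rw [← integral_congr_ae h3, h2]
  congr 1
  rw [← integral_neg]
  exact integral_congr_ae (Eventually.of_forall fun x =>
    integral_exp_frullani (hc.trans_le (hfc x).1))

end Configurations

/-! ### Bounded maps into the upper half-plane -/

section HalfPlaneMaps

variable {X : Type*} [MeasurableSpace X]

theorem exists_bounds_of_isBounded {s : Set ℍ} (hs : Bornology.IsBounded s) :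
    ∃ c C : ℝ, 0 < c ∧ ∀ z ∈ s, c ≤ z.im ∧ ‖(z : ℂ)‖ ≤ C := by
  have hK := hs.isCompact_closure
  obtain ⟨C, hC⟩ := hK.exists_bound_of_continuousOn UpperHalfPlane.continuous_coe.continuousOn
  obtain ⟨D, hD⟩ := hK.exists_bound_of_continuousOn (f := fun z : ℍ => z.im⁻¹)
    (UpperHalfPlane.continuous_im.inv₀ fun z => z.im_pos.ne').continuousOn
  refine ⟨(max D 1)⁻¹, C, by positivity, fun z hz => ⟨?_, hC z (subset_closure hz)⟩⟩
  have h1 := hD z (subset_closure hz)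
  rw [Real.norm_of_nonneg (inv_nonneg.2 z.im_pos.le)] at h1
  exact inv_le_of_inv_le₀ z.im_pos (h1.trans (le_max_left _ _))

theorem HalfPlaneMaps.exists_bounds (z : HalfPlaneMaps X) :
    ∃ c C : ℝ, 0 < c ∧ ∀ x, c ≤ (z.1 x).im ∧ ‖(z.1 x : ℂ)‖ ≤ C := by
  obtain ⟨c, C, hc, h⟩ := exists_bounds_of_isBounded z.2.2
  exact ⟨c, C, hc, fun x => h _ ⟨x, rfl⟩⟩

theorem HalfPlaneMaps.measurable_coe (z : HalfPlaneMaps X) : Measurable fun x => (z.1 x : ℂ) :=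
  measurable_comap_iff.1 z.2.1

theorem isBounded_of_bounds {s : Set ℍ} {c C : ℝ} (hc : 0 < c)
    (h : ∀ z ∈ s, c ≤ z.im ∧ ‖(z : ℂ)‖ ≤ C) : Bornology.IsBounded s := by
  refine (Metric.isBounded_iff_subset_closedBall UpperHalfPlane.I).2
    ⟨(C + 1) / Real.sqrt c, fun z hz => ?_⟩
  obtain ⟨h1, h2⟩ := h z hz
  refine (UpperHalfPlane.dist_le_dist_coe_div_sqrt _ _).trans ?_
  rw [UpperHalfPlane.I_im, mul_one]
  have h3 : dist (z : ℂ) (UpperHalfPlane.I : ℂ) ≤ C + 1 := by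
    rw [dist_eq_norm]
    refine (norm_sub_le _ _).trans (add_le_add h2 ?_)
    simp
  have h4 : 0 < Real.sqrt c := Real.sqrt_pos.2 hc
  have h5 := Real.sqrt_le_sqrt h1
  have h6 : 0 ≤ C + 1 := dist_nonneg.trans h3
  gcongr

/-- A bounded map into the upper half-plane given by its complex values. -/
def HalfPlaneMaps.mk (w : X → ℂ) (hw : Measurable w) {c C : ℝ} (hc : 0 < c)
    (h : ∀ x, c ≤ (w x).im ∧ ‖w x‖ ≤ C) : HalfPlaneMaps X :=
  ⟨fun x => ⟨w x, hc.trans_le (h x).1⟩, measurable_comap_iff.2 hw,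
    isBounded_of_bounds hc (by rintro _ ⟨x, rfl⟩; exact h x)⟩

end HalfPlaneMaps

/-! ### The functionals in the integral model -/

section Functionals

variable {X : Type*}

/-- The vectors `⊗ e^{i r_k² w(x_k)}`. -/
def expTens (w : X → ℂ) (ξ : Config X) : TensorH0 :=
  tens 1 norm_one fun k => Complex.exp (Complex.I * ((ξ k).1 : ℂ) ^ 2 * w (ξ k).2)

theorem summable_sq_weights {ξ : Config X} (hξ : ξ ∈ l1plus X) : Summable fun k => (ξ k).1 ^ 2 := by
  obtain ⟨-, hpos, hsum, -⟩ := hξ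
  refine Summable.of_nonneg_of_le (fun k => sq_nonneg _) (fun k => ?_)
    (hsum.mul_left (∑' k, (ξ k).1))
  rw [sq]
  exact mul_le_mul_of_nonneg_right (hsum.le_tsum k fun j _ => (hpos j).le) (hpos k).le

theorem norm_exp_sub_one_le {r : ℝ} {w : ℂ} (hw : 0 ≤ w.im) :
    ‖Complex.exp (Complex.I * (r : ℂ) ^ 2 * w) - 1‖ ≤ 2 * ‖w‖ * r ^ 2 := by
  have h := norm_exp_neg_sub_le (-(Complex.I * (r : ℂ) ^ 2 * w)) 0
  have h1 : (-(Complex.I * (r : ℂ) ^ 2 * w)).re = r ^ 2 * w.im := by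
    rw [mul_assoc, ← Complex.ofReal_pow, Complex.neg_re, Complex.I_mul_re, neg_neg,
      Complex.im_ofReal_mul]
  have h2 : ‖-(Complex.I * (r : ℂ) ^ 2 * w) - 0‖ = r ^ 2 * ‖w‖ := by
    rw [sub_zero, norm_neg, norm_mul, norm_mul, norm_pow, Complex.norm_I, Complex.norm_real,
      one_mul, Real.norm_eq_abs, sq_abs]
  rw [h1, h2] at h
  simp only [neg_neg, neg_zero, Complex.exp_zero, Complex.zero_re, Real.exp_zero] at h
  have h3 : Real.exp (-(r ^ 2 * w.im)) ≤ 1 :=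
    Real.exp_le_one_iff.2 (neg_nonpos.2 (mul_nonneg (sq_nonneg _) hw))
  have h4 : 0 ≤ r ^ 2 * ‖w‖ := by positivity
  nlinarith

theorem summable_exp_sub_one {w : X → ℂ} {C : ℝ} (hw : ∀ x, 0 ≤ (w x).im ∧ ‖w x‖ ≤ C)
    {ξ : Config X} (hξ : ξ ∈ l1plus X) : Summable fun k =>
      ‖Complex.exp (Complex.I * ((ξ k).1 : ℂ) ^ 2 * w (ξ k).2) - 1‖ := by
  refine Summable.of_nonneg_of_le (fun k => norm_nonneg _) (fun k => ?_)
    ((summable_sq_weights hξ).mul_left (2 * C))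
  refine (norm_exp_sub_one_le (hw _).1).trans ?_
  have := (hw (ξ k).2).2
  gcongr

/-- The real inner product of `ℂ` is `Re (w̄ v)`, so the two exponents combine to `-ρ r²` with `ρ =
-i (v - w̄)`. The real part of `ρ` is `Im v + Im w`, hence positive on the half-plane, and the
Gaussian Frullani integral applies. -/
theorem inner_exp_exp (r : ℝ) (w v : ℂ) :
    inner ℝ (Complex.exp (Complex.I * (r : ℂ) ^ 2 * w)) (Complex.exp (Complex.I * (r : ℂ) ^ 2 * v))
      = (Complex.exp (-(-Complex.I * (v - starRingEnd ℂ w) * (r : ℂ) ^ 2))).re := by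
  rw [Complex.inner, ← Complex.exp_conj, ← Complex.exp_add]
  congr 2
  simp only [map_mul, map_pow, Complex.conj_I, Complex.conj_ofReal]
  ring

theorem inner_expTens {w v : X → ℂ} {C : ℝ} (hw : ∀ x, 0 ≤ (w x).im ∧ ‖w x‖ ≤ C)
    (hv : ∀ x, 0 ≤ (v x).im ∧ ‖v x‖ ≤ C) {ξ : Config X} (hξ : ξ ∈ l1plus X) :
    inner ℝ (expTens w ξ) (expTens v ξ) = ∏' k, (Complex.exp (-(-Complex.I *
      (v (ξ k).2 - starRingEnd ℂ (w (ξ k).2)) * ((ξ k).1 : ℂ) ^ 2))).re := by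
  rw [expTens, expTens, inner_tens _ (summable_exp_sub_one hw hξ) (summable_exp_sub_one hv hξ)]
  exact tprod_congr fun k => inner_exp_exp _ _ _

/-- A factor `e^{- ∑ r_k² t(x_k)}` separates from the vectors `⊗ e^{i r_k² w(x_k)}`. -/
theorem expTens_add_mul_I {w : X → ℂ} {t : X → ℝ} {C : ℝ} (hw : ∀ x, 0 ≤ (w x).im ∧ ‖w x‖ ≤ C)
    (ht : ∀ x, 0 ≤ t x ∧ t x ≤ C) {ξ : Config X} (hξ : ξ ∈ l1plus X) :
    expTens (fun x => w x + t x * Complex.I) ξ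
      = Real.exp (-∑' k, (ξ k).1 ^ 2 * t (ξ k).2) • expTens w ξ := by
  have hC : ∀ x, 0 ≤ ((t x : ℂ) * Complex.I).im ∧ ‖(t x : ℂ) * Complex.I‖ ≤ C := fun x => by
    rw [norm_mul, Complex.norm_I, mul_one, Complex.norm_real, Real.norm_of_nonneg (ht x).1]
    simpa using ht x
  have e1 : ∀ k, Complex.exp (Complex.I * ((ξ k).1 : ℂ) ^ 2 * (t (ξ k).2 * Complex.I))
      = (Real.exp (-((ξ k).1 ^ 2 * t (ξ k).2)) : ℝ) := fun k => by
    push_cast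
    congr 1
    linear_combination ((ξ k).1 : ℂ) ^ 2 * t (ξ k).2 * Complex.I_mul_I
  have hs : Summable fun k => (ξ k).1 ^ 2 * t (ξ k).2 :=
    Summable.of_nonneg_of_le (fun k => mul_nonneg (sq_nonneg _) (ht _).1)
      (fun k => mul_le_mul_of_nonneg_left (ht _).2 (sq_nonneg _))
      ((summable_sq_weights hξ).mul_right C)
  have h := tens_smul norm_one (summable_exp_sub_one hw hξ)
    (c := fun k => Real.exp (-((ξ k).1 ^ 2 * t (ξ k).2))) (by
      refine (summable_exp_sub_one hC hξ).congr fun k => ?_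
      rw [e1, ← Complex.ofReal_one, ← Complex.ofReal_sub, Complex.norm_real])
  have h2 : ∏' k, Real.exp (-((ξ k).1 ^ 2 * t (ξ k).2))
      = Real.exp (-∑' k, (ξ k).1 ^ 2 * t (ξ k).2) := by
    rw [← tsum_neg]
    exact hs.neg.hasSum.rexp.tprod_eq
  rw [h2] at h
  rw [expTens, expTens, ← h]
  congr 1
  funext k
  rw [mul_add, Complex.exp_add, e1, Complex.real_smul, mul_comm]

variable [MeasurableSpace X]

theorem functional_eq (z : HalfPlaneMaps X) : functional z = expTens fun x => (z.1 x : ℂ) := rfl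

variable [StandardBorelSpace X] (m : Measure X) [IsProbabilityMeasure m] [NullSingletonClass m]

/-- On `l1plus X` the norms, and the inner products with decomposable vectors, are infinite products
of measurable functions. Outside it `tens` may take its default value `0`, so the field is cut off
there. -/
theorem aestronglyMeasurable_expTens {w : X → ℂ} (hwm : Measurable w) {C : ℝ}
    (hw : ∀ x, 0 ≤ (w x).im ∧ ‖w x‖ ≤ C) :
    AEStronglyMeasurable (expTens w) (infLebesgue m) := by
  have hms := measurableSet_l1plus (X := X)
  have hexp : ∀ k, Measurable fun ξ : Config X =>
      Complex.exp (Complex.I * ((ξ k).1 : ℂ) ^ 2 * w (ξ k).2) := fun k =>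
    ((((Complex.measurable_ofReal.comp (measurable_weight k)).pow_const 2).const_mul _).mul
      (hwm.comp (measurable_point k))).cexp
  have hd : Dense (Submodule.span ℝ (Set.range
      fun f : {f : ℕ → ℂ // Summable fun k => ‖f k - 1‖} => tens (1 : ℂ) norm_one f.1) :
      Set TensorH0) :=
    dense_span_of_inner_eq_zero fun x hx => eq_zero_of_inner_tens norm_one fun f hf => hx ⟨f, hf⟩
  refine ⟨(l1plus X).indicator (expTens w), stronglyMeasurable_of_inner hd (fun f => ?_) ?_, ?_⟩
  · have : (fun ξ => inner ℝ (tens (1 : ℂ) norm_one f.1) ((l1plus X).indicator (expTens w) ξ))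
        = (l1plus X).indicator fun ξ => ∏' k, inner ℝ (f.1 k)
          (Complex.exp (Complex.I * ((ξ k).1 : ℂ) ^ 2 * w (ξ k).2)) := by
      funext ξ
      by_cases hξ : ξ ∈ l1plus X
      · rw [Set.indicator_of_mem hξ, Set.indicator_of_mem hξ, expTens,
          inner_tens _ f.2 (summable_exp_sub_one hw hξ)]
      · rw [Set.indicator_of_notMem hξ, Set.indicator_of_notMem hξ, inner_zero_right]
    rw [this]
    exact (Measurable.tprod fun k => measurable_const.inner (hexp k)).indicator hms
  · have : (fun ξ => ‖(l1plus X).indicator (expTens w) ξ‖)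
        = (l1plus X).indicator fun ξ => Real.sqrt (∏' k, inner ℝ
          (Complex.exp (Complex.I * ((ξ k).1 : ℂ) ^ 2 * w (ξ k).2))
          (Complex.exp (Complex.I * ((ξ k).1 : ℂ) ^ 2 * w (ξ k).2))) := by
      funext ξ
      by_cases hξ : ξ ∈ l1plus X
      · rw [Set.indicator_of_mem hξ, Set.indicator_of_mem hξ, expTens,
          ← inner_tens norm_one (summable_exp_sub_one hw hξ) (summable_exp_sub_one hw hξ),
          real_inner_self_eq_norm_sq, Real.sqrt_sq (norm_nonneg _)]
      · rw [Set.indicator_of_notMem hξ, Set.indicator_of_notMem hξ, norm_zero]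
    rw [this]
    exact (Measurable.tprod fun k => (hexp k).inner (hexp k)).sqrt.indicator hms
  · filter_upwards [ae_mem_l1plus m] with ξ hξ
    rw [Set.indicator_of_mem hξ]

/-- The inner product in the fibre is a product of Gaussian factors over the points. In the exponent
of Campbell's formula the inner integral over `r` is the Frullani integral at `ρ = -i (z₂ - z̄₁)`.
-/
theorem integral_inner_functional (z₁ z₂ : HalfPlaneMaps X) :
    Integrable (fun ξ => inner ℝ (functional z₁ ξ) (functional z₂ ξ)) (infLebesgue m) ∧
    ∫ ξ, inner ℝ (functional z₁ ξ) (functional z₂ ξ) ∂(infLebesgue m) = Real.exp (frullaniConst -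
      (∫ x, Real.log ‖(z₂.1 x : ℂ) - starRingEnd ℂ (z₁.1 x : ℂ)‖ ∂m) / 2) := by
  obtain ⟨c₁, C₁, hc₁, h₁⟩ := z₁.exists_bounds
  obtain ⟨c₂, C₂, hc₂, h₂⟩ := z₂.exists_bounds
  have hre : ∀ x, (-Complex.I * ((z₂.1 x : ℂ) - starRingEnd ℂ (z₁.1 x : ℂ))).re
      = (z₂.1 x).im + (z₁.1 x).im := fun x => by simp
  have hn : ∀ x, ‖-Complex.I * ((z₂.1 x : ℂ) - starRingEnd ℂ (z₁.1 x : ℂ))‖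
      = ‖(z₂.1 x : ℂ) - starRingEnd ℂ (z₁.1 x : ℂ)‖ := fun x => by
    rw [norm_mul, norm_neg, Complex.norm_I, one_mul]
  have hlow : ∀ x, c₁ + c₂ ≤ ‖(z₂.1 x : ℂ) - starRingEnd ℂ (z₁.1 x : ℂ)‖ := fun x => by
    rw [← hn]
    refine le_trans ?_ (Complex.re_le_norm _)
    rw [hre]
    linarith [(h₁ x).1, (h₂ x).1]
  have hup : ∀ x, ‖(z₂.1 x : ℂ) - starRingEnd ℂ (z₁.1 x : ℂ)‖ ≤ C₂ + C₁ := fun x =>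
    (norm_sub_le _ _).trans (add_le_add (h₂ x).2 (by rw [Complex.norm_conj]; exact (h₁ x).2))
  have hm₁ := z₁.measurable_coe
  have hm₂ := z₂.measurable_coe
  have hm : Measurable fun x => (z₂.1 x : ℂ) - starRingEnd ℂ (z₁.1 x : ℂ) :=
    hm₂.sub (Complex.continuous_conj.measurable.comp hm₁)
  obtain ⟨hi, he⟩ := lebesgue_campbell m
    (ψ := fun r x => (Complex.exp (-(-Complex.I * ((z₂.1 x : ℂ) - starRingEnd ℂ (z₁.1 x : ℂ)) *
      (r : ℂ) ^ 2))).re) (b := expDiffBound 2 (c₁ + c₂) (C₂ + C₁))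
    (Complex.measurable_re.comp ((((hm.comp measurable_snd).const_mul _).mul
      ((Complex.measurable_ofReal.comp measurable_fst).pow_const 2)).neg.cexp))
    (fun x => Continuous.continuousOn (by fun_prop)) (continuous_expDiffBound _ _ _).measurable
    (continuous_expDiffBound _ _ _).continuousOn (integrableOn_expDiffBound_two (by linarith))
    (fun r hr x => by
      have h := norm_exp_neg_pow_sub_le 2
        (ρ := -Complex.I * ((z₂.1 x : ℂ) - starRingEnd ℂ (z₁.1 x : ℂ))) (c := c₁ + c₂)
        (C := C₂ + C₁) (by rw [hre]; linarith [(h₁ x).1, (h₂ x).1]) (by rw [hn]; exact hup x) hr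
      refine le_trans ?_ h
      refine le_trans (le_of_eq ?_) (Complex.abs_re_le_norm _)
      rw [Complex.sub_re, ← Complex.ofReal_neg, Complex.exp_ofReal_re])
  have hae : (fun ξ : Config X => ∏' k, (Complex.exp (-(-Complex.I * ((z₂.1 (ξ k).2 : ℂ) -
      starRingEnd ℂ (z₁.1 (ξ k).2 : ℂ)) * ((ξ k).1 : ℂ) ^ 2))).re) =ᵐ[infLebesgue m]
      fun ξ => inner ℝ (functional z₁ ξ) (functional z₂ ξ) := by
    filter_upwards [ae_mem_l1plus m] with ξ hξ
    rw [functional_eq, functional_eq, inner_expTens (C := max C₁ C₂)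
      (fun x => ⟨(z₁.1 x).im_pos.le, (h₁ x).2.trans (le_max_left _ _)⟩)
      (fun x => ⟨(z₂.1 x).im_pos.le, (h₂ x).2.trans (le_max_right _ _)⟩) hξ]
  refine ⟨hi.congr hae, ?_⟩
  rw [← integral_congr_ae hae, he]
  congr 1
  have hb : ∀ x, ‖Real.log ‖(z₂.1 x : ℂ) - starRingEnd ℂ (z₁.1 x : ℂ)‖‖ ≤
      max |Real.log (c₁ + c₂)| |Real.log (C₂ + C₁)| := fun x => by
    rw [Real.norm_eq_abs]
    exact abs_le_max_abs_abs (Real.log_le_log (by linarith) (hlow x))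
      (Real.log_le_log (by linarith [hlow x]) (hup x))
  have hli : Integrable (fun x => Real.log ‖(z₂.1 x : ℂ) - starRingEnd ℂ (z₁.1 x : ℂ)‖) m :=
    Integrable.of_bound hm.norm.log.aestronglyMeasurable _ (Eventually.of_forall hb)
  rw [integral_congr_ae (g := fun x => frullaniConst -
    Real.log ‖(z₂.1 x : ℂ) - starRingEnd ℂ (z₁.1 x : ℂ)‖ / 2) (Eventually.of_forall fun x => ?_)]
  · rw [integral_sub (integrable_const _) (hli.div_const 2), integral_div]
    simp
  · simp only
    rw [integral_re_gauss (by rw [hre]; linarith [(z₁.1 x).im_pos, (z₂.1 x).im_pos]), hn]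

theorem memLp_functional (z : HalfPlaneMaps X) : MemLp (functional z) 2 (infLebesgue m) := by
  obtain ⟨c, C, -, h⟩ := z.exists_bounds
  refine (memLp_two_iff_integrable_sq_norm (aestronglyMeasurable_expTens m z.measurable_coe
    fun x => ⟨(z.1 x).im_pos.le, (h x).2⟩)).2 ?_
  refine (integral_inner_functional m z z).1.congr (Eventually.of_forall fun ξ => ?_)
  exact real_inner_self_eq_norm_sq _

/-- The functional `F⁰_z` as an element of the integral model. -/
def functionalLp (z : HalfPlaneMaps X) : IntH0 m := (memLp_functional m z).toLp _

theorem inner_functionalLp (z₁ z₂ : HalfPlaneMaps X) :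
    inner ℝ (functionalLp m z₁) (functionalLp m z₂) = Real.exp (frullaniConst -
      (∫ x, Real.log ‖(z₂.1 x : ℂ) - starRingEnd ℂ (z₁.1 x : ℂ)‖ ∂m) / 2) := by
  rw [← (integral_inner_functional m z₁ z₂).2, L2.inner_def]
  refine integral_congr_ae ?_
  filter_upwards [(memLp_functional m z₁).coeFn_toLp, (memLp_functional m z₂).coeFn_toLp]
    with ξ h1 h2
  rw [functionalLp, functionalLp, h1, h2]

end Functionals

/-! ### Moments of measures on a cube -/

section Moments

variable {ι : Type*} [Countable ι]

/-- The coordinate functions of a cube. -/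
def cubeCoord (i : ι) : BoundedContinuousFunction (ι → unitInterval) ℝ :=
  BoundedContinuousFunction.mkOfCompact ⟨fun t => (t i : ℝ), by fun_prop⟩

/-- The coordinates separate the points of the cube, so the algebra they generate separates finite
measures. This algebra is the linear span of the monomials. -/
theorem measure_cube_ext {P P' : Measure (ι → unitInterval)} [IsFiniteMeasure P]
    [IsFiniteMeasure P'] (h : ∀ f ∈ Submonoid.closure (Set.range (cubeCoord (ι := ι))),
      ∫ t, f t ∂P = ∫ t, f t ∂P') : P = P' := by
  let A : StarSubalgebra ℝ (BoundedContinuousFunction (ι → unitInterval) ℝ) :=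
    { Algebra.adjoin ℝ (Set.range cubeCoord) with
      star_mem' := fun {a} ha => by
        have : star a = a := by ext; simp
        rw [this]; exact ha }
  refine ext_of_forall_mem_subalgebra_integral_eq_of_polish (𝕜 := ℝ) (A := A) ?_ fun g hg => ?_
  · intro s t hst
    obtain ⟨i, hi⟩ := Function.ne_iff.1 hst
    refine ⟨_, ⟨_, ⟨cubeCoord i, Algebra.subset_adjoin ⟨i, rfl⟩, rfl⟩, rfl⟩, ?_⟩
    exact fun h => hi (Subtype.ext h)
  · have hg : g ∈ Subalgebra.toSubmodule (Algebra.adjoin ℝ (Set.range (cubeCoord (ι := ι)))) := hg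
    rw [Algebra.adjoin_eq_span] at hg
    clear * - hg h
    induction hg using Submodule.span_induction with
    | mem f hf => exact h f hf
    | zero => simp
    | add f g _ _ hf hg =>
      simp only [BoundedContinuousFunction.coe_add, Pi.add_apply]
      rw [integral_add (f.integrable P) (g.integrable P),
        integral_add (f.integrable P') (g.integrable P'), hf, hg]
    | smul c f _ hf =>
      simp only [BoundedContinuousFunction.coe_smul]
      rw [integral_smul, integral_smul, hf]

end Moments

/-! ### Sorting permutations -/

section Sorting

/-- The place of `k` in decreasing order is the number of larger terms, which is finite because the
positive sequence tends to `0`. This rank is a bijection of `ℕ`. -/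
theorem exists_sorting_perm {s : ℕ → ℝ} (hpos : ∀ k, 0 < s k) (hs : Tendsto s atTop (nhds 0))
    (hinj : Function.Injective s) : ∃ σ : Equiv.Perm ℕ, StrictAnti fun k => s (σ k) := by
  have hfin : ∀ k, {j | s k < s j}.Finite := fun k => by
    have h1 := hs.eventually (gt_mem_nhds (hpos k))
    rw [← Nat.cofinite_eq_atTop, eventually_cofinite] at h1
    exact h1.subset fun j hj => not_lt.2 (le_of_lt hj)
  let A : ℕ → Finset ℕ := fun k => (hfin k).toFinset
  have hA : ∀ k j, j ∈ A k ↔ s k < s j := fun k j => by simp [A]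
  let ρ : ℕ → ℕ := fun k => (A k).card
  have hlt : ∀ j k, s k < s j → ρ j < ρ k := fun j k h => by
    refine Finset.card_lt_card (Finset.ssubset_iff_subset_ne.2 ⟨fun i hi => ?_, fun he => ?_⟩)
    · rw [hA] at hi ⊢; exact h.trans hi
    · have : j ∈ A j := by rw [he, hA]; exact h
      rw [hA] at this
      exact lt_irrefl _ this
  have hρ : Function.Injective ρ := fun j k h => by
    by_contra hne
    rcases lt_or_gt_of_ne (hinj.ne hne) with h1 | h1
    · exact absurd h (hlt k j h1).ne'
    · exact absurd h (hlt j k h1).ne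
  -- The `ρ k` terms larger than `s k` have distinct ranks below `ρ k`, so they exhaust them. Hence
  -- the ranks leave no gaps.
  have him : ∀ k, (A k).image ρ = Finset.range (ρ k) := fun k => by
    refine Finset.eq_of_subset_of_card_le (fun n hn => ?_) ?_
    · obtain ⟨j, hj, rfl⟩ := Finset.mem_image.1 hn
      exact Finset.mem_range.2 (hlt j k ((hA k j).1 hj))
    · rw [Finset.card_image_of_injective _ hρ, Finset.card_range]
  have hsurj : Function.Surjective ρ := fun n => by
    obtain ⟨k, hk⟩ : ∃ k, n < ρ k := by
      by_contra hc
      push Not at hc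
      exact Set.infinite_range_of_injective hρ
        ((Set.finite_Iic n).subset (by rintro _ ⟨k, rfl⟩; exact hc k))
    have : n ∈ (A k).image ρ := by rw [him]; exact Finset.mem_range.2 hk
    obtain ⟨j, -, hj⟩ := Finset.mem_image.1 this
    exact ⟨j, hj⟩
  let e := Equiv.ofBijective ρ ⟨hρ, hsurj⟩
  refine ⟨e.symm, fun i j hij => ?_⟩
  have hi : ρ (e.symm i) = i := e.apply_symm_apply i
  have hj : ρ (e.symm j) = j := e.apply_symm_apply j
  by_contra hc
  rcases (not_lt.1 hc).lt_or_eq with h | h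
  · have := hlt _ _ h
    omega
  · exact hij.ne (e.symm.injective (hinj h))

theorem strictAnti_sortPerm {s : ℕ → ℝ} (hpos : ∀ k, 0 < s k) (hs : Tendsto s atTop (nhds 0))
    (hinj : Function.Injective s) : StrictAnti fun k => s (sortPerm s k) := by
  have h := exists_sorting_perm hpos hs hinj
  rw [sortPerm, dif_pos h]
  exact h.choose_spec

end Sorting

/-! ### Configurations are determined by exponential functionals -/

section Uniqueness

variable {X : Type*}

/-- The integral of `t` with respect to `∑ a(x_k) r_k ^ p δ_{x_k}`. -/
def pairing (p : ℕ) (a t : X → ℝ) (ξ : Config X) : ℝ :=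
  ∑' k, a (ξ k).2 * (ξ k).1 ^ p * t (ξ k).2

/-- The real functions with values in a bounded interval of nonnegative numbers. -/
def IsBddNonneg (t : X → ℝ) : Prop := ∃ C, ∀ x, 0 ≤ t x ∧ t x ≤ C

theorem summable_weights_pow {p : ℕ} (hp : 1 ≤ p) {ξ : Config X} (hξ : ξ ∈ l1plus X) :
    Summable fun k => (ξ k).1 ^ p := by
  obtain ⟨-, hpos, hsum, -⟩ := hξ
  obtain ⟨q, rfl⟩ : ∃ q, p = q + 1 := ⟨p - 1, by omega⟩
  refine Summable.of_nonneg_of_le (fun k => pow_nonneg (hpos k).le _) (fun k => ?_)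
    (hsum.mul_left ((∑' k, (ξ k).1) ^ q))
  rw [pow_succ]
  exact mul_le_mul_of_nonneg_right
    (pow_le_pow_left₀ (hpos k).le (hsum.le_tsum k fun j _ => (hpos j).le) q) (hpos k).le

theorem summable_pairing {p : ℕ} (hp : 1 ≤ p) {a t : X → ℝ} (ha : IsBddNonneg a)
    (ht : IsBddNonneg t) {ξ : Config X} (hξ : ξ ∈ l1plus X) :
    Summable fun k => a (ξ k).2 * (ξ k).1 ^ p * t (ξ k).2 := by
  obtain ⟨A, hA⟩ := ha
  obtain ⟨C, hC⟩ := ht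
  have hr : ∀ k, 0 ≤ (ξ k).1 ^ p := fun k => pow_nonneg (hξ.2.1 k).le _
  refine Summable.of_nonneg_of_le
    (fun k => mul_nonneg (mul_nonneg (hA _).1 (hr k)) (hC _).1) (fun k => ?_)
    (((summable_weights_pow hp hξ).mul_left A).mul_right C)
  exact mul_le_mul (mul_le_mul_of_nonneg_right (hA _).2 (hr k)) (hC _).2 (hC _).1
    (mul_nonneg ((hA (ξ k).2).1.trans (hA _).2) (hr k))

theorem pairing_nonneg (p : ℕ) {a t : X → ℝ} (ha : IsBddNonneg a)
    (ht : IsBddNonneg t) {ξ : Config X} (hξ : ξ ∈ l1plus X) : 0 ≤ pairing p a t ξ :=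
  tsum_nonneg fun k => mul_nonneg (mul_nonneg (ha.choose_spec _).1 (pow_nonneg (hξ.2.1 k).le _))
    (ht.choose_spec _).1

theorem pairing_add {p : ℕ} (hp : 1 ≤ p) {a t t' : X → ℝ} (ha : IsBddNonneg a)
    (ht : IsBddNonneg t) (ht' : IsBddNonneg t') {ξ : Config X} (hξ : ξ ∈ l1plus X) :
    pairing p a (fun x => t x + t' x) ξ = pairing p a t ξ + pairing p a t' ξ := by
  rw [pairing, pairing, pairing,
    ← (summable_pairing hp ha ht hξ).tsum_add (summable_pairing hp ha ht' hξ)]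
  exact tsum_congr fun k => mul_add _ _ _

theorem IsBddNonneg.add {t t' : X → ℝ} (ht : IsBddNonneg t) (ht' : IsBddNonneg t') :
    IsBddNonneg fun x => t x + t' x := by
  obtain ⟨C, hC⟩ := ht
  obtain ⟨C', hC'⟩ := ht'
  exact ⟨C + C', fun x => ⟨add_nonneg (hC x).1 (hC' x).1, add_le_add (hC x).2 (hC' x).2⟩⟩

theorem isBddNonneg_const {c : ℝ} (hc : 0 ≤ c) : IsBddNonneg fun _ : X => c :=
  ⟨c, fun _ => ⟨hc, le_rfl⟩⟩

variable [MeasurableSpace X]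

theorem measurable_pairing (p : ℕ) {a t : X → ℝ} (ha : Measurable a) (ht : Measurable t) :
    Measurable (pairing p a t) :=
  Measurable.tsum fun k => ((ha.comp (measurable_point k)).mul
    ((measurable_weight k).pow_const p)).mul (ht.comp (measurable_point k))

variable [StandardBorelSpace X]

/-- The indicator function of the set of the points with given first binary digits. -/
def cyl (i : Σ N, (Fin N → Bool)) (x : X) : ℝ := if bits X i.1 x = i.2 then 1 else 0

theorem measurable_cyl (i : Σ N, (Fin N → Bool)) : Measurable (cyl (X := X) i) :=
  Measurable.ite (measurable_bits X i.1 (measurableSet_singleton i.2)) measurable_const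
    measurable_const

theorem isBddNonneg_cyl (i : Σ N, (Fin N → Bool)) : IsBddNonneg (cyl (X := X) i) :=
  ⟨1, fun x => by unfold cyl; split_ifs <;> norm_num⟩

/-- The exponential functionals of a configuration. -/
def expCoord (p : ℕ) (a : X → ℝ) (ξ : Config X) (i : Σ N, (Fin N → Bool)) : unitInterval :=
  Set.projIcc 0 1 zero_le_one (Real.exp (-pairing p a (cyl i) ξ))

theorem coe_expCoord (p : ℕ) {a : X → ℝ} (ha : IsBddNonneg a) {ξ : Config X} (hξ : ξ ∈ l1plus X)
    (i : Σ N, (Fin N → Bool)) :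
    (expCoord p a ξ i : ℝ) = Real.exp (-pairing p a (cyl i) ξ) := by
  rw [expCoord, Set.projIcc_of_mem]
  exact ⟨(Real.exp_pos _).le, Real.exp_le_one_iff.2
    (neg_nonpos.2 (pairing_nonneg p ha (isBddNonneg_cyl i) hξ))⟩

theorem measurable_expCoord (p : ℕ) {a : X → ℝ} (ha : Measurable a) :
    Measurable (expCoord p a) :=
  measurable_pi_iff.2 fun i => continuous_projIcc.measurable.comp
    (measurable_pairing p ha (measurable_cyl i)).neg.exp

/-- Products of exponential functionals are exponential functionals of the sum of the test
functions. So monomials on the cube pull back to functionals `exp (-pairing p a t)`, with one `t`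
that serves all weights `a` and all configurations. -/
theorem exists_pairing_of_mem_closure {p : ℕ} (hp : 1 ≤ p)
    {f : BoundedContinuousFunction ((Σ N, (Fin N → Bool)) → unitInterval) ℝ}
    (hf : f ∈ Submonoid.closure (Set.range cubeCoord)) :
    ∃ t : X → ℝ, Measurable t ∧ IsBddNonneg t ∧ ∀ a : X → ℝ, IsBddNonneg a → ∀ ξ ∈ l1plus X,
      f (expCoord p a ξ) = Real.exp (-pairing p a t ξ) := by
  induction hf using Submonoid.closure_induction with
  | mem f hf =>
    obtain ⟨i, rfl⟩ := hf
    exact ⟨cyl i, measurable_cyl i, isBddNonneg_cyl i, fun a ha ξ hξ => coe_expCoord p ha hξ i⟩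
  | one => exact ⟨fun _ => 0, measurable_const, isBddNonneg_const le_rfl, fun a ha ξ hξ => by
      simp [pairing]⟩
  | mul f g _ _ hf hg =>
    obtain ⟨t, ht, htb, h⟩ := hf
    obtain ⟨t', ht', htb', h'⟩ := hg
    refine ⟨fun x => t x + t' x, ht.add ht', htb.add htb', fun a ha ξ hξ => ?_⟩
    rw [pairing_add hp ha htb htb' hξ, BoundedContinuousFunction.coe_mul, Pi.mul_apply,
      h a ha ξ hξ, h' a ha ξ hξ, ← Real.exp_add]
    congr 1
    ring

/-- Equality of the exponential functionals is equality of all moments on the cube. Two weights are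
allowed because the weight `a` describes the scaled configuration without sorting it. -/
theorem map_expCoord_eq {p : ℕ} (hp : 1 ≤ p) {μ₁ μ₂ : Measure (Config X)} [IsFiniteMeasure μ₁]
    [IsFiniteMeasure μ₂] (h₁ : ∀ᵐ ξ ∂μ₁, ξ ∈ l1plus X) (h₂ : ∀ᵐ ξ ∂μ₂, ξ ∈ l1plus X)
    {a₁ a₂ : X → ℝ} (ha₁ : Measurable a₁) (ha₂ : Measurable a₂) (hb₁ : IsBddNonneg a₁)
    (hb₂ : IsBddNonneg a₂) (h : ∀ t : X → ℝ, Measurable t → IsBddNonneg t →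
      ∫ ξ, Real.exp (-pairing p a₁ t ξ) ∂μ₁ = ∫ ξ, Real.exp (-pairing p a₂ t ξ) ∂μ₂) :
    μ₁.map (expCoord p a₁) = μ₂.map (expCoord p a₂) := by
  have hm₁ := measurable_expCoord p ha₁
  have hm₂ := measurable_expCoord p ha₂
  refine measure_cube_ext fun f hf => ?_
  obtain ⟨t, ht, htb, hft⟩ := exists_pairing_of_mem_closure (X := X) hp hf
  rw [integral_map hm₁.aemeasurable f.continuous.aestronglyMeasurable,
    integral_map hm₂.aemeasurable f.continuous.aestronglyMeasurable,
    integral_congr_ae (g := fun ξ => Real.exp (-pairing p a₁ t ξ)) (h₁.mono fun ξ hξ =>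
      hft a₁ hb₁ ξ hξ), integral_congr_ae (g := fun ξ => Real.exp (-pairing p a₂ t ξ))
      (h₂.mono fun ξ hξ => hft a₂ hb₂ ξ hξ)]
  exact h t ht htb

/-- The mass of a point with respect to `∑ r_k ^ p δ_{x_k}` is the limit of the masses of the
cylinders which contain the point. -/
theorem tendsto_pairing_cyl {p : ℕ} (hp : 1 ≤ p) {ξ : Config X} (hξ : ξ ∈ l1plus X) (x : X) :
    Tendsto (fun N => pairing p (fun _ => 1) (cyl ⟨N, bits X N x⟩) ξ) atTop
      (nhds (∑' k, (Set.indicator {x} (fun _ => (ξ k).1 ^ p) (ξ k).2))) := by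
  refine tendsto_tsum_of_dominated_convergence (summable_weights_pow hp hξ) (fun k => ?_)
    (Eventually.of_forall fun N k => ?_)
  · by_cases hx : (ξ k).2 = x
    · rw [Set.indicator_of_mem (by exact hx)]
      refine tendsto_const_nhds.congr fun N => ?_
      simp [cyl, hx]
    · rw [Set.indicator_of_notMem (by exact hx)]
      refine tendsto_const_nhds.congr' ?_
      filter_upwards [eventually_bits_ne hx] with N hN
      simp [cyl, hN]
  · have hr : 0 ≤ (ξ k).1 ^ p := pow_nonneg (hξ.2.1 k).le _
    rw [one_mul, norm_mul, Real.norm_of_nonneg hr]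
    refine mul_le_of_le_one_right hr ?_
    unfold cyl
    split_ifs <;> norm_num

theorem tsum_indicator_point {p : ℕ} {ξ : Config X} (hξ : ξ ∈ l1plus X) (k : ℕ) :
    ∑' j, (Set.indicator {(ξ k).2} (fun _ => (ξ j).1 ^ p) (ξ j).2) = (ξ k).1 ^ p := by
  rw [tsum_eq_single k fun j hj => ?_]
  · exact Set.indicator_of_mem (Set.mem_singleton _) _
  · exact Set.indicator_of_notMem (s := {(ξ k).2})
      (show ¬ (ξ j).2 = (ξ k).2 from fun h => hj (hξ.2.2.2 h)) _

/-- The mass at a point is the limit of the masses of the cylinders around it, so it is determined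
by the coordinates. A nonzero mass at a point of `ξ` forces `η` to have the same point with the same
weight. -/
theorem range_subset_of_expCoord_eq {p : ℕ} (hp : 1 ≤ p) {ξ η : Config X} (hξ : ξ ∈ l1plus X)
    (hη : η ∈ l1plus X) (h : expCoord p (fun _ => 1) ξ = expCoord p (fun _ => 1) η) :
    Set.range ξ ⊆ Set.range η := by
  have h1 : ∀ i, pairing p (fun _ => 1) (cyl i) ξ = pairing p (fun _ => 1) (cyl i) η := fun i => by
    have := congrArg Subtype.val (congrFun h i)
    rw [coe_expCoord p (isBddNonneg_const zero_le_one) hξ,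
      coe_expCoord p (isBddNonneg_const zero_le_one) hη] at this
    exact neg_injective (Real.exp_injective this)
  rintro _ ⟨k, rfl⟩
  have h2 := tendsto_pairing_cyl hp hξ (ξ k).2
  simp only [h1] at h2
  have h3 := tendsto_nhds_unique h2 (tendsto_pairing_cyl hp hη (ξ k).2)
  rw [tsum_indicator_point hξ] at h3
  have h4 : (0 : ℝ) < (ξ k).1 ^ p := pow_pos (hξ.2.1 k) p
  obtain ⟨j, hj⟩ : ∃ j, (η j).2 = (ξ k).2 := by
    by_contra hc
    push Not at hc
    rw [tsum_congr (g := fun _ => (0 : ℝ)) fun j => Set.indicator_of_notMem (s := {(ξ k).2})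
      (show ¬ (η j).2 = (ξ k).2 from hc j) _, tsum_zero] at h3
    exact h4.ne' h3
  rw [← hj, tsum_indicator_point hη] at h3
  exact ⟨j, Prod.ext ((pow_left_inj₀ (hη.2.1 j).le (hξ.2.1 k).le (by omega)).1 h3.symm) hj⟩

/-- The coordinates determine the set of pairs `(r_k, x_k)`, and the decreasing order of the weights
determines the enumeration. -/
theorem injOn_expCoord {p : ℕ} (hp : 1 ≤ p) : Set.InjOn (expCoord p fun _ : X => 1) (l1plus X) := by
  intro ξ hξ η hη h
  have h1 := (range_subset_of_expCoord_eq hp hξ hη h).antisymm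
    (range_subset_of_expCoord_eq hp hη hξ h.symm)
  have h2 : (fun k => (ξ k).1) = fun k => (η k).1 := by
    have h3 : Set.range (fun k => (ξ k).1) = Set.range fun k => (η k).1 := by
      have := congrArg (Set.image Prod.fst) h1
      rwa [← Set.range_comp, ← Set.range_comp] at this
    have := (StrictMono.range_inj (f := fun k => OrderDual.toDual (ξ k).1)
      (g := fun k => OrderDual.toDual (η k).1) (fun i j hij => hξ.1 hij)
      (fun i j hij => hη.1 hij)).1 (by
        have := congrArg (Set.image OrderDual.toDual) h3
        rwa [← Set.range_comp, ← Set.range_comp] at this)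
    funext k
    exact congrArg OrderDual.ofDual (congrFun this k)
  funext k
  obtain ⟨j, hj⟩ : ξ k ∈ Set.range η := h1 ▸ ⟨k, rfl⟩
  have : j = k := hη.1.injective (by
    rw [hj]; exact congrFun h2 k)
  rw [← hj, this]

variable (m : Measure X) [IsProbabilityMeasure m] [NullSingletonClass m]

/-- The finite measures with densities `h⁺` and `h⁻` have equal exponential functionals, hence equal
images in the cube. The coordinates are injective on `l1plus X` and map its Borel subsets to Borel
sets (Lusin–Souslin), so the two measures are equal. The power `2` is the one with which the weights
enter `expTens`. -/
theorem eq_zero_of_integral_exp_sq {h : Config X → ℝ} (hh : Integrable h (infLebesgue m))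
    (H : ∀ t : X → ℝ, Measurable t → IsBddNonneg t →
      ∫ ξ, Real.exp (-pairing 2 (fun _ => 1) t ξ) * h ξ ∂(infLebesgue m) = 0) :
    h =ᵐ[infLebesgue m] 0 := by
  have hf₁ := isFiniteMeasure_withDensity_ofReal hh.2
  have hf₂ := isFiniteMeasure_withDensity_ofReal hh.neg.2
  have hm₁ : AEMeasurable (fun ξ => ENNReal.ofReal (h ξ)) (infLebesgue m) :=
    hh.1.aemeasurable.ennreal_ofReal
  have hm₂ : AEMeasurable (fun ξ => ENNReal.ofReal ((-h) ξ)) (infLebesgue m) :=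
    hh.neg.1.aemeasurable.ennreal_ofReal
  have hl := ae_mem_l1plus m
  have hae : ∀ f : Config X → ℝ≥0∞, ∀ᵐ ξ ∂((infLebesgue m).withDensity f), ξ ∈ l1plus X :=
    fun f => (withDensity_absolutelyContinuous _ _) hl
  have hint : ∀ (g : Config X → ℝ), Integrable g (infLebesgue m) → ∀ t : X → ℝ, Measurable t →
      IsBddNonneg t → Integrable (fun ξ => Real.exp (-pairing 2 (fun _ => 1) t ξ) * g ξ)
        (infLebesgue m) := fun g hg t ht htb => by
    refine hg.bdd_mul (c := 1)
      (measurable_pairing 2 measurable_const ht).neg.exp.aestronglyMeasurable ?_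
    filter_upwards [hl] with ξ hξ
    rw [Real.norm_of_nonneg (Real.exp_pos _).le]
    exact Real.exp_le_one_iff.2
      (neg_nonpos.2 (pairing_nonneg 2 (isBddNonneg_const zero_le_one) htb hξ))
  have key := map_expCoord_eq one_le_two (hae _) (hae _) measurable_const measurable_const
    (isBddNonneg_const zero_le_one) (isBddNonneg_const zero_le_one) (a₁ := fun _ : X => (1 : ℝ))
    (a₂ := fun _ : X => (1 : ℝ)) (μ₁ := (infLebesgue m).withDensity fun ξ => ENNReal.ofReal (h ξ))
    (μ₂ := (infLebesgue m).withDensity fun ξ => ENNReal.ofReal ((-h) ξ)) fun t ht htb => by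
      rw [integral_withDensity_eq_integral_toReal_smul₀ hm₁
        (Eventually.of_forall fun _ => ENNReal.ofReal_lt_top),
        integral_withDensity_eq_integral_toReal_smul₀ hm₂
        (Eventually.of_forall fun _ => ENNReal.ofReal_lt_top), ← sub_eq_zero, ← integral_sub, ← H t ht htb]
      · refine integral_congr_ae (Eventually.of_forall fun ξ => ?_)
        simp only [smul_eq_mul, Pi.neg_apply, ENNReal.toReal_ofReal']
        rcases le_total 0 (h ξ) with h0 | h0
        · rw [max_eq_left h0, max_eq_right (by linarith)]; ring
        · rw [max_eq_right h0, max_eq_left (by linarith)]; ring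
      · refine (hint _ hh.pos_part t ht htb).congr (Eventually.of_forall fun ξ => ?_)
        simp only [smul_eq_mul, ENNReal.toReal_ofReal']
        rw [mul_comm]
      · refine (hint _ hh.neg_part t ht htb).congr (Eventually.of_forall fun ξ => ?_)
        simp only [smul_eq_mul, ENNReal.toReal_ofReal', Pi.neg_apply]
        rw [mul_comm]
  have heq : (infLebesgue m).withDensity (fun ξ => ENNReal.ofReal (h ξ))
      = (infLebesgue m).withDensity fun ξ => ENNReal.ofReal ((-h) ξ) := by
    ext A hA
    have hΘ := measurable_expCoord 2 (a := fun _ : X => (1 : ℝ)) measurable_const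
    have hB : MeasurableSet (expCoord 2 (fun _ : X => 1) '' (A ∩ l1plus X)) :=
      (hA.inter measurableSet_l1plus).image_of_measurable_injOn hΘ
        ((injOn_expCoord one_le_two).mono Set.inter_subset_right)
    have hpre : ∀ μ : Measure (Config X), (∀ᵐ ξ ∂μ, ξ ∈ l1plus X) →
        μ A = μ.map (expCoord 2 fun _ : X => 1) (expCoord 2 (fun _ : X => 1) '' (A ∩ l1plus X)) := by
      intro μ hμ
      rw [Measure.map_apply hΘ hB]
      refine measure_congr ?_
      filter_upwards [hμ] with ξ hξ
      refine propext ⟨fun h => ⟨ξ, ⟨h, hξ⟩, rfl⟩, ?_⟩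
      rintro ⟨η, ⟨h1, h2⟩, h3⟩
      rw [← injOn_expCoord one_le_two h2 hξ h3]
      exact h1
    rw [hpre _ (hae _), hpre _ (hae _), key]
  have hfin : ∫⁻ ξ, ENNReal.ofReal (h ξ) ∂(infLebesgue m) ≠ ⊤ := by
    have := measure_ne_top ((infLebesgue m).withDensity fun ξ => ENNReal.ofReal (h ξ)) Set.univ
    rwa [withDensity_apply _ MeasurableSet.univ, Measure.restrict_univ] at this
  filter_upwards [(withDensity_eq_iff hm₁ hm₂ hfin).1 heq] with ξ hξ
  simp only [Pi.neg_apply] at hξ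
  rcases le_total 0 (h ξ) with h0 | h0
  · rw [ENNReal.ofReal_of_nonpos (neg_nonpos.2 h0), ENNReal.ofReal_eq_zero] at hξ
    exact le_antisymm hξ h0
  · rw [ENNReal.ofReal_of_nonpos h0, eq_comm, ENNReal.ofReal_eq_zero] at hξ
    exact le_antisymm h0 (neg_nonpos.1 hξ)

theorem multiplicator_mem {a : X → ℝ} {c C : ℝ} (hc : 0 < c) (hac : ∀ x, c ≤ a x ∧ a x ≤ C)
    {ξ : Config X} (hξ : ξ ∈ l1plus X)
    (hinj : Function.Injective fun k => a (ξ k).2 * (ξ k).1) : multiplicator a ξ ∈ l1plus X := by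
  have hpos : ∀ k, 0 < a (ξ k).2 * (ξ k).1 := fun k => mul_pos (hc.trans_le (hac _).1) (hξ.2.1 k)
  have hsum : Summable fun k => a (ξ k).2 * (ξ k).1 :=
    Summable.of_nonneg_of_le (fun k => (hpos k).le)
      (fun k => mul_le_mul_of_nonneg_right (hac _).2 (hξ.2.1 k).le) (hξ.2.2.1.mul_left C)
  refine ⟨strictAnti_sortPerm hpos hsum.tendsto_atTop_zero hinj, fun k => hpos _, ?_, ?_⟩
  · exact (multPerm a ξ).summable_iff.2 hsum
  · exact hξ.2.2.2.comp (multPerm a ξ).injective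

theorem pairing_multiplicator (a t : X → ℝ) (ξ : Config X) :
    pairing 1 (fun _ => 1) t (multiplicator a ξ) = pairing 1 a t ξ := by
  rw [pairing, pairing,
    ← (multPerm a ξ).tsum_eq fun k => a (ξ k).2 * (ξ k).1 ^ 1 * t (ξ k).2]
  simp [multiplicator]

/-- The multiplicators are nonsingular transformations. -/
theorem ae_multiplicator {a : X → ℝ} (ha : Measurable a) {c C : ℝ} (hc : 0 < c)
    (hac : ∀ x, c ≤ a x ∧ a x ≤ C) {q : Config X → Prop} (hq : ∀ᵐ ξ ∂(infLebesgue m), q ξ) :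
    ∀ᵐ ξ ∂(infLebesgue m), q (multiplicator a ξ) := by
  have hl := ae_mem_l1plus m
  have hab : IsBddNonneg a := ⟨C, fun x => ⟨hc.le.trans (hac x).1, (hac x).2⟩⟩
  have h1b : IsBddNonneg fun _ : X => (1 : ℝ) := isBddNonneg_const zero_le_one
  -- The Laplace transform at `f (1 + t)`: the logarithm splits, so `f` contributes only a constant
  -- factor.
  have hlap : ∀ (f t : X → ℝ), Measurable f → Measurable t → ∀ c C : ℝ, 0 < c →
      (∀ x, c ≤ f x ∧ f x ≤ C) → IsBddNonneg t →
      Integrable (fun ξ => Real.exp (-pairing 1 f (fun x => 1 + t x) ξ)) (infLebesgue m) ∧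
      ∫ ξ, Real.exp (-pairing 1 f (fun x => 1 + t x) ξ) ∂(infLebesgue m)
        = Real.exp (-∫ x, Real.log (f x) ∂m) * Real.exp (-∫ x, Real.log (1 + t x) ∂m) := by
    intro f t hf ht c C hc hfc ⟨D, hD⟩
    have hb : ∀ x, c ≤ f x * (1 + t x) ∧ f x * (1 + t x) ≤ C * (1 + D) := fun x =>
      ⟨by nlinarith [hfc x, hD x], mul_le_mul (hfc x).2 (by linarith [hD x])
        (by linarith [hD x]) (by linarith [hfc x])⟩
    obtain ⟨h1, h2⟩ := laplace_infLebesgue m (hf.mul (ht.const_add 1)) hc hb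
    have e : ∀ ξ : Config X, pairing 1 f (fun x => 1 + t x) ξ
        = ∑' k, (ξ k).1 * (f (ξ k).2 * (1 + t (ξ k).2)) := fun ξ =>
      tsum_congr fun k => by ring
    have hbl : ∀ (g : X → ℝ) (u v : ℝ), Measurable g → 0 < u → (∀ x, u ≤ g x ∧ g x ≤ v) →
        Integrable (fun x => Real.log (g x)) m := fun g u v hg hu hguv =>
      Integrable.of_bound hg.log.aestronglyMeasurable (max |Real.log u| |Real.log v|)
        (Eventually.of_forall fun x => abs_le_max_abs_abs (Real.log_le_log hu (hguv x).1)
          (Real.log_le_log (hu.trans_le (hguv x).1) (hguv x).2))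
    simp only [e]
    refine ⟨h1, h2.trans ?_⟩
    rw [← Real.exp_add]
    congr 1
    rw [← neg_add, ← integral_add (hbl f c C hf hc hfc)
      (hbl (fun x => 1 + t x) 1 (1 + D) (ht.const_add 1) one_pos
        fun x => ⟨by linarith [hD x], by linarith [hD x]⟩)]
    congr 1
    refine integral_congr_ae (Eventually.of_forall fun x => ?_)
    exact Real.log_mul (hc.trans_le (hfc x).1).ne' (by linarith [hD x])
  have hsplit : ∀ (f t : X → ℝ), IsBddNonneg f → IsBddNonneg t → ∀ ξ ∈ l1plus X,
      Real.exp (-pairing 1 f (fun _ => 1) ξ) * Real.exp (-pairing 1 f t ξ)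
        = Real.exp (-pairing 1 f (fun x => 1 + t x) ξ) := fun f t hf ht ξ hξ => by
    rw [← Real.exp_add, pairing_add le_rfl hf h1b ht hξ]
    congr 1
    ring
  -- These positive densities cut `ℒ` down to finite measures with the same null sets.
  let D : (X → ℝ) → Config X → ℝ := fun f ξ => Real.exp (-pairing 1 f (fun _ => 1) ξ)
  have hDm : ∀ f : X → ℝ, Measurable f → Measurable fun ξ => ENNReal.ofReal (D f ξ) := fun f hf =>
    (measurable_pairing 1 hf measurable_const).neg.exp.ennreal_ofReal
  let κ : ℝ := Real.exp (-∫ x, Real.log (a x) ∂m)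
  let μ₁ := (infLebesgue m).withDensity fun ξ => ENNReal.ofReal (D a ξ)
  let μ₂ := (infLebesgue m).withDensity fun ξ => ENNReal.ofReal (D (fun _ => 1) ξ)
  have hfinite : ∀ (f : X → ℝ), Measurable f → ∀ c C : ℝ, 0 < c → (∀ x, c ≤ f x ∧ f x ≤ C) →
      IsFiniteMeasure ((infLebesgue m).withDensity fun ξ => ENNReal.ofReal (D f ξ)) := by
    intro f hf c C hc hfc
    refine isFiniteMeasure_withDensity_ofReal ?_
    have := (hlap f (fun _ => 0) hf measurable_const c C hc hfc (isBddNonneg_const le_rfl)).1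
    simp only [add_zero] at this
    exact this.2
  have hf₁ : IsFiniteMeasure μ₁ := hfinite a ha c C hc hac
  have hf₂ : IsFiniteMeasure μ₂ := hfinite _ measurable_const 1 1 one_pos fun _ => ⟨le_rfl, le_rfl⟩
  have hf₃ : IsFiniteMeasure (ENNReal.ofReal κ • μ₂) := Measure.smul_finite _ ENNReal.ofReal_ne_top
  have hae₁ : ∀ᵐ ξ ∂μ₁, ξ ∈ l1plus X := (withDensity_absolutelyContinuous _ _) hl
  have hae₂ : ∀ᵐ ξ ∂μ₂, ξ ∈ l1plus X := (withDensity_absolutelyContinuous _ _) hl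
  have hae₃ : ∀ᵐ ξ ∂(ENNReal.ofReal κ • μ₂), ξ ∈ l1plus X :=
    Measure.ae_smul_measure hae₂ _
  have hintD : ∀ f t : X → ℝ, Measurable f → Measurable t → ∀ c C : ℝ, 0 < c →
      (∀ x, c ≤ f x ∧ f x ≤ C) → IsBddNonneg t → ∫ ξ, Real.exp (-pairing 1 f t ξ)
        ∂((infLebesgue m).withDensity fun ξ => ENNReal.ofReal (D f ξ))
        = Real.exp (-∫ x, Real.log (f x) ∂m) * Real.exp (-∫ x, Real.log (1 + t x) ∂m) := by
    intro f t hf ht c C hc hfc htb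
    rw [integral_withDensity_eq_integral_toReal_smul (hDm f hf)
      (Eventually.of_forall fun _ => ENNReal.ofReal_lt_top), ← (hlap f t hf ht c C hc hfc htb).2]
    refine integral_congr_ae ?_
    filter_upwards [hl] with ξ hξ
    rw [ENNReal.toReal_ofReal (Real.exp_pos _).le, smul_eq_mul,
      ← hsplit f t ⟨C, fun x => ⟨hc.le.trans (hfc x).1, (hfc x).2⟩⟩ htb ξ hξ]
  -- Seen through the coordinates, the multiplicator carries `e^{-∑ a(x_k) r_k} ℒ` to `κ e^{-∑ r_k}
  -- ℒ`.
  have key := map_expCoord_eq le_rfl hae₁ hae₃ ha measurable_const hab h1b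
    (a₂ := fun _ : X => (1 : ℝ)) fun t ht htb => by
      rw [hintD a t ha ht c C hc hac htb, integral_smul_measure,
        hintD (fun _ => 1) t measurable_const ht 1 1 one_pos (fun _ => ⟨le_rfl, le_rfl⟩) htb,
        ENNReal.toReal_ofReal (Real.exp_pos _).le]
      simp
  have hΘ := measurable_expCoord 1 (a := fun _ : X => (1 : ℝ)) measurable_const
  have hq' : infLebesgue m {ξ | ¬ q ξ} = 0 := ae_iff.1 hq
  -- The property `q` need not be measurable.
  let S := toMeasurable (infLebesgue m) {ξ | ¬ q ξ}
  have hS0 : infLebesgue m S = 0 := by rw [measure_toMeasurable]; exact hq'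
  have hSm : MeasurableSet S := measurableSet_toMeasurable _ _
  have hB : MeasurableSet (expCoord 1 (fun _ : X => 1) '' (S ∩ l1plus X)) :=
    (hSm.inter measurableSet_l1plus).image_of_measurable_injOn hΘ
      ((injOn_expCoord le_rfl).mono Set.inter_subset_right)
  have h0 : μ₂.map (expCoord 1 fun _ : X => 1) (expCoord 1 (fun _ : X => 1) '' (S ∩ l1plus X))
      = 0 := by
    rw [Measure.map_apply hΘ hB]
    have hS2 : ∀ᵐ ξ ∂μ₂, ξ ∉ S :=
      measure_eq_zero_iff_ae_notMem.1 ((withDensity_absolutelyContinuous _ _) hS0)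
    refine measure_mono_null (t := {ξ | ¬ (ξ ∈ l1plus X ∧ ξ ∉ S)}) ?_
      (ae_iff.1 (hae₂.and hS2))
    rintro ξ ⟨η, ⟨h1, h2⟩, h3⟩ ⟨h4, h5⟩
    rw [← injOn_expCoord le_rfl h2 h4 h3] at h5
    exact h5 h1
  have h1 : μ₁ (expCoord 1 a ⁻¹' (expCoord 1 (fun _ : X => 1) '' (S ∩ l1plus X))) = 0 := by
    rw [← Measure.map_apply (measurable_expCoord 1 ha) hB, key, Measure.map_smul,
      Measure.smul_apply, h0, smul_zero]
  have h2 : infLebesgue m (expCoord 1 a ⁻¹' (expCoord 1 (fun _ : X => 1) '' (S ∩ l1plus X)))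
      = 0 := by
    have := withDensity_absolutelyContinuous' (hDm a ha).aemeasurable
      (Eventually.of_forall fun ξ => (ENNReal.ofReal_pos.2 (Real.exp_pos _)).ne')
      (μ := infLebesgue m)
    exact this h1
  have h3 : ∀ᵐ ξ ∂(infLebesgue m), ξ ∉ expCoord 1 a ⁻¹' (expCoord 1 (fun _ : X => 1) ''
      (S ∩ l1plus X)) := measure_eq_zero_iff_ae_notMem.1 h2
  filter_upwards [h3, hl, ae_scaled_weights_injective m ha fun x => hc.trans_le (hac x).1]
    with ξ h4 hξ hinj
  have hmem := multiplicator_mem hc hac hξ hinj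
  by_contra hnq
  refine h4 ⟨multiplicator a ξ, ⟨subset_toMeasurable _ _ hnq, hmem⟩, ?_⟩
  funext i
  rw [expCoord, expCoord, pairing_multiplicator]

end Uniqueness

/-! ### Totality of the functionals -/

section Totality

variable {X : Type*} [MeasurableSpace X] [StandardBorelSpace X] (m : Measure X)
  [IsProbabilityMeasure m] [NullSingletonClass m]

theorem inner_functionalLp_eq_integral (z : HalfPlaneMaps X) (Φ : IntH0 m) :
    inner ℝ (functionalLp m z) Φ = ∫ ξ, inner ℝ (functional z ξ) (Φ ξ) ∂(infLebesgue m) := by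
  rw [L2.inner_def]
  refine integral_congr_ae ?_
  filter_upwards [(memLp_functional m z).coeFn_toLp] with ξ h
  rw [functionalLp, h]

theorem integrable_inner_functional (z : HalfPlaneMaps X) (Φ : IntH0 m) :
    Integrable (fun ξ => inner ℝ (functional z ξ) (Φ ξ)) (infLebesgue m) := by
  refine (L2.integrable_inner (𝕜 := ℝ) (functionalLp m z) Φ).congr ?_
  filter_upwards [(memLp_functional m z).coeFn_toLp] with ξ h
  rw [functionalLp, h]

/-- The functional at `u + i + i t` is `e^{-∑ r_k² t(x_k)}` times the one at `u + i`. Orthogonality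
for all `t ≥ 0` makes the inner product with the latter vanish in almost every fibre. Removing the
scalar `e^{-∑ r_k²}` leaves the boundary value at `u`, a pure phase in every factor. -/
theorem ae_inner_expTens_eq_zero {Φ : IntH0 m} (hΦ : ∀ z, inner ℝ (functionalLp m z) Φ = 0)
    {u : X → ℝ} (hu : Measurable u) {C : ℝ} (hC : ∀ x, |u x| ≤ C) :
    ∀ᵐ ξ ∂(infLebesgue m), inner ℝ (expTens (fun x => (u x : ℂ)) ξ) (Φ ξ) = 0 := by
  have hz : ∀ t : X → ℝ, Measurable t → IsBddNonneg t → ∃ z : HalfPlaneMaps X,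
      functional z = expTens fun x => (u x + 1 * Complex.I) + t x * Complex.I := by
    intro t ht ⟨D, hD⟩
    refine ⟨HalfPlaneMaps.mk (c := 1) (C := C + 1 + D)
      (fun x => ((u x : ℂ) + 1 * Complex.I) + t x * Complex.I)
      (((Complex.measurable_ofReal.comp hu).add_const _).add
        ((Complex.measurable_ofReal.comp ht).mul_const _)) one_pos fun x => ⟨?_, ?_⟩, rfl⟩
    · simpa using (hD x).1
    · refine (norm_add_le _ _).trans (add_le_add ((norm_add_le _ _).trans (add_le_add ?_ ?_)) ?_)
      · rw [Complex.norm_real]; exact hC x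
      · simp
      · rw [norm_mul, Complex.norm_I, mul_one, Complex.norm_real, Real.norm_of_nonneg (hD x).1]
        exact (hD x).2
  obtain ⟨z₀, hz₀⟩ := hz (fun _ => 0) measurable_const (isBddNonneg_const le_rfl)
  have hw : ∀ x, 0 ≤ ((u x : ℂ) + 1 * Complex.I).im ∧ ‖(u x : ℂ) + 1 * Complex.I‖ ≤ C + 1 := by
    refine fun x => ⟨by simp, (norm_add_le _ _).trans (add_le_add ?_ (by simp))⟩
    rw [Complex.norm_real]; exact hC x
  have hsep : ∀ t : X → ℝ, IsBddNonneg t → ∀ ξ ∈ l1plus X,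
      expTens (fun x => ((u x : ℂ) + 1 * Complex.I) + t x * Complex.I) ξ
        = Real.exp (-pairing 2 (fun _ => 1) t ξ) • functional z₀ ξ := by
    intro t ⟨D, hD⟩ ξ hξ
    rw [expTens_add_mul_I (C := max (C + 1) D)
      (fun x => ⟨(hw x).1, (hw x).2.trans (le_max_left _ _)⟩)
      (fun x => ⟨(hD x).1, (hD x).2.trans (le_max_right _ _)⟩) hξ, hz₀]
    simp [pairing]
  have h0 := eq_zero_of_integral_exp_sq m (integrable_inner_functional m z₀ Φ) fun t ht htb => by
    obtain ⟨z, hzt⟩ := hz t ht htb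
    rw [← hΦ z, inner_functionalLp_eq_integral]
    refine integral_congr_ae ?_
    filter_upwards [ae_mem_l1plus m] with ξ hξ
    rw [hzt, hsep t htb ξ hξ, real_inner_smul_left]
  filter_upwards [h0, ae_mem_l1plus m] with ξ h hξ
  have h1 : functional z₀ ξ = Real.exp (-∑' k, (ξ k).1 ^ 2 * 1) • expTens (fun x => (u x : ℂ)) ξ := by
    rw [hz₀, ← expTens_add_mul_I (t := fun _ => 1) (C := max C 1) (fun x => ⟨by simp, by
      rw [Complex.norm_real]; exact (hC x).trans (le_max_left _ _)⟩)
      (fun x => ⟨zero_le_one, le_max_right _ _⟩) hξ]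
    simp
  simp only [Pi.zero_apply] at h
  rw [h1, real_inner_smul_left] at h
  exact (mul_eq_zero.1 h).resolve_left (Real.exp_pos _).ne'

/-- Rational step functions `u` on the dyadic partitions are countably many, so one null set serves
them all. In a fixed fibre such functions converge to arbitrary phases at finitely many chosen
points and to `1` at the others, which gives a total family. -/
theorem eq_zero_of_inner_functionalLp {Φ : IntH0 m}
    (hΦ : ∀ z, inner ℝ (functionalLp m z) Φ = 0) : Φ = 0 := by
  have hall : ∀ᵐ ξ ∂(infLebesgue m), ∀ i : Σ N, ((Fin N → Bool) → ℚ),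
      inner ℝ (expTens (fun x => (((i.2 (bits X i.1 x) : ℚ) : ℝ) : ℂ)) ξ) (Φ ξ) = 0 := by
    rw [ae_all_iff]
    rintro ⟨N, c⟩
    obtain ⟨C, hC⟩ := (Set.finite_range fun e => |((c e : ℚ) : ℝ)|).bddAbove
    exact ae_inner_expTens_eq_zero m hΦ (u := fun x => ((c (bits X N x) : ℚ) : ℝ))
      ((measurable_of_countable fun e => ((c e : ℚ) : ℝ)).comp (measurable_bits X N))
      fun x => hC ⟨_, rfl⟩
  refine Lp.ext ?_
  filter_upwards [hall, ae_mem_l1plus m, Lp.coeFn_zero TensorH0 2 (infLebesgue m)] with ξ h hξ h0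
  rw [h0, Pi.zero_apply]
  have hr : ∀ k, (0 : ℝ) < (ξ k).1 ^ 2 := fun k => pow_pos (hξ.2.1 k) 2
  -- The choice `0 < r_k² u_k < π` keeps the phase off the real axis.
  choose u hu0 hu1 using fun k => exists_rat_btwn (div_pos Real.pi_pos (hr k))
  have hexp : ∀ k, Complex.exp (Complex.I * ((ξ k).1 : ℂ) ^ 2 * ((u k : ℝ) : ℂ))
      = Complex.exp (((ξ k).1 ^ 2 * u k : ℝ) * Complex.I) := fun k => by
    congr 1; push_cast; ring
  refine eq_zero_of_inner_tens_ite
    (w := fun k => Complex.exp (Complex.I * ((ξ k).1 : ℂ) ^ 2 * ((u k : ℝ) : ℂ))) (fun k => ?_)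
    fun s => ?_
  · rw [hexp, Complex.exp_ofReal_mul_I_im]
    refine (Real.sin_pos_of_pos_of_lt_pi (mul_pos (hr k) (hu0 k)) ?_).ne'
    have := hu1 k
    rwa [lt_div_iff₀ (hr k), mul_comm] at this
  -- Once the cells are fine enough to separate a given point from the points of `s`, the value
  -- there is `u k` at the `k`-th point with `k ∈ s` and `0` at any other.
  let c : (N : ℕ) → (Fin N → Bool) → ℚ := fun N e =>
    ∑ k ∈ s, if bits X N (ξ k).2 = e then u k else 0
  have hcD : ∀ N e, |((c N e : ℚ) : ℝ)| ≤ ∑ k ∈ s, |(u k : ℝ)| := fun N e => by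
    simp only [c]
    push_cast
    refine (Finset.abs_sum_le_sum_abs _ _).trans (Finset.sum_le_sum fun k _ => ?_)
    split_ifs <;> simp
  have hclim : ∀ j, ∀ᶠ N in atTop, c N (bits X N (ξ j).2) = if j ∈ s then u j else 0 := fun j => by
    have : ∀ᶠ N in atTop, ∀ k ∈ s, k ≠ j → bits X N (ξ k).2 ≠ bits X N (ξ j).2 := by
      rw [eventually_all_finset]
      intro k _
      by_cases hkj : k = j
      · simp [hkj]
      · filter_upwards [eventually_bits_ne (hξ.2.2.2.ne hkj)] with N hN _ using hN
    filter_upwards [this] with N hN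
    simp only [c]
    rw [Finset.sum_congr rfl (g := fun k => if k = j then u k else 0), Finset.sum_ite_eq']
    intro k hk
    by_cases hkj : k = j
    · simp [hkj]
    · simp [hkj, hN k hk hkj]
  have hlim := tendsto_tens (h := (1 : ℂ)) norm_one (l := atTop)
    (F := fun N k => Complex.exp (Complex.I * ((ξ k).1 : ℂ) ^ 2 *
      (((c N (bits X N (ξ k).2) : ℚ) : ℝ) : ℂ)))
    (f := fun k => if k ∈ s then Complex.exp (Complex.I * ((ξ k).1 : ℂ) ^ 2 * ((u k : ℝ) : ℂ))
      else 1)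
    (b := fun k => 2 * (∑ k ∈ s, |(u k : ℝ)|) * (ξ k).1 ^ 2)
    ((summable_sq_weights hξ).mul_left _) (fun k => ?_) (fun N k => ?_) (fun k => ?_)
  · refine tendsto_nhds_unique (hlim.inner tendsto_const_nhds) ?_
    refine tendsto_const_nhds.congr fun N => (h ⟨N, c N⟩).symm
  · refine tendsto_const_nhds.congr' ?_
    filter_upwards [hclim k] with N hN
    rw [hN]
    split_ifs <;> simp
  · refine (norm_exp_sub_one_le (by simp)).trans ?_
    rw [Complex.norm_real]
    exact mul_le_mul_of_nonneg_right (mul_le_mul_of_nonneg_left (hcD _ _) two_pos.le) (hr k).le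
  · split_ifs with hk
    · refine (norm_exp_sub_one_le (by simp)).trans ?_
      rw [Complex.norm_real]
      exact mul_le_mul_of_nonneg_right (mul_le_mul_of_nonneg_left
        (Finset.single_le_sum (f := fun k => |(u k : ℝ)|) (fun _ _ => abs_nonneg _) hk)
        two_pos.le) (hr k).le
    · rw [sub_self, norm_zero]
      have : 0 ≤ ∑ k ∈ s, |(u k : ℝ)| := Finset.sum_nonneg fun _ _ => abs_nonneg _
      have := hr k
      positivity

theorem dense_span_functionalLp :
    Dense (Submodule.span ℝ (Set.range (functionalLp m)) : Set (IntH0 m)) :=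
  dense_span_of_inner_eq_zero fun _ h => eq_zero_of_inner_functionalLp m h

end Totality

/-! ### Holomorphic changes of variables -/

section ChangeOfVariables

theorem abs_det_restrictScalars_toSpanSingleton (a : ℂ) :
    |((ContinuousLinearMap.toSpanSingleton ℂ a).restrictScalars ℝ).det| = ‖a‖ ^ 2 := by
  have h : (((ContinuousLinearMap.toSpanSingleton ℂ a).restrictScalars ℝ : ℂ →L[ℝ] ℂ) :
      ℂ →ₗ[ℝ] ℂ) = LinearMap.mulLeft ℝ a := by
    ext
    simp [mul_comm]
  have h2 : LinearMap.det (LinearMap.mulLeft ℝ a) = Algebra.norm ℝ a := rfl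
  rw [ContinuousLinearMap.det, h, h2, Algebra.norm_complex_apply,
    Complex.normSq_eq_norm_sq, abs_of_nonneg (sq_nonneg _)]

variable {s : Set ℂ} {f f' : ℂ → ℂ}

theorem lintegral_image_holomorphic (hs : MeasurableSet s) (hf : ∀ x ∈ s, HasDerivAt f (f' x) x)
    (hinj : Set.InjOn f s) (g : ℂ → ℝ≥0∞) :
    ∫⁻ x in f '' s, g x = ∫⁻ x in s, ENNReal.ofReal (‖f' x‖ ^ 2) * g (f x) := by
  rw [lintegral_image_eq_lintegral_abs_det_fderiv_mul volume hs
    (fun x hx => ((hf x hx).hasFDerivAt.restrictScalars ℝ).hasFDerivWithinAt) hinj]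
  simp only [abs_det_restrictScalars_toSpanSingleton]

theorem integral_image_holomorphic (hs : MeasurableSet s) (hf : ∀ x ∈ s, HasDerivAt f (f' x) x)
    (hinj : Set.InjOn f s) (g : ℂ → ℂ) :
    ∫ x in f '' s, g x = ∫ x in s, ‖f' x‖ ^ 2 • g (f x) := by
  rw [integral_image_eq_integral_abs_det_fderiv_smul volume hs
    (fun x hx => ((hf x hx).hasFDerivAt.restrictScalars ℝ).hasFDerivWithinAt) hinj]
  simp only [abs_det_restrictScalars_toSpanSingleton]

theorem integrableOn_image_holomorphic (hs : MeasurableSet s)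
    (hf : ∀ x ∈ s, HasDerivAt f (f' x) x) (hinj : Set.InjOn f s) (g : ℂ → ℂ) :
    IntegrableOn g (f '' s) ↔ IntegrableOn (fun x => ‖f' x‖ ^ 2 • g (f x)) s := by
  rw [integrableOn_image_iff_integrableOn_abs_det_fderiv_smul volume hs
    (fun x hx => ((hf x hx).hasFDerivAt.restrictScalars ℝ).hasFDerivWithinAt) hinj]
  simp only [abs_det_restrictScalars_toSpanSingleton]

end ChangeOfVariables

/-! ### The mean value property of integrable holomorphic functions on the disc -/

/-- Average the area integral over all rotations, which preserve it, and interchange the integrals: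
for fixed `ζ` the mean of `G` over the circle through `ζ` is `G 0`. Nothing is required at the
boundary besides integrability. -/
theorem integral_ball_of_holomorphic {G : ℂ → ℂ} (hG : DifferentiableOn ℂ G (Metric.ball 0 1))
    (hi : IntegrableOn G (Metric.ball 0 1)) :
    ∫ ζ in Metric.ball (0 : ℂ) 1, G ζ = Real.pi * G 0 := by
  set B := Metric.ball (0 : ℂ) 1 with hB
  have hBm : MeasurableSet B := measurableSet_ball
  let E : ℝ → ℂ := circleMap 0 1
  have hE : ∀ θ, E θ = Circle.exp θ := fun θ => by simp [E, circleMap, Circle.coe_exp]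
  have hEn : ∀ θ, ‖E θ‖ = 1 := fun θ => by rw [hE, Circle.norm_coe]
  let Gi : ℂ → ℂ := B.indicator G
  have hGm : Measurable Gi := by
    classical
    have := hG.continuousOn.measurable_piecewise (g := 0) continuousOn_const hBm
    rwa [Set.piecewise_eq_indicator] at this
  have hGi : Integrable Gi := (integrable_indicator_iff hBm).2 hi
  have hmp : ∀ θ, MeasurePreserving (fun ζ => E θ * ζ) := fun θ => by
    have := (rotation (Circle.exp θ)).measurePreserving
    simp only [hE]
    exact this
  have hemb : ∀ θ, MeasurableEmbedding fun ζ => E θ * ζ := fun θ =>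
    measurableEmbedding_mulLeft₀ (norm_ne_zero_iff.1 (by rw [hEn]; exact one_ne_zero))
  have hEm : Measurable E := (continuous_circleMap 0 1).measurable
  have hint : Integrable (Function.uncurry fun (θ : ℝ) (ζ : ℂ) => Gi (E θ * ζ))
      ((volume.restrict (Set.Ioc 0 (2 * Real.pi))).prod volume) := by
    refine (integrable_prod_iff (hGm.comp ((hEm.comp measurable_fst).mul
      measurable_snd)).aestronglyMeasurable).2 ⟨Eventually.of_forall fun θ => ?_, ?_⟩
    · exact ((hmp θ).integrable_comp_emb (hemb θ)).2 hGi
    · have : (fun θ : ℝ => ∫ ζ, ‖Function.uncurry (fun (θ : ℝ) (ζ : ℂ) => Gi (E θ * ζ)) (θ, ζ)‖)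
          = fun _ => ∫ ζ, ‖Gi ζ‖ := funext fun θ =>
        (hmp θ).integral_comp (hemb θ) fun ζ => ‖Gi ζ‖
      exact (integrable_const _).congr (Eventually.of_forall fun θ => (congrFun this θ).symm)
  have h1 : ∀ θ, ∫ ζ, Gi (E θ * ζ) = ∫ ζ in B, G ζ := fun θ => by
    rw [(hmp θ).integral_comp (hemb θ), integral_indicator hBm]
  have h2 : ∀ ζ, ∫ θ in Set.Ioc 0 (2 * Real.pi), Gi (E θ * ζ)
      = B.indicator (fun _ => 2 * Real.pi * G 0) ζ := fun ζ => by
    have hmem : ∀ θ, E θ * ζ ∈ B ↔ ζ ∈ B := fun θ => by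
      simp only [hB, mem_ball_zero_iff, norm_mul, hEn, one_mul]
    by_cases hζ : ζ ∈ B
    · rw [Set.indicator_of_mem hζ]
      -- As `‖ζ‖ < 1`, the function `s ↦ G (s ζ)` is holomorphic up to the unit circle, where the
      -- mean value property is applied.
      have hd : DiffContOnCl ℂ (fun s => G (s * ζ)) (Metric.ball 0 |1|) := by
        rw [abs_one]
        refine DifferentiableOn.diffContOnCl ?_
        rw [closure_ball _ one_ne_zero]
        refine hG.comp (by fun_prop) fun s hs => ?_
        rw [hB, mem_ball_zero_iff] at *
        rw [mem_closedBall_zero_iff] at hs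
        rw [norm_mul]
        exact (mul_le_of_le_one_left (norm_nonneg _) hs).trans_lt hζ
      have h := hd.circleAverage
      rw [Real.circleAverage_def, intervalIntegral.integral_of_le Real.two_pi_pos.le,
        zero_mul, Complex.real_smul] at h
      rw [← h, ← mul_assoc]
      have hpi : (2 * (Real.pi : ℂ)) ≠ 0 := by
        simp [Real.pi_ne_zero]
      push_cast
      rw [mul_inv_cancel₀ hpi, one_mul]
      exact integral_congr_ae (Eventually.of_forall fun θ =>
        Set.indicator_of_mem ((hmem θ).2 hζ) _)
    · rw [Set.indicator_of_notMem hζ]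
      refine integral_eq_zero_of_ae (Eventually.of_forall fun θ => ?_)
      exact Set.indicator_of_notMem (fun h => hζ ((hmem θ).1 h)) _
  have h3 := integral_integral_swap hint
  simp only [h1, h2] at h3
  rw [integral_indicator hBm, setIntegral_const, setIntegral_const, measureReal_def,
    measureReal_def, Real.volume_Ioc, Complex.volume_ball, Complex.real_smul, Complex.real_smul,
    ENNReal.toReal_ofReal (by linarith [Real.two_pi_pos])] at h3
  have hpi : (2 * (Real.pi : ℂ)) ≠ 0 := by simp [Real.pi_ne_zero]
  refine mul_left_cancel₀ hpi ?_
  simp only [sub_zero, Complex.ofReal_mul, Complex.ofReal_ofNat] at h3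
  rw [h3]
  simp
  ring

/-! ### The Cayley transform -/

section Cayley

/-- The upper half-plane as a set of complex numbers. -/
def upper : Set ℂ := {w | 0 < w.im}

theorem isOpen_upper : IsOpen upper := isOpen_lt continuous_const Complex.continuous_im

theorem measurableSet_upper : MeasurableSet upper := isOpen_upper.measurableSet

theorem halfPlaneVol_eq : halfPlaneVol = volume.restrict upper := rfl

theorem sub_conj_ne_zero {p w : ℂ} (hp : 0 < p.im) (hw : 0 < w.im) :
    w - starRingEnd ℂ p ≠ 0 := fun h => by
  have := congrArg Complex.im h
  simp at this
  linarith

theorem norm_sub_lt_norm_sub_conj {p : ℂ} (hp : 0 < p.im) (w : ℂ) :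
    ‖w - p‖ < ‖w - starRingEnd ℂ p‖ ↔ 0 < w.im := by
  rw [← sq_lt_sq₀ (norm_nonneg _) (norm_nonneg _), ← Complex.normSq_eq_norm_sq,
    ← Complex.normSq_eq_norm_sq, Complex.normSq_apply, Complex.normSq_apply]
  simp only [Complex.sub_re, Complex.sub_im, Complex.conj_re, Complex.conj_im]
  constructor
  · intro h; nlinarith
  · intro h; nlinarith

/-- The conformal map of the unit disc onto the upper half-plane with `0 ↦ p`. -/
def cayley (p ζ : ℂ) : ℂ := (p - starRingEnd ℂ p * ζ) / (1 - ζ)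

theorem one_sub_ne_zero_of_mem_ball {ζ : ℂ} (hζ : ζ ∈ Metric.ball (0 : ℂ) 1) : 1 - ζ ≠ 0 := by
  intro h
  rw [mem_ball_zero_iff, ← sub_eq_zero.1 h, norm_one] at hζ
  exact lt_irrefl _ hζ

theorem cayley_sub_conj (p : ℂ) {ζ : ℂ} (hζ : 1 - ζ ≠ 0) :
    cayley p ζ - starRingEnd ℂ p = (p - starRingEnd ℂ p) / (1 - ζ) := by
  unfold cayley
  field_simp
  ring

theorem cayley_sub (p : ℂ) {ζ : ℂ} (hζ : 1 - ζ ≠ 0) :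
    cayley p ζ - p = (p - starRingEnd ℂ p) / (1 - ζ) * ζ := by
  unfold cayley
  field_simp
  ring

theorem hasDerivAt_cayley (p : ℂ) {ζ : ℂ} (hζ : 1 - ζ ≠ 0) :
    HasDerivAt (cayley p) ((p - starRingEnd ℂ p) / (1 - ζ) ^ 2) ζ := by
  have h := (((hasDerivAt_id ζ).const_mul (starRingEnd ℂ p)).const_sub p).div
    ((hasDerivAt_id ζ).const_sub 1) hζ
  refine h.congr_deriv ?_
  simp only [id]
  congr 1
  ring

theorem image_cayley {p : ℂ} (hp : 0 < p.im) : cayley p '' Metric.ball 0 1 = upper := by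
  have hpp := sub_conj_ne_zero hp hp
  ext w
  constructor
  · rintro ⟨ζ, hζ, rfl⟩
    have h1 := one_sub_ne_zero_of_mem_ball hζ
    refine (norm_sub_lt_norm_sub_conj hp _).1 ?_
    rw [cayley_sub p h1, cayley_sub_conj p h1, norm_mul]
    exact mul_lt_of_lt_one_right (norm_pos_iff.2 (div_ne_zero hpp h1)) (mem_ball_zero_iff.1 hζ)
  · intro hw
    have hw' : 0 < w.im := hw
    have h1 := sub_conj_ne_zero hp hw'
    refine ⟨(w - p) / (w - starRingEnd ℂ p), ?_, ?_⟩
    · rw [mem_ball_zero_iff, norm_div, div_lt_one (norm_pos_iff.2 h1)]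
      exact (norm_sub_lt_norm_sub_conj hp _).2 hw'
    · have h2 : 1 - (w - p) / (w - starRingEnd ℂ p)
          = (p - starRingEnd ℂ p) / (w - starRingEnd ℂ p) := by
        field_simp
        ring
      rw [cayley, h2]
      field_simp
      ring

theorem injOn_cayley {p : ℂ} (hp : 0 < p.im) : Set.InjOn (cayley p) (Metric.ball 0 1) := by
  intro ζ hζ η hη h
  have h1 := one_sub_ne_zero_of_mem_ball hζ
  have h2 := one_sub_ne_zero_of_mem_ball hη
  have hpp := sub_conj_ne_zero hp hp
  have h3 := cayley_sub_conj p h1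
  rw [h, cayley_sub_conj p h2] at h3
  have h4 := (div_eq_div_iff h2 h1).1 h3
  have := mul_left_cancel₀ hpp h4
  linear_combination -this

end Cayley

/-! ### The reproducing kernel of the Bergman space -/

section Reproducing

/-- The reproducing kernel, up to a factor. -/
def bergKer (p w : ℂ) : ℂ := 1 / (w - starRingEnd ℂ p) ^ 2

theorem measurable_bergKer (p : ℂ) : Measurable (bergKer p) :=
  measurable_const.div ((measurable_id.sub_const _).pow_const 2)

theorem lintegral_bergKer {p : ℂ} (hp : 0 < p.im) :
    ∫⁻ w, ENNReal.ofReal (‖bergKer p w‖ ^ 2) ∂halfPlaneVol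
      = ENNReal.ofReal (‖p - starRingEnd ℂ p‖ ^ 2)⁻¹ * ENNReal.ofReal Real.pi := by
  rw [halfPlaneVol_eq, ← image_cayley hp, lintegral_image_holomorphic measurableSet_ball
    (fun ζ hζ => hasDerivAt_cayley p (one_sub_ne_zero_of_mem_ball hζ)) (injOn_cayley hp)]
  have hpp := norm_pos_iff.2 (sub_conj_ne_zero hp hp)
  rw [setLIntegral_congr_fun (g := fun _ => ENNReal.ofReal (‖p - starRingEnd ℂ p‖ ^ 2)⁻¹)
    measurableSet_ball fun ζ hζ => ?_]
  · rw [setLIntegral_const, Complex.volume_ball]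
    simp [ENNReal.ofReal, NNReal.pi, Real.toNNReal_of_nonneg Real.pi_pos.le]
    rfl
  · have h1 := one_sub_ne_zero_of_mem_ball hζ
    have h2 := norm_pos_iff.2 h1
    simp only
    rw [← ENNReal.ofReal_mul (by positivity), bergKer, cayley_sub_conj p h1]
    congr 1
    simp only [norm_div, norm_one, norm_pow]
    field_simp

theorem memLp_bergKer {p : ℂ} (hp : 0 < p.im) : MemLp (bergKer p) 2 halfPlaneVol := by
  have hm := (measurable_bergKer p).aestronglyMeasurable (μ := halfPlaneVol)
  refine (memLp_two_iff_integrable_sq_norm hm).2 ⟨hm.norm.pow 2, ?_⟩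
  rw [hasFiniteIntegral_iff_ofReal (Eventually.of_forall fun w => sq_nonneg _),
    lintegral_bergKer hp]
  exact ENNReal.mul_lt_top ENNReal.ofReal_lt_top ENNReal.ofReal_lt_top

/-- In the disc coordinate centred at `p` the conjugated kernel cancels the antiholomorphic half of
the Jacobian. What remains is a constant times `F(cayley) · cayley'`, to which the mean value
property applies. The sign comes from `(p - p̄)/(p̄ - p)`. -/
theorem integral_mul_conj_bergKer {p : ℂ} (hp : 0 < p.im) {F : ℂ → ℂ}
    (hF : DifferentiableOn ℂ F upper) (hF2 : MemLp F 2 halfPlaneVol) :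
    ∫ w, F w * starRingEnd ℂ (bergKer p w) ∂halfPlaneVol = -Real.pi * F p := by
  have hpp := sub_conj_ne_zero hp hp
  have hpp' : starRingEnd ℂ p - p ≠ 0 := fun h => hpp (by linear_combination -h)
  have hi : Integrable (fun w => F w * starRingEnd ℂ (bergKer p w)) halfPlaneVol :=
    hF2.integrable_mul (memLp_bergKer hp).star
  let G : ℂ → ℂ := fun ζ => F (cayley p ζ) * ((p - starRingEnd ℂ p) / (1 - ζ) ^ 2)
  have hd : ∀ ζ ∈ Metric.ball (0 : ℂ) 1,
      HasDerivAt (cayley p) ((p - starRingEnd ℂ p) / (1 - ζ) ^ 2) ζ :=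
    fun ζ hζ => hasDerivAt_cayley p (one_sub_ne_zero_of_mem_ball hζ)
  have hG : DifferentiableOn ℂ G (Metric.ball 0 1) := by
    refine (hF.comp (fun ζ hζ => (hd ζ hζ).differentiableAt.differentiableWithinAt)
      fun ζ hζ => image_cayley hp ▸ ⟨ζ, hζ, rfl⟩).mul ?_
    exact (differentiableOn_const _).div (by fun_prop)
      fun ζ hζ => pow_ne_zero 2 (one_sub_ne_zero_of_mem_ball hζ)
  have hpt : ∀ ζ ∈ Metric.ball (0 : ℂ) 1, ‖(p - starRingEnd ℂ p) / (1 - ζ) ^ 2‖ ^ 2 •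
      (F (cayley p ζ) * starRingEnd ℂ (bergKer p (cayley p ζ)))
        = (starRingEnd ℂ p - p)⁻¹ * G ζ := fun ζ hζ => by
    have h1 := one_sub_ne_zero_of_mem_ball hζ
    have h2 : 1 - starRingEnd ℂ ζ ≠ 0 := fun h => h1 (by
      have := congrArg (starRingEnd ℂ) h
      simpa using this)
    rw [Complex.real_smul, Complex.ofReal_pow, ← Complex.mul_conj', bergKer,
      cayley_sub_conj p h1]
    simp only [G, map_div₀, map_pow, map_sub, map_one, Complex.conj_conj]
    field_simp
  rw [halfPlaneVol_eq, ← image_cayley hp] at hi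
  rw [halfPlaneVol_eq, ← image_cayley hp, integral_image_holomorphic measurableSet_ball hd
    (injOn_cayley hp), setIntegral_congr_fun measurableSet_ball hpt, integral_const_mul,
    integral_ball_of_holomorphic hG]
  · have h0 : cayley p 0 = p := by simp [cayley]
    simp only [G, h0, sub_zero, one_pow, div_one]
    field_simp
    ring
  · have h3 := (integrableOn_image_holomorphic measurableSet_ball hd (injOn_cayley hp) _).1 hi
    have h4 := (h3.congr_fun hpt measurableSet_ball).const_mul (starRingEnd ℂ p - p)
    refine IntegrableOn.congr_fun h4 (fun ζ _ => ?_) measurableSet_ball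
    field_simp

end Reproducing

/-! ### The vectors of the cocycle -/

section SpecialVectors

/-- The normalizing factor `(2π)^{-1/2}`. -/
def specialConst : ℝ := (Real.sqrt (2 * Real.pi))⁻¹

theorem specialConst_sq : specialConst * (Real.pi * specialConst) = 1 / 2 := by
  have h : Real.sqrt (2 * Real.pi) * Real.sqrt (2 * Real.pi) = 2 * Real.pi :=
    Real.mul_self_sqrt Real.two_pi_pos.le
  have h0 : Real.sqrt (2 * Real.pi) ≠ 0 := (Real.sqrt_pos.2 Real.two_pi_pos).ne'
  have hpi := Real.pi_ne_zero
  rw [specialConst]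
  field_simp
  linear_combination -h

/-- The function `(2π)^{-1/2} (d/dw) log ((w - p̄) / (w + i))`. -/
def specialFun (p w : ℂ) : ℂ :=
  (specialConst : ℂ) * (1 / (w - starRingEnd ℂ p) - 1 / (w + Complex.I))

theorem specialCocycle_eq (g : SL2) :
    specialCocycle g = specialFun (act g UpperHalfPlane.I : ℂ) := rfl

theorem measurable_specialFun (p : ℂ) : Measurable (specialFun p) :=
  ((measurable_const.div (measurable_id.sub_const _)).sub
    (measurable_const.div (measurable_id.add_const _))).const_mul _

theorem add_I_ne_zero {w : ℂ} (hw : 0 < w.im) : w + Complex.I ≠ 0 := by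
  have := sub_conj_ne_zero (p := Complex.I) (by simp) hw
  simpa using this

theorem differentiableOn_specialFun {p : ℂ} (hp : 0 < p.im) :
    DifferentiableOn ℂ (specialFun p) upper :=
  (((differentiableOn_const _).div (by fun_prop) fun _ hw => sub_conj_ne_zero hp hw).sub
    ((differentiableOn_const _).div (by fun_prop) fun _ hw => add_I_ne_zero hw)).const_mul _

theorem ae_mem_upper : ∀ᵐ w ∂halfPlaneVol, w ∈ upper := ae_restrict_mem measurableSet_upper

theorem memLp_specialFun {p : ℂ} (hp : 0 < p.im) : MemLp (specialFun p) 2 halfPlaneVol := by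
  have hI : 0 < Complex.I.im := by simp
  refine ((((memLp_bergKer hp).norm.add (memLp_bergKer hI).norm).const_mul
    (specialConst * ‖starRingEnd ℂ p + Complex.I‖))).mono
    (measurable_specialFun p).aestronglyMeasurable ?_
  filter_upwards [ae_mem_upper] with w hw
  have h1 := sub_conj_ne_zero hp hw
  have h2 := add_I_ne_zero hw
  have hc : 0 ≤ specialConst := inv_nonneg.2 (Real.sqrt_nonneg _)
  have h3 : specialFun p w = specialConst * ((starRingEnd ℂ p + Complex.I) *
      (1 / (w - starRingEnd ℂ p) * (1 / (w + Complex.I)))) := by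
    rw [specialFun]
    field_simp
    ring
  have hn : 0 ≤ specialConst * ‖starRingEnd ℂ p + Complex.I‖ := by positivity
  simp only [Pi.add_apply, norm_mul, norm_norm]
  rw [Real.norm_of_nonneg hc,
    Real.norm_of_nonneg (show 0 ≤ ‖bergKer p w‖ + ‖bergKer Complex.I w‖ by positivity), h3, norm_mul, norm_mul,
    Complex.norm_real, Real.norm_of_nonneg hc, ← mul_assoc]
  refine mul_le_mul_of_nonneg_left ?_ hn
  have e1 : ‖bergKer p w‖ = ‖1 / (w - starRingEnd ℂ p)‖ ^ 2 := by
    rw [bergKer, ← norm_pow, div_pow, one_pow]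
  have e2 : ‖bergKer Complex.I w‖ = ‖1 / (w + Complex.I)‖ ^ 2 := by
    rw [bergKer, ← norm_pow, div_pow, one_pow, Complex.conj_I, sub_neg_eq_add]
  rw [norm_mul, e1, e2]
  nlinarith [sq_nonneg (‖1 / (w - starRingEnd ℂ p)‖ - ‖1 / (w + Complex.I)‖),
    sq_nonneg ‖1 / (w - starRingEnd ℂ p)‖, sq_nonneg ‖1 / (w + Complex.I)‖]

/-- The reproducing kernel as an element of the Hilbert space. -/
def bergLp (p : ℂ) : Lp ℂ 2 halfPlaneVol :=
  if hp : 0 < p.im then (memLp_bergKer hp).toLp _ else 0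

/-- The functions `specialFun p` as elements of the Hilbert space. -/
def specialLp (p : ℂ) : Lp ℂ 2 halfPlaneVol :=
  if hp : 0 < p.im then (memLp_specialFun hp).toLp _ else 0

theorem coeFn_bergLp {p : ℂ} (hp : 0 < p.im) : bergLp p =ᵐ[halfPlaneVol] bergKer p := by
  rw [bergLp, dif_pos hp]; exact MemLp.coeFn_toLp _

theorem coeFn_specialLp {p : ℂ} (hp : 0 < p.im) : specialLp p =ᵐ[halfPlaneVol] specialFun p := by
  rw [specialLp, dif_pos hp]; exact MemLp.coeFn_toLp _

theorem specialLp_I : specialLp Complex.I = 0 := by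
  refine Lp.ext ((coeFn_specialLp (by simp)).trans (EventuallyEq.trans ?_ (Lp.coeFn_zero _ _ _).symm))
  refine Eventually.of_forall fun w => ?_
  simp [specialFun]

/-- The reproducing property. -/
theorem inner_smul_bergLp {q : ℂ} (hq : 0 < q.im) (ε : ℂ) {f : Lp ℂ 2 halfPlaneVol} {F : ℂ → ℂ}
    (hF : DifferentiableOn ℂ F upper) (hf : f =ᵐ[halfPlaneVol] F) :
    inner ℝ (starRingEnd ℂ ε • bergLp q) f = -Real.pi * (ε * F q).re := by
  have hF2 : MemLp F 2 halfPlaneVol := (memLp_congr_ae hf).1 (Lp.memLp f)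
  have hi : Integrable (fun w => F w * starRingEnd ℂ (bergKer q w)) halfPlaneVol :=
    hF2.integrable_mul (memLp_bergKer hq).star
  have h := integral_mul_conj_bergKer hq hF hF2
  have h2 : (ε * F q).re * -Real.pi
      = (∫ w, ε * (F w * starRingEnd ℂ (bergKer q w)) ∂halfPlaneVol).re := by
    rw [integral_const_mul, h, ← Complex.re_mul_ofReal]
    congr 1
    push_cast
    ring
  rw [mul_comm, h2, ← RCLike.re_eq_complex_re, ← integral_re (hi.const_mul ε), L2.inner_def]
  refine integral_congr_ae ?_
  filter_upwards [hf, coeFn_bergLp hq, Lp.coeFn_smul (starRingEnd ℂ ε) (bergLp q)] with w h1 h2 h3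
  rw [Complex.inner, h1, h3, Pi.smul_apply, h2, smul_eq_mul, map_mul, Complex.conj_conj,
    RCLike.re_eq_complex_re]
  congr 1
  ring

/-- The derivative of `p ↦ specialLp p`. -/
def specialDeriv (q : ℂ) : ℂ →L[ℝ] Lp ℂ 2 halfPlaneVol :=
  specialConst • (((ContinuousLinearMap.toSpanSingleton ℂ (bergLp q)).restrictScalars ℝ).comp
    (Complex.conjCLE : ℂ →L[ℝ] ℂ))

theorem specialDeriv_apply (q ε : ℂ) :
    specialDeriv q ε = specialConst • (starRingEnd ℂ ε • bergLp q) := rfl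

/-- The error of the linear approximation is exactly `ε̄² bergKer q` divided by `w - (q + ε)‾`, up
to the normalizing factor. For `‖ε‖ ≤ Im q / 2` this denominator has modulus at least `Im q / 2`, so
the error is quadratic in norm. -/
theorem hasFDerivAt_specialLp {q : ℂ} (hq : 0 < q.im) :
    HasFDerivAt specialLp (specialDeriv q) q := by
  have hc : 0 ≤ specialConst := inv_nonneg.2 (Real.sqrt_nonneg _)
  have key : ∀ ε : ℂ, ‖ε‖ ≤ q.im / 2 →
      ‖specialLp (q + ε) - specialLp q - specialDeriv q ε‖
        ≤ specialConst * (2 / q.im) * ‖bergLp q‖ * ‖ε‖ ^ 2 := by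
    intro ε hε
    have him : |ε.im| ≤ q.im / 2 := (Complex.abs_im_le_norm ε).trans hε
    have hqe : 0 < (q + ε).im := by
      rw [Complex.add_im]; linarith [neg_le_of_abs_le him]
    have h := Lp.norm_le_mul_norm_of_ae_le_mul (p := 2)
      (f := specialLp (q + ε) - specialLp q - specialDeriv q ε) (g := bergLp q)
      (c := specialConst * (2 / q.im) * ‖ε‖ ^ 2) ?_
    · linarith
    rw [specialDeriv_apply]
    filter_upwards [Lp.coeFn_sub (specialLp (q + ε) - specialLp q)
        (specialConst • (starRingEnd ℂ ε • bergLp q)), Lp.coeFn_sub (specialLp (q + ε))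
        (specialLp q), Lp.coeFn_smul specialConst (starRingEnd ℂ ε • bergLp q),
        Lp.coeFn_smul (starRingEnd ℂ ε) (bergLp q), coeFn_specialLp hqe, coeFn_specialLp hq,
        coeFn_bergLp hq, ae_mem_upper] with w e1 e2 e3 e4 e5 e6 e7 hw
    rw [e1, Pi.sub_apply, e2, Pi.sub_apply, e3, Pi.smul_apply, e4, Pi.smul_apply, e5, e6, e7]
    have hw : 0 < w.im := hw
    have h1 := sub_conj_ne_zero hq hw
    have h2 := sub_conj_ne_zero hqe hw
    have h3 : specialFun (q + ε) w - specialFun q w - specialConst • starRingEnd ℂ ε • bergKer q w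
        = specialConst * (starRingEnd ℂ ε ^ 2 * (1 / (w - starRingEnd ℂ (q + ε))) * bergKer q w) := by
      rw [specialFun, specialFun, bergKer, Complex.real_smul, smul_eq_mul, ← mul_sub, ← mul_sub]
      congr 1
      have h2' : w - (starRingEnd ℂ q + starRingEnd ℂ ε) ≠ 0 := by rwa [← map_add]
      rw [map_add]
      field_simp
      ring
    have h4 : ‖1 / (w - starRingEnd ℂ (q + ε))‖ ≤ 2 / q.im := by
      rw [norm_div, norm_one, ← one_div_div q.im 2]
      refine one_div_le_one_div_of_le (by linarith) ?_
      have h5 := Complex.abs_im_le_norm (w - starRingEnd ℂ (q + ε))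
      rw [Complex.sub_im, Complex.conj_im, Complex.add_im] at h5
      have h6 := le_abs_self (w.im - -(q.im + ε.im))
      linarith [neg_le_of_abs_le him]
    rw [h3, norm_mul, norm_mul, norm_mul, norm_pow, Complex.norm_conj, Complex.norm_real,
      Real.norm_of_nonneg hc]
    calc specialConst * (‖ε‖ ^ 2 * ‖1 / (w - starRingEnd ℂ (q + ε))‖ * ‖bergKer q w‖)
        ≤ specialConst * (‖ε‖ ^ 2 * (2 / q.im) * ‖bergKer q w‖) := by gcongr
      _ = _ := by ring
  rw [hasFDerivAt_iff_isLittleO_nhds_zero]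
  refine Asymptotics.IsBigO.trans_isLittleO (g := fun ε : ℂ => ‖ε‖ ^ 2) ?_ ?_
  · refine Asymptotics.IsBigO.of_bound (specialConst * (2 / q.im) * ‖bergLp q‖) ?_
    filter_upwards [Metric.closedBall_mem_nhds (0 : ℂ) (half_pos hq)] with ε hε
    rw [norm_pow, norm_norm]
    exact key ε (mem_closedBall_zero_iff.1 hε)
  · exact (Asymptotics.isLittleO_norm_pow_id one_lt_two)

theorem continuousOn_specialLp : ContinuousOn specialLp upper := fun _ hq =>
  (hasFDerivAt_specialLp hq).continuousAt.continuousWithinAt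

/-- The inner products of the vectors of the cocycle. -/
theorem inner_specialLp {p q : ℂ} (hp : 0 < p.im) (hq : 0 < q.im) :
    inner ℝ (specialLp q) (specialLp p) = -(Real.log ‖q - starRingEnd ℂ p‖ -
      Real.log ‖q + Complex.I‖ - Real.log ‖p + Complex.I‖ + Real.log 2) / 2 := by
  let Ψ : ℂ → ℂ := fun q => Complex.log (q - starRingEnd ℂ p) - Complex.log (q + Complex.I)
  have hΨ : ∀ q ∈ upper, HasDerivAt Ψ (1 / (q - starRingEnd ℂ p) - 1 / (q + Complex.I)) q := by
    intro q hq
    have hq : 0 < q.im := hq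
    refine (((hasDerivAt_id q).sub_const _).clog ?_).sub (((hasDerivAt_id q).add_const _).clog ?_)
    · refine Or.inr ?_
      simp only [id, Complex.sub_im, Complex.conj_im]
      linarith
    · refine Or.inr ?_
      simp only [id, Complex.add_im, Complex.I_im]
      linarith
  -- By the reproducing property the derivative of the inner product in the direction `ε` is `-½ Re
  -- (ε Ψ')`, the factor being `π specialConst² = ½`. So `φ` is constant, and it is evaluated at `q
  -- = i`, where `specialLp` vanishes.
  let φ : ℂ → ℝ := fun q => inner ℝ (specialLp q) (specialLp p) + (Ψ q).re / 2
  have hφ : ∀ q ∈ upper, HasFDerivAt φ (0 : ℂ →L[ℝ] ℝ) q := by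
    intro q hq
    have h1 := (hasFDerivAt_specialLp hq).inner ℝ
      (hasFDerivAt_const (𝕜 := ℝ) (specialLp p) q)
    have h2 := (Complex.reCLM.hasFDerivAt (x := Ψ q)).comp q
      ((hΨ q hq).hasFDerivAt.restrictScalars ℝ)
    have h3 := h1.add (h2.const_mul (1 / 2 : ℝ))
    have h4 : φ = (fun q => inner ℝ (specialLp q) (specialLp p)) +
        fun q => 1 / 2 * (Complex.reCLM ∘ Ψ) q := by
      funext q
      simp only [φ, Pi.add_apply, Function.comp_apply, Complex.reCLM_apply]
      ring
    rw [h4]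
    refine h3.congr_fderiv ?_
    ext ε
    have h5 := inner_smul_bergLp hq ε (differentiableOn_specialFun hp) (coeFn_specialLp hp)
    simp only [add_apply, ContinuousLinearMap.comp_apply,
      smul_apply, fderivInnerCLM_apply, ContinuousLinearMap.prod_apply,
      zero_apply, inner_zero_right, zero_add, specialDeriv_apply,
      real_inner_smul_left, h5, Complex.reCLM_apply, ContinuousLinearMap.coe_restrictScalars',
      ContinuousLinearMap.toSpanSingleton_apply, smul_eq_mul]
    have h6 : (ε * specialFun p q).re
        = specialConst * (ε * (1 / (q - starRingEnd ℂ p) - 1 / (q + Complex.I))).re := by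
      rw [specialFun, ← Complex.re_ofReal_mul]
      congr 1
      ring
    rw [h6]
    linear_combination -(ε * (1 / (q - starRingEnd ℂ p) - 1 / (q + Complex.I))).re *
      specialConst_sq
  have hconst : φ q = φ Complex.I := by
    refine isOpen_upper.is_const_of_fderiv_eq_zero (𝕜 := ℝ)
      (convex_halfSpace_im_gt 0).isPreconnected
      (fun q hq => (hφ q hq).differentiableAt.differentiableWithinAt)
      (fun q hq => (hφ q hq).fderiv) hq (show 0 < Complex.I.im by simp)
  have h7 : ‖Complex.I - starRingEnd ℂ p‖ = ‖p + Complex.I‖ := by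
    rw [← Complex.norm_conj, map_sub, Complex.conj_I, Complex.conj_conj, ← norm_neg]
    congr 1
    ring
  have h8 : ‖Complex.I + Complex.I‖ = 2 := by
    rw [← two_mul, norm_mul, Complex.norm_I]; simp
  simp only [φ, Ψ, specialLp_I, inner_zero_left, Complex.sub_re, Complex.log_re, h7, h8] at hconst
  linarith

end SpecialVectors

/-! ### Totality of the vectors of the cocycle -/

section SpecialTotality

/-- The functions `specialFun p` as elements of the Bergman space. -/
def specialVec (p : ℍ) : Bergman :=
  ⟨specialLp p, specialFun p, differentiableOn_specialFun p.im_pos, coeFn_specialLp p.im_pos⟩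

theorem coe_specialVec (p : ℍ) : (specialVec p : Lp ℂ 2 halfPlaneVol) = specialLp p := rfl

theorem specialVec_I : specialVec UpperHalfPlane.I = 0 :=
  Subtype.ext (by rw [coe_specialVec, UpperHalfPlane.coe_I, specialLp_I]; rfl)

theorem inner_specialVec (p q : ℍ) : inner ℝ (specialVec q) (specialVec p) =
    -(Real.log ‖(q : ℂ) - starRingEnd ℂ (p : ℂ)‖ - Real.log ‖(q : ℂ) + Complex.I‖ -
      Real.log ‖(p : ℂ) + Complex.I‖ + Real.log 2) / 2 := by
  rw [Submodule.coe_inner, coe_specialVec, coe_specialVec, inner_specialLp p.im_pos q.im_pos]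

theorem continuous_specialVec : Continuous specialVec :=
  (continuousOn_specialLp.comp_continuous UpperHalfPlane.continuous_coe
    fun p => p.im_pos).subtype_mk _

/-- The closed span contains the derivatives of `p ↦ specialLp p`, that is, all multiples of the
reproducing kernels. For `f` in the Bergman space let `y` be its projection to the closed span; then
`f - y` is orthogonal to the kernels. Elements of the span that tend to `y` converge pointwise to
the holomorphic representative of `f`, and a subsequence converges almost everywhere to `y`, so `f =
y`. -/
theorem dense_span_specialVec :
    Dense (Submodule.span ℝ (Set.range specialVec) : Set Bergman) := by
  let S : Submodule ℝ (Lp ℂ 2 halfPlaneVol) := Submodule.span ℝ (Set.range fun p : ℍ => specialLp p)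
  have hS : ∀ p : ℂ, specialLp p ∈ S := fun p => by
    by_cases hp : 0 < p.im
    · exact Submodule.subset_span ⟨⟨p, hp⟩, rfl⟩
    · rw [specialLp, dif_neg hp]; exact S.zero_mem
  have hrep : ∀ f ∈ S, ∃ F : ℂ → ℂ, DifferentiableOn ℂ F upper ∧ f =ᵐ[halfPlaneVol] F := by
    intro f hf
    have : S ≤ Bergman := Submodule.span_le.2 (by rintro _ ⟨p, rfl⟩; exact (specialVec p).2)
    exact this hf
  have hder : ∀ (q : ℂ) (_ : 0 < q.im) (ε : ℂ),
      starRingEnd ℂ ε • bergLp q ∈ S.topologicalClosure := by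
    intro q hq ε
    have h1 := (hasFDerivAt_specialLp hq).lim_real ε
    have h2 : specialDeriv q ε ∈ S.topologicalClosure :=
      mem_closure_of_tendsto h1 (Eventually.of_forall fun c =>
        S.smul_mem _ (S.sub_mem (hS _) (hS _)))
    rw [specialDeriv_apply] at h2
    have hc : specialConst ≠ 0 := inv_ne_zero (Real.sqrt_pos.2 Real.two_pi_pos).ne'
    have h3 := S.topologicalClosure.smul_mem specialConst⁻¹ h2
    rwa [inv_smul_smul₀ hc] at h3
  have hmain : ∀ f ∈ Bergman, f ∈ S.topologicalClosure := by
    rintro f ⟨F, hF, hf⟩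
    have : CompleteSpace S.topologicalClosure := S.isClosed_topologicalClosure.completeSpace_coe
    obtain ⟨y, hy, z, hz, hyz⟩ :=
      Submodule.exists_add_mem_mem_orthogonal (K := S.topologicalClosure) f
    obtain ⟨u, hu, huy⟩ := mem_closure_iff_seq_limit.1 hy
    choose G hG hGu using fun n => hrep (u n) (hu n)
    have hre : ∀ q ∈ upper, ∀ ε : ℂ,
        Tendsto (fun n => (ε * G n q).re) atTop (nhds (ε * F q).re) := by
      intro q hq ε
      have hq : 0 < q.im := hq
      have h1 : Tendsto (fun n => inner ℝ (starRingEnd ℂ ε • bergLp q) (u n)) atTop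
          (nhds (inner ℝ (starRingEnd ℂ ε • bergLp q) y)) := tendsto_const_nhds.inner huy
      have h2 : inner ℝ (starRingEnd ℂ ε • bergLp q) y = inner ℝ (starRingEnd ℂ ε • bergLp q) f := by
        rw [hyz, inner_add_right, (Submodule.mem_orthogonal _ z).1 hz _ (hder q hq ε), add_zero]
      rw [h2, inner_smul_bergLp hq ε hF hf] at h1
      simp only [fun n => inner_smul_bergLp hq ε (hG n) (hGu n)] at h1
      have h3 := h1.const_mul (-Real.pi)⁻¹
      have hpi : -Real.pi ≠ 0 := neg_ne_zero.2 Real.pi_ne_zero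
      simpa only [inv_mul_cancel_left₀ hpi] using h3
    have hpt : ∀ q ∈ upper, Tendsto (fun n => G n q) atTop (nhds (F q)) := by
      intro q hq
      have h1 := hre q hq 1
      -- Only real inner products are available; this multiple yields the imaginary part.
      have h2 := hre q hq (-Complex.I)
      simp only [one_mul, neg_mul, Complex.neg_re, Complex.I_mul_re, neg_neg] at h1 h2
      have h3 := ((Complex.continuous_ofReal.tendsto _).comp h1).add
        (((Complex.continuous_ofReal.tendsto _).comp h2).mul_const Complex.I)
      simpa only [Function.comp_def, Complex.re_add_im] using h3
    obtain ⟨ns, hns, hae⟩ := (tendstoInMeasure_of_tendsto_Lp huy).exists_seq_tendsto_ae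
    have hyF : y =ᵐ[halfPlaneVol] F := by
      have hall : ∀ᵐ w ∂halfPlaneVol, ∀ n, u n w = G n w := ae_all_iff.2 hGu
      filter_upwards [hae, hall, ae_mem_upper] with w h1 h2 hw
      simp only [h2] at h1
      exact tendsto_nhds_unique h1 ((hpt w hw).comp hns.tendsto_atTop)
    have : f = y := Lp.ext (hf.trans hyF.symm)
    rw [this]
    exact hy
  intro f
  rw [Metric.mem_closure_iff]
  intro ε hε
  obtain ⟨g, hg, hd⟩ := Metric.mem_closure_iff.1 (hmain f.1 f.2) ε hε
  have h1 : Submodule.map Bergman.subtype (Submodule.span ℝ (Set.range specialVec)) = S := by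
    rw [Submodule.map_span, ← Set.range_comp]
    rfl
  rw [← h1] at hg
  obtain ⟨g', hg', rfl⟩ := hg
  exact ⟨g', hg', hd⟩

end SpecialTotality

/-! ### The special representation -/

section SpecialAct

/-- The fractional linear map `w ↦ g⁻¹ w`. -/
def invMoebius (g : SL2) (w : ℂ) : ℂ :=
  ((g 0 0 : ℂ) * w - g 1 0) / ((g 1 1 : ℂ) - g 0 1 * w)

theorem det_complex (g : SL2) : (g 0 0 : ℂ) * g 1 1 - g 0 1 * g 1 0 = 1 := by
  have h := g.det_coe
  rw [Matrix.det_fin_two] at h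
  exact_mod_cast h

theorem invMoebius_coe (g : SL2) (w : ℍ) : invMoebius g w = act g⁻¹ w := by
  rw [coe_act, Matrix.SpecialLinearGroup.coe_inv, Matrix.adjugate_fin_two, invMoebius]
  simp
  congr 1
  ring

theorem linear_ne_zero {a b : ℝ} (h : a ≠ 0 ∨ b ≠ 0) {w : ℂ} (hw : w.im ≠ 0) :
    (a : ℂ) + b * w ≠ 0 := fun h0 => by
  have h1 := congrArg Complex.im h0
  have h2 := congrArg Complex.re h0
  simp [hw] at h1
  simp [h1] at h2
  simp [h1, h2] at h

theorem denom_ne_zero (g : SL2) {w : ℂ} (hw : w.im ≠ 0) : (g 1 1 : ℂ) - g 0 1 * w ≠ 0 := by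
  have h : g 1 1 ≠ 0 ∨ -g 0 1 ≠ 0 := by
    by_contra hc
    push Not at hc
    have := det_complex g
    rw [hc.1, neg_eq_zero.1 hc.2] at this
    simp at this
  have := linear_ne_zero h hw
  push_cast at this
  rwa [neg_mul, ← sub_eq_add_neg] at this

theorem denom_ne_zero' (g : SL2) {w : ℂ} (hw : w.im ≠ 0) : (g 0 1 : ℂ) * w + g 0 0 ≠ 0 := by
  have h : g 0 0 ≠ 0 ∨ g 0 1 ≠ 0 := by
    by_contra hc
    push Not at hc
    have := det_complex g
    rw [hc.1, hc.2] at this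
    simp at this
  rw [add_comm]
  exact linear_ne_zero h hw

theorem hasDerivAt_invMoebius (g : SL2) {w : ℂ} (hw : w.im ≠ 0) :
    HasDerivAt (invMoebius g) (1 / ((g 1 1 : ℂ) - g 0 1 * w) ^ 2) w := by
  have h := (((hasDerivAt_id w).const_mul (g 0 0 : ℂ)).sub_const (g 1 0 : ℂ)).div
    (((hasDerivAt_id w).const_mul (g 0 1 : ℂ)).const_sub (g 1 1 : ℂ)) (denom_ne_zero g hw)
  refine h.congr_deriv ?_
  simp only [id]
  congr 1
  linear_combination det_complex g

/-- `flip` is conjugation by the transposition of the two coordinates, hence multiplicative. -/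
theorem act_mul (g h : SL2) (z : ℍ) : act (g * h) z = act g (act h z) := by
  have h1 : flip (g * h) = flip g * flip h := by
    refine Subtype.ext ?_
    rw [Matrix.SpecialLinearGroup.coe_mul]
    ext i j
    fin_cases i <;> fin_cases j <;>
      simp [flip, Matrix.mul_apply, Fin.sum_univ_two] <;> ring
  rw [act, h1, mul_smul]
  rfl

theorem act_one (z : ℍ) : act 1 z = z := by
  have h1 : flip 1 = 1 := by
    ext i j
    fin_cases i <;> fin_cases j <;> simp [flip]
  rw [act, h1, one_smul]

theorem image_invMoebius (g : SL2) : invMoebius g '' upper = upper := by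
  ext w
  constructor
  · rintro ⟨v, hv, rfl⟩
    have := invMoebius_coe g ⟨v, hv⟩
    simp only at this
    rw [this]
    exact (act g⁻¹ _).im_pos
  · intro hw
    refine ⟨act g ⟨w, hw⟩, (act g _).im_pos, ?_⟩
    rw [invMoebius_coe, ← act_mul, inv_mul_cancel, act_one]

theorem injOn_invMoebius (g : SL2) : Set.InjOn (invMoebius g) upper := by
  intro w hw v hv h
  have h1 := invMoebius_coe g ⟨w, hw⟩
  have h2 := invMoebius_coe g ⟨v, hv⟩
  simp only at h1 h2
  rw [h1, h2] at h
  have h3 := congrArg (act g) (UpperHalfPlane.ext h)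
  rw [← act_mul, ← act_mul, mul_inv_cancel, act_one, act_one] at h3
  exact congrArg UpperHalfPlane.coe h3

theorem measurable_invMoebius (g : SL2) : Measurable (invMoebius g) :=
  ((measurable_id.const_mul _).sub_const _).div ((measurable_id.const_mul _).const_sub _)

theorem specialAct_eq (g : SL2) (f : ℂ → ℂ) (w : ℂ) :
    specialAct g f w = f (invMoebius g w) / ((g 1 1 : ℂ) - g 0 1 * w) ^ 2 := rfl

theorem lintegral_specialAct (g : SL2) (f : ℂ → ℂ) :
    ∫⁻ w, ‖specialAct g f w‖ₑ ^ (2 : ℝ) ∂halfPlaneVol = ∫⁻ w, ‖f w‖ₑ ^ (2 : ℝ) ∂halfPlaneVol := by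
  conv_rhs => rw [halfPlaneVol_eq, ← image_invMoebius g]
  rw [lintegral_image_holomorphic measurableSet_upper
    (fun w hw => hasDerivAt_invMoebius g (ne_of_gt hw)) (injOn_invMoebius g), halfPlaneVol_eq]
  refine lintegral_congr fun w => ?_
  rw [specialAct_eq, div_eq_mul_one_div, enorm_mul, ENNReal.mul_rpow_of_nonneg _ _ zero_le_two,
    mul_comm]
  congr 1
  rw [ENNReal.rpow_ofNat, ← ofReal_norm, ENNReal.ofReal_pow (norm_nonneg _)]

/-- Norm preservation, applied to the indicator function of a null set, shows that its preimage is
null. This makes the action well defined on classes of functions. -/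
theorem quasiMeasurePreserving_invMoebius (g : SL2) :
    Measure.QuasiMeasurePreserving (invMoebius g) halfPlaneVol halfPlaneVol := by
  refine ⟨measurable_invMoebius g, Measure.AbsolutelyContinuous.mk fun N hN h0 => ?_⟩
  rw [Measure.map_apply (measurable_invMoebius g) hN]
  have h1 := lintegral_specialAct g (N.indicator fun _ => 1)
  have h2 : ∫⁻ w, ‖N.indicator (fun _ => (1 : ℂ)) w‖ₑ ^ (2 : ℝ) ∂halfPlaneVol = 0 := by
    rw [lintegral_eq_zero_iff (((measurable_const.indicator hN).enorm).pow_const _)]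
    filter_upwards [measure_eq_zero_iff_ae_notMem.1 h0] with w hw
    simp [hw]
  rw [h2, lintegral_eq_zero_iff] at h1
  · refine measure_eq_zero_iff_ae_notMem.2 ?_
    filter_upwards [h1, ae_mem_upper] with w h3 hw h4
    have h4 : invMoebius g w ∈ N := h4
    have h5 := denom_ne_zero g (ne_of_gt hw)
    simp [specialAct_eq, h4, h5] at h3
  · exact ((((measurable_const.indicator hN).comp (measurable_invMoebius g)).div
      (((measurable_id.const_mul _).const_sub _).pow_const 2)).enorm).pow_const _

theorem specialAct_congr (g : SL2) {f f' : ℂ → ℂ} (h : f =ᵐ[halfPlaneVol] f') :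
    specialAct g f =ᵐ[halfPlaneVol] specialAct g f' := by
  filter_upwards [(quasiMeasurePreserving_invMoebius g).ae_eq_comp h] with w hw
  simp only [Function.comp_apply] at hw
  rw [specialAct_eq, specialAct_eq, hw]

theorem memLp_specialAct (g : SL2) {f : ℂ → ℂ} (hf : MemLp f 2 halfPlaneVol) :
    MemLp (specialAct g f) 2 halfPlaneVol := by
  have hd : Measurable fun w : ℂ => ((g 1 1 : ℂ) - g 0 1 * w) ^ 2 := by fun_prop
  refine ⟨((hf.1.comp_quasiMeasurePreserving
    (quasiMeasurePreserving_invMoebius g)).aemeasurable.div hd.aemeasurable).aestronglyMeasurable, ?_⟩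
  have h := hf.2
  rw [eLpNorm_eq_lintegral_rpow_enorm_toReal two_ne_zero ENNReal.ofNat_ne_top,
    ENNReal.toReal_ofNat] at h ⊢
  rwa [lintegral_specialAct]

/-- The operators of the special representation on all square integrable functions. -/
def specialLpOp (g : SL2) (f : Lp ℂ 2 halfPlaneVol) : Lp ℂ 2 halfPlaneVol :=
  (memLp_specialAct g (Lp.memLp f)).toLp _

theorem coeFn_specialLpOp (g : SL2) (f : Lp ℂ 2 halfPlaneVol) :
    specialLpOp g f =ᵐ[halfPlaneVol] specialAct g f := MemLp.coeFn_toLp _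

/-- The operators of the special representation. -/
def specialOp (g : SL2) : Bergman →ₗᵢ[ℝ] Bergman where
  toFun f := ⟨specialLpOp g f, by
    obtain ⟨F, hF, hf⟩ := f.2
    refine ⟨specialAct g F, ?_, (coeFn_specialLpOp g _).trans (specialAct_congr g hf)⟩
    refine (hF.comp (fun w hw =>
      (hasDerivAt_invMoebius g (ne_of_gt hw)).differentiableAt.differentiableWithinAt)
      fun w hw => ?_).div (by fun_prop) fun w hw => pow_ne_zero 2 (denom_ne_zero g (ne_of_gt hw))
    exact (image_invMoebius g).subset ⟨w, hw, rfl⟩⟩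
  map_add' f f' := Subtype.ext (Lp.ext (by
    refine (coeFn_specialLpOp g _).trans ((specialAct_congr g (Lp.coeFn_add f.1 f'.1)).trans ?_)
    refine EventuallyEq.trans ?_ (Lp.coeFn_add (specialLpOp g f) (specialLpOp g f')).symm
    filter_upwards [coeFn_specialLpOp g f, coeFn_specialLpOp g f'] with w h1 h2
    rw [Pi.add_apply, h1, h2, specialAct_eq, specialAct_eq, specialAct_eq, Pi.add_apply, add_div]))
  map_smul' c f := Subtype.ext (Lp.ext (by
    refine (coeFn_specialLpOp g _).trans ((specialAct_congr g (Lp.coeFn_smul c f.1)).trans ?_)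
    refine EventuallyEq.trans ?_ (Lp.coeFn_smul c (specialLpOp g f)).symm
    filter_upwards [coeFn_specialLpOp g f] with w h1
    rw [Pi.smul_apply, h1, specialAct_eq, specialAct_eq, Pi.smul_apply,
      Complex.real_smul, Complex.real_smul, mul_div_assoc]))
  norm_map' f := by
    change ‖specialLpOp g f‖ = ‖f.1‖
    rw [specialLpOp, Lp.norm_toLp, Lp.norm_def, eLpNorm_eq_lintegral_rpow_enorm_toReal two_ne_zero
      ENNReal.ofNat_ne_top, eLpNorm_eq_lintegral_rpow_enorm_toReal two_ne_zero
      ENNReal.ofNat_ne_top, ENNReal.toReal_ofNat, lintegral_specialAct]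

theorem coeFn_specialOp (g : SL2) (f : Bergman) :
    ((specialOp g f : Lp ℂ 2 halfPlaneVol) : ℂ → ℂ) =ᵐ[halfPlaneVol]
      specialAct g (f : Lp ℂ 2 halfPlaneVol) := coeFn_specialLpOp g f

/-- The action sends `1/(w - q̄)` to `1/(w - (gq)‾)` plus the term `β/(δ - βw)`. The latter does not
depend on `q` and cancels in the difference of the values at `p` and `i`. -/
theorem specialAct_specialFun (g : SL2) (p : ℍ) {w : ℂ} (hw : w ∈ upper) :
    specialAct g (specialFun p) w
      = specialFun (act g p) w - specialFun (act g UpperHalfPlane.I) w := by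
  have key : ∀ q : ℍ, 1 / (invMoebius g w - starRingEnd ℂ (q : ℂ)) /
      ((g 1 1 : ℂ) - g 0 1 * w) ^ 2 = 1 / (w - starRingEnd ℂ (act g q : ℂ)) +
        g 0 1 / ((g 1 1 : ℂ) - g 0 1 * w) := by
    intro q
    have hd := det_complex g
    have h1 := denom_ne_zero g (ne_of_gt hw)
    have hqi : (starRingEnd ℂ (q : ℂ)).im ≠ 0 := by
      rw [Complex.conj_im]; exact neg_ne_zero.2 (ne_of_gt q.im_pos)
    have h2 := denom_ne_zero' g hqi
    have h3 := sub_conj_ne_zero (act g q).im_pos hw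
    have hcoe : starRingEnd ℂ (act g q : ℂ) = ((g 1 1 : ℂ) * starRingEnd ℂ (q : ℂ) + g 1 0) /
        ((g 0 1 : ℂ) * starRingEnd ℂ (q : ℂ) + g 0 0) := by
      rw [coe_act]
      simp
    set c := starRingEnd ℂ (q : ℂ) with hc
    set c' := starRingEnd ℂ (act g q : ℂ) with hc'
    have h4 : c' * ((g 0 1 : ℂ) * c + g 0 0) = (g 1 1 : ℂ) * c + g 1 0 := by
      rw [hcoe, div_mul_cancel₀ _ h2]
    have h5 : invMoebius g w - c
        = ((g 0 1 : ℂ) * c + g 0 0) * (w - c') / ((g 1 1 : ℂ) - g 0 1 * w) := by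
      rw [invMoebius, eq_div_iff h1, sub_mul, div_mul_cancel₀ _ h1]
      linear_combination h4
    rw [h5, div_add_div _ _ h3 h1, one_div_div, div_div, div_eq_div_iff
      (mul_ne_zero (mul_ne_zero h2 h3) (pow_ne_zero 2 h1)) (mul_ne_zero h3 h1)]
    linear_combination (-(((g 1 1 : ℂ) - g 0 1 * w) ^ 2 * (w - c'))) *
      (hd - (g 0 1 : ℂ) * h4)
  have k1 := key p
  have k2 := key UpperHalfPlane.I
  simp only [UpperHalfPlane.coe_I, Complex.conj_I, sub_neg_eq_add] at k2
  rw [specialAct_eq, specialFun, specialFun, specialFun, mul_div_assoc, sub_div, k1, k2]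
  ring

theorem specialOp_specialVec (g : SL2) (p : ℍ) : specialOp g (specialVec p)
    = specialVec (act g p) - specialVec (act g UpperHalfPlane.I) := by
  refine Subtype.ext (Lp.ext ((coeFn_specialOp g _).trans ?_))
  refine (specialAct_congr g (coeFn_specialLp p.im_pos)).trans ?_
  have h := Lp.coeFn_sub (specialLp (act g p)) (specialLp (act g UpperHalfPlane.I))
  refine EventuallyEq.trans ?_ h.symm
  filter_upwards [ae_mem_upper, coeFn_specialLp (act g p).im_pos,
    coeFn_specialLp (act g UpperHalfPlane.I).im_pos] with w hw h1 h2
  rw [Pi.sub_apply, h1, h2, specialAct_specialFun g p hw]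

end SpecialAct

/-! ### Logarithmic integrals -/

section LogIntegrals

/-- The denominator of the action. -/
def autFactor (g : SL2) (z : ℂ) : ℂ := (g 0 1 : ℂ) * z + g 0 0

theorem autFactor_ne_zero (g : SL2) (z : ℍ) : autFactor g z ≠ 0 :=
  denom_ne_zero' g (ne_of_gt z.im_pos)

theorem autFactor_mul (g h : SL2) (z : ℍ) :
    autFactor (g * h) z = autFactor g (act h z) * autFactor h z := by
  have h1 := autFactor_ne_zero h z
  have h2 : (act h z : ℂ) * autFactor h z = (h 1 1 : ℂ) * z + h 1 0 := by
    rw [coe_act]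
    exact div_mul_cancel₀ _ h1
  have h3 : ((g * h) 0 1 : ℝ) = g 0 0 * h 0 1 + g 0 1 * h 1 1 := by
    simp [Matrix.mul_apply, Fin.sum_univ_two]
  have h4 : ((g * h) 0 0 : ℝ) = g 0 0 * h 0 0 + g 0 1 * h 1 0 := by
    simp [Matrix.mul_apply, Fin.sum_univ_two]
  have h5 : autFactor g (act h z) * autFactor h z
      = (g 0 1 : ℂ) * ((act h z : ℂ) * autFactor h z) + g 0 0 * autFactor h z := by
    rw [autFactor]; ring
  rw [h5, h2, autFactor, autFactor, h3, h4]
  push_cast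
  ring

theorem act_sub_conj_act (g : SL2) (z w : ℍ) :
    ‖(act g z : ℂ) - starRingEnd ℂ (act g w : ℂ)‖ * (‖autFactor g z‖ * ‖autFactor g w‖)
      = ‖(z : ℂ) - starRingEnd ℂ (w : ℂ)‖ := by
  have h1 := autFactor_ne_zero g z
  have h2 := autFactor_ne_zero g w
  have hz : (act g z : ℂ) * autFactor g z = (g 1 1 : ℂ) * z + g 1 0 := by
    rw [coe_act]; exact div_mul_cancel₀ _ h1
  have hw : starRingEnd ℂ (act g w : ℂ) * starRingEnd ℂ (autFactor g w)
      = (g 1 1 : ℂ) * starRingEnd ℂ (w : ℂ) + g 1 0 := by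
    have hw' : (act g w : ℂ) * autFactor g w = (g 1 1 : ℂ) * w + g 1 0 := by
      rw [coe_act]; exact div_mul_cancel₀ _ h2
    rw [← map_mul, hw']
    simp
  have hc : starRingEnd ℂ (autFactor g w) = (g 0 1 : ℂ) * starRingEnd ℂ (w : ℂ) + g 0 0 := by
    simp [autFactor]
  rw [← Complex.norm_conj (autFactor g w), ← norm_mul, ← norm_mul]
  congr 1
  have h5 : ((act g z : ℂ) - starRingEnd ℂ (act g w : ℂ)) *
      (autFactor g z * starRingEnd ℂ (autFactor g w))
      = (act g z : ℂ) * autFactor g z * starRingEnd ℂ (autFactor g w) -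
        starRingEnd ℂ (act g w : ℂ) * starRingEnd ℂ (autFactor g w) * autFactor g z := by ring
  rw [h5, hz, hw, hc, autFactor]
  linear_combination ((z : ℂ) - starRingEnd ℂ (w : ℂ)) * det_complex g

theorem norm_sub_conj_pos (z w : ℍ) : 0 < ‖(z : ℂ) - starRingEnd ℂ (w : ℂ)‖ :=
  norm_pos_iff.2 (sub_conj_ne_zero w.im_pos z.im_pos)

theorem log_act_sub_conj_act (g : SL2) (z w : ℍ) :
    Real.log ‖(act g z : ℂ) - starRingEnd ℂ (act g w : ℂ)‖
      = Real.log ‖(z : ℂ) - starRingEnd ℂ (w : ℂ)‖ -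
        (Real.log ‖autFactor g z‖ + Real.log ‖autFactor g w‖) := by
  have h1 := (norm_pos_iff.2 (autFactor_ne_zero g z)).ne'
  have h2 := (norm_pos_iff.2 (autFactor_ne_zero g w)).ne'
  rw [← act_sub_conj_act g z w, Real.log_mul (norm_sub_conj_pos _ _).ne' (mul_ne_zero h1 h2),
    Real.log_mul h1 h2]
  ring

/-- By the transformation rule the first difference contributes `-log|j(z)| - log|j(i)|`, and the
halved one contributes `+log|j(i)|`; the base point drops out. -/
theorem re_uPlus (g : SL2) (z : ℍ) : (uPlus g z).re = -Real.log ‖autFactor g z‖ := by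
  have hc : ∀ z w : ℍ, (cFun z w).re = Real.log ‖(z : ℂ) - starRingEnd ℂ (w : ℂ)‖ := fun z w => by
    rw [cFun, Complex.log_re, norm_mul, norm_neg, Complex.norm_I, one_mul]
  have h2 : ∀ w : ℂ, (w / 2).re = w.re / 2 := fun w => by simp
  rw [uPlus, Complex.sub_re, Complex.sub_re, h2, Complex.sub_re, hc, hc, hc, hc,
    log_act_sub_conj_act, log_act_sub_conj_act]
  ring

variable {X : Type*} [MeasurableSpace X]

/-- The constant maps. -/
def HalfPlaneMaps.const (p : ℍ) : HalfPlaneMaps X :=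
  ⟨fun _ => p, measurable_const, Bornology.IsBounded.subset (t := {p}) Bornology.isBounded_singleton
    (by rintro _ ⟨x, rfl⟩; rfl)⟩

variable (m : Measure X) [IsProbabilityMeasure m]

theorem integrable_log_sub_conj (z w : HalfPlaneMaps X) :
    Integrable (fun x => Real.log ‖(z.1 x : ℂ) - starRingEnd ℂ (w.1 x : ℂ)‖) m := by
  obtain ⟨c₁, C₁, hc₁, h₁⟩ := z.exists_bounds
  obtain ⟨c₂, C₂, hc₂, h₂⟩ := w.exists_bounds
  have hlow : ∀ x, c₁ + c₂ ≤ ‖(z.1 x : ℂ) - starRingEnd ℂ (w.1 x : ℂ)‖ := fun x => by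
    refine le_trans ?_ (Complex.im_le_norm _)
    simp only [Complex.sub_im, Complex.conj_im, UpperHalfPlane.coe_im]
    linarith [(h₁ x).1, (h₂ x).1]
  have hup : ∀ x, ‖(z.1 x : ℂ) - starRingEnd ℂ (w.1 x : ℂ)‖ ≤ C₁ + C₂ := fun x =>
    (norm_sub_le _ _).trans (add_le_add (h₁ x).2 (by rw [Complex.norm_conj]; exact (h₂ x).2))
  have hm : Measurable fun x => (z.1 x : ℂ) - starRingEnd ℂ (w.1 x : ℂ) :=
    z.measurable_coe.sub (Complex.continuous_conj.measurable.comp w.measurable_coe)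
  refine Integrable.of_bound hm.norm.log.aestronglyMeasurable
    (max |Real.log (c₁ + c₂)| |Real.log (C₁ + C₂)|) (Eventually.of_forall fun x => ?_)
  exact abs_le_max_abs_abs (Real.log_le_log (by linarith) (hlow x))
    (Real.log_le_log (by linarith [hlow x]) (hup x))

/-- The diagonal case of the transformation rule writes the logarithm through two bounded maps into
the half-plane, from which its integrability follows. -/
theorem log_autFactor (g : currents X) (z : HalfPlaneMaps X) (x : X) :
    Real.log ‖autFactor (g.1 x) (z.1 x)‖
      = (Real.log ‖(z.1 x : ℂ) - starRingEnd ℂ (z.1 x : ℂ)‖ -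
        Real.log ‖((currentAct g z).1 x : ℂ) - starRingEnd ℂ ((currentAct g z).1 x : ℂ)‖) / 2 := by
  have h := log_act_sub_conj_act (g.1 x) (z.1 x) (z.1 x)
  change _ = (_ - Real.log ‖(act (g.1 x) (z.1 x) : ℂ) - starRingEnd ℂ (act (g.1 x) (z.1 x) : ℂ)‖) / 2
  linarith

theorem integrable_log_autFactor (g : currents X) (z : HalfPlaneMaps X) :
    Integrable (fun x => Real.log ‖autFactor (g.1 x) (z.1 x)‖) m := by
  simp only [log_autFactor]
  exact ((integrable_log_sub_conj m z z).sub (integrable_log_sub_conj m _ _)).div_const 2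

/-- The integral of `log |z - w̄|`. -/
def logSub (z w : HalfPlaneMaps X) : ℝ :=
  ∫ x, Real.log ‖(z.1 x : ℂ) - starRingEnd ℂ (w.1 x : ℂ)‖ ∂m

/-- The integral of `log |β z + α|`. -/
def logAut (g : currents X) (z : HalfPlaneMaps X) : ℝ :=
  ∫ x, Real.log ‖autFactor (g.1 x) (z.1 x)‖ ∂m

theorem logSub_comm (z w : HalfPlaneMaps X) : logSub m z w = logSub m w z := by
  refine integral_congr_ae (Eventually.of_forall fun x => ?_)
  simp only
  rw [← Complex.norm_conj, map_sub, Complex.conj_conj, norm_sub_rev]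

theorem logSub_act (g : currents X) (z w : HalfPlaneMaps X) :
    logSub m (currentAct g z) (currentAct g w) = logSub m z w - (logAut m g z + logAut m g w) := by
  have hadd : Integrable (fun x => Real.log ‖autFactor (g.1 x) (z.1 x)‖ +
      Real.log ‖autFactor (g.1 x) (w.1 x)‖) m :=
    (integrable_log_autFactor m g z).add (integrable_log_autFactor m g w)
  rw [logSub, logSub, logAut, logAut, ← integral_add (integrable_log_autFactor m g z)
    (integrable_log_autFactor m g w), ← integral_sub (integrable_log_sub_conj m z w) hadd]
  exact integral_congr_ae (Eventually.of_forall fun x => log_act_sub_conj_act _ _ _)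

theorem logAut_mul (g h : currents X) (z : HalfPlaneMaps X) :
    logAut m (g * h) z = logAut m g (currentAct h z) + logAut m h z := by
  rw [logAut, logAut, logAut, ← integral_add (integrable_log_autFactor m g _)
    (integrable_log_autFactor m h z)]
  refine integral_congr_ae (Eventually.of_forall fun x => ?_)
  change Real.log ‖autFactor (g.1 x * h.1 x) (z.1 x)‖
    = Real.log ‖autFactor (g.1 x) (act (h.1 x) (z.1 x))‖ + _
  rw [autFactor_mul, norm_mul, Real.log_mul (norm_ne_zero_iff.2 (autFactor_ne_zero _ _))
    (norm_ne_zero_iff.2 (autFactor_ne_zero _ _))]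

theorem logAut_one (z : HalfPlaneMaps X) : logAut m 1 z = 0 := by
  refine integral_eq_zero_of_ae (Eventually.of_forall fun x => ?_)
  simp [autFactor]

theorem currentAct_mul (g h : currents X) (z : HalfPlaneMaps X) :
    currentAct (g * h) z = currentAct g (currentAct h z) :=
  Subtype.ext (funext fun _ => act_mul _ _ _)

theorem currentAct_one (z : HalfPlaneMaps X) : currentAct 1 z = z :=
  Subtype.ext (funext fun _ => act_one _)

theorem abs_im_clog_le (w : ℂ) : |(Complex.log w).im| ≤ Real.pi := by
  rw [Complex.log_im]; exact Complex.abs_arg_le_pi w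

/-- The imaginary parts are arguments, bounded by `π`. Integrability of the complex function is
needed to take the real part inside the integral, which would otherwise have the default value `0`.
-/
theorem integrable_uPlus (g : currents X) (z : HalfPlaneMaps X) :
    Integrable (fun x => uPlus (g.1 x) (z.1 x)) m := by
  let i : HalfPlaneMaps X := HalfPlaneMaps.const UpperHalfPlane.I
  have hc : ∀ z w : HalfPlaneMaps X, Integrable (fun x => cFun (z.1 x) (w.1 x)) m := by
    intro z w
    have hm : Measurable fun x => cFun (z.1 x) (w.1 x) :=
      ((z.measurable_coe.sub (Complex.continuous_conj.measurable.comp w.measurable_coe)).const_mul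
        _).clog
    refine Integrable.mono' ((integrable_log_sub_conj m z w).norm.add (integrable_const Real.pi))
      hm.aestronglyMeasurable (Eventually.of_forall fun x => ?_)
    refine (Complex.norm_le_abs_re_add_abs_im _).trans (add_le_add (le_of_eq ?_) (abs_im_clog_le _))
    rw [cFun, Complex.log_re, norm_mul, norm_neg, Complex.norm_I, one_mul]
    rfl
  exact ((hc (currentAct g z) (currentAct g i)).sub (hc z i)).sub
    (((hc (currentAct g i) (currentAct g i)).sub (hc i i)).div_const 2)

theorem multiplier_eq (g : currents X) (z : HalfPlaneMaps X) :
    multiplier m g z = Real.exp (-logAut m g z / 2) := by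
  rw [multiplier, logAut, ← integral_neg]
  congr 2
  rw [← RCLike.re_eq_complex_re, ← integral_re (integrable_uPlus m g z)]
  exact integral_congr_ae (Eventually.of_forall fun x => re_uPlus _ _)

end LogIntegrals

/-! ### The one-particle space -/

section OneParticleSpace

variable {X : Type*} [MeasurableSpace X]

theorem HalfPlaneMaps.stronglyMeasurable (z : HalfPlaneMaps X) : StronglyMeasurable z.1 :=
  z.2.1.stronglyMeasurable

variable (m : Measure X) [IsProbabilityMeasure m]

theorem memLp_specialVec (z : HalfPlaneMaps X) : MemLp (fun x => specialVec (z.1 x)) 2 m := by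
  obtain ⟨C, hC⟩ := z.2.2.isCompact_closure.exists_bound_of_continuousOn
    continuous_specialVec.continuousOn
  exact MemLp.of_bound (continuous_specialVec.comp_stronglyMeasurable
    z.stronglyMeasurable).aestronglyMeasurable C
    (Eventually.of_forall fun x => hC _ (subset_closure ⟨x, rfl⟩))

/-- The field `x ↦ specialVec (z x)`. -/
def specialField (z : HalfPlaneMaps X) : OneParticle m := (memLp_specialVec m z).toLp _

theorem coeFn_specialField (z : HalfPlaneMaps X) :
    specialField m z =ᵐ[m] fun x => specialVec (z.1 x) := MemLp.coeFn_toLp _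

theorem inner_specialField (z w : HalfPlaneMaps X) :
    inner ℝ (specialField m z) (specialField m w) =
      -(logSub m z w - logSub m z (HalfPlaneMaps.const UpperHalfPlane.I) -
        logSub m w (HalfPlaneMaps.const UpperHalfPlane.I) +
        logSub m (HalfPlaneMaps.const UpperHalfPlane.I)
          (HalfPlaneMaps.const UpperHalfPlane.I)) / 2 := by
  let i : HalfPlaneMaps X := HalfPlaneMaps.const UpperHalfPlane.I
  have h1 := integrable_log_sub_conj m z w
  have h2 := integrable_log_sub_conj m z i
  have h3 := integrable_log_sub_conj m w i
  have h4 := integrable_log_sub_conj m i i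
  have h12 : Integrable (fun x => Real.log ‖(z.1 x : ℂ) - starRingEnd ℂ (w.1 x : ℂ)‖ -
    Real.log ‖(z.1 x : ℂ) - starRingEnd ℂ (i.1 x : ℂ)‖) m := h1.sub h2
  have h123 : Integrable (fun x => Real.log ‖(z.1 x : ℂ) - starRingEnd ℂ (w.1 x : ℂ)‖ -
    Real.log ‖(z.1 x : ℂ) - starRingEnd ℂ (i.1 x : ℂ)‖ -
    Real.log ‖(w.1 x : ℂ) - starRingEnd ℂ (i.1 x : ℂ)‖) m := h12.sub h3
  rw [logSub, logSub, logSub, logSub, ← integral_sub h1 h2, ← integral_sub h12 h3,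
    ← integral_add h123 h4, ← integral_neg, ← integral_div, L2.inner_def]
  refine integral_congr_ae ?_
  filter_upwards [coeFn_specialField m z, coeFn_specialField m w] with x e1 e2
  rw [e1, e2, inner_specialVec]
  have hi : (i.1 x : ℂ) = Complex.I := rfl
  have h5 : ‖Complex.I + Complex.I‖ = 2 := by
    rw [← two_mul, norm_mul, Complex.norm_I]; simp
  simp [hi, h5]

/-- On the vectors `specialVec p` the operators are explicit, so the dependence on `x` is measurable
there. Linear combinations, limits of vectors and then limits of simple functions give the general
case. -/
theorem stronglyMeasurable_specialOp (g : currents X) {v : X → Bergman}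
    (hv : StronglyMeasurable v) : StronglyMeasurable fun x => specialOp (g.1 x) (v x) := by
  have h1 : ∀ f : Bergman, StronglyMeasurable fun x => specialOp (g.1 x) f := by
    intro f
    obtain ⟨u, hu, huf⟩ := mem_closure_iff_seq_limit.1 (dense_span_specialVec f)
    refine stronglyMeasurable_of_tendsto atTop (f := fun n x => specialOp (g.1 x) (u n))
      (fun n => ?_) (tendsto_pi_nhds.2 fun x => ((specialOp (g.1 x)).continuous.tendsto f).comp huf)
    refine Submodule.span_induction
      (p := fun f _ => StronglyMeasurable fun x => specialOp (g.1 x) f) ?_ ?_ ?_ ?_ (hu n)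
    · rintro _ ⟨p, rfl⟩
      simp only [specialOp_specialVec]
      exact (continuous_specialVec.comp_stronglyMeasurable
        (currentAct g (HalfPlaneMaps.const p)).stronglyMeasurable).sub
        (continuous_specialVec.comp_stronglyMeasurable
        (currentAct g (HalfPlaneMaps.const UpperHalfPlane.I)).stronglyMeasurable)
    · simp only [map_zero]; exact stronglyMeasurable_const
    · intro a b _ _ ha hb
      simp only [map_add]
      exact ha.add hb
    · intro c a _ ha
      simp only [map_smul]
      exact ha.const_smul c
  have h2 : ∀ s : SimpleFunc X Bergman, StronglyMeasurable fun x => specialOp (g.1 x) (s x) := by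
    intro s
    induction s using SimpleFunc.induction with
    | @const c t hs =>
      have : (fun x => specialOp (g.1 x) ((SimpleFunc.piecewise t hs (SimpleFunc.const X c)
          (SimpleFunc.const X 0)) x)) = t.indicator fun x => specialOp (g.1 x) c := by
        funext x
        classical
        rw [SimpleFunc.coe_piecewise, SimpleFunc.coe_const, SimpleFunc.coe_const]
        simp only [Set.piecewise, Set.indicator, Function.const_apply]
        split_ifs <;> simp
      rw [this]
      exact (h1 c).indicator hs
    | add _ hf hf' =>
      simp only [SimpleFunc.coe_add, Pi.add_apply, map_add]
      exact hf.add hf'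
  exact stronglyMeasurable_of_tendsto atTop (fun n => h2 (hv.approx n))
    (tendsto_pi_nhds.2 fun x => ((specialOp (g.1 x)).continuous.tendsto _).comp
      (hv.tendsto_approx x))

theorem memLp_specialOp (g : currents X) (v : OneParticle m) :
    MemLp (fun x => specialOp (g.1 x) (v x)) 2 m := by
  refine (Lp.memLp v).congr_norm ?_ (Eventually.of_forall fun x =>
    ((specialOp (g.1 x)).norm_map _).symm)
  exact (stronglyMeasurable_specialOp g (Lp.stronglyMeasurable v)).aestronglyMeasurable

/-- The direct integral of the operators of the special representation. -/
def specialOpField (g : currents X) (v : OneParticle m) : OneParticle m :=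
  (memLp_specialOp m g v).toLp _

theorem coeFn_specialOpField (g : currents X) (v : OneParticle m) :
    specialOpField m g v =ᵐ[m] fun x => specialOp (g.1 x) (v x) := MemLp.coeFn_toLp _

theorem isSpecialAct_specialOpField (g : currents X) (v : OneParticle m) :
    IsSpecialAct m g v (specialOpField m g v) := by
  filter_upwards [coeFn_specialOpField m g v] with x hx
  rw [hx]
  exact coeFn_specialOp _ _

theorem isSpecialCocycle_specialField (g : currents X) : IsSpecialCocycle m g
    (specialField m (currentAct g (HalfPlaneMaps.const UpperHalfPlane.I))) := by
  filter_upwards [coeFn_specialField m (currentAct g (HalfPlaneMaps.const UpperHalfPlane.I))]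
    with x hx
  rw [hx, specialCocycle_eq]
  exact coeFn_specialLp (act _ _).im_pos

theorem inner_specialOpField (g : currents X) (v w : OneParticle m) :
    inner ℝ (specialOpField m g v) (specialOpField m g w) = inner ℝ v w := by
  rw [L2.inner_def, L2.inner_def]
  refine integral_congr_ae ?_
  filter_upwards [coeFn_specialOpField m g v, coeFn_specialOpField m g w] with x h1 h2
  rw [h1, h2, LinearIsometry.inner_map_map]

theorem specialOpField_specialField (g : currents X) (z : HalfPlaneMaps X) :
    specialOpField m g (specialField m z) + specialField m (currentAct g
      (HalfPlaneMaps.const UpperHalfPlane.I)) = specialField m (currentAct g z) := by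
  refine Lp.ext ((Lp.coeFn_add _ _).trans ?_)
  filter_upwards [coeFn_specialOpField m g (specialField m z), coeFn_specialField m z,
    coeFn_specialField m (currentAct g (HalfPlaneMaps.const UpperHalfPlane.I)),
    coeFn_specialField m (currentAct g z)] with x h1 h2 h3 h4
  rw [Pi.add_apply, h1, h2, h3, h4, specialOp_specialVec]
  exact sub_add_cancel _ _

/-- Step functions with values in the half-plane are bounded maps, and `specialVec` vanishes at `i`,
as the totality criterion for exponential vectors requires. -/
theorem eq_zero_of_inner_expVec_specialField [StandardBorelSpace X] [NullSingletonClass m]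
    {Φ : Fock (OneParticle m)} (h : ∀ z, inner ℝ (expVec (specialField m z)) Φ = 0) : Φ = 0 := by
  refine eq_zero_of_inner_expVec_step m (p₀ := UpperHalfPlane.I) specialVec_I
    dense_span_specialVec fun J _ _ _ τ hτ σ => ?_
  let z : HalfPlaneMaps X := ⟨fun x => σ (τ x), (measurable_of_countable σ).comp hτ,
    ((Set.finite_range σ).subset (by rintro _ ⟨x, rfl⟩; exact ⟨τ x, rfl⟩)).isBounded⟩
  exact h z

theorem dense_span_expVec_specialField [StandardBorelSpace X] [NullSingletonClass m] :
    Dense (Submodule.span ℝ (Set.range fun z => expVec (specialField m z)) :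
      Set (Fock (OneParticle m))) :=
  dense_span_of_inner_eq_zero fun _ h => eq_zero_of_inner_expVec_specialField m h

end OneParticleSpace

/-! ### The representation in the integral model and the Fock representation -/

section Gauss

variable {E : Type*} [NormedAddCommGroup E] [InnerProductSpace ℝ E]

/-- The prefactors cancel the terms `⟪v, b⟫ + ⟪w, b⟫ + ‖b‖²` of `⟪v + b, w + b⟫`, so translations
act isometrically. -/
theorem inner_expVec_add (b v w : E) :
    inner ℝ (Real.exp (-‖b‖ ^ 2 / 2 - inner ℝ v b) • expVec (v + b))
      (Real.exp (-‖b‖ ^ 2 / 2 - inner ℝ w b) • expVec (w + b)) = Real.exp (inner ℝ v w) := by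
  rw [real_inner_smul_left, real_inner_smul_right, inner_expVec, ← Real.exp_add, ← Real.exp_add,
    inner_add_left, inner_add_right, inner_add_right, real_inner_self_eq_norm_sq,
    real_inner_comm w b]
  congr 1
  ring

/-- A representation which acts on a total family of exponential vectors as the second
quantization of the affine action `v ↦ T g v + b g` is this second quantization. -/
theorem exists_fockRep {G H ι : Type*} [Group G] [NormedAddCommGroup H] [InnerProductSpace ℝ H]
    (T : G → E → E) (b : G → E) (hT : ∀ g v w, inner ℝ (T g v) (T g w) = inner ℝ v w)
    (U : G →* (H ≃ₗᵢ[ℝ] H)) (W : H ≃ₗᵢ[ℝ] Fock E) (F : ι → H) (e : ι → E) (c : ι → ℝ)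
    (hc : ∀ i, c i ≠ 0) (hW : ∀ i, W (F i) = c i • expVec (e i))
    (he : Dense (Submodule.span ℝ (Set.range fun i => expVec (e i)) : Set (Fock E)))
    (a : G → ι → ι) (μ : G → ι → ℝ) (hU : ∀ g i, U g (F i) = μ g i • F (a g i))
    (ha : ∀ g i, T g (e i) + b g = e (a g i))
    (hμ : ∀ g i, μ g i * c (a g i) =
      c i * Real.exp (inner ℝ (b g) (b g) / 2 - inner ℝ (e (a g i)) (b g))) :
    ∃ V : G →* (Fock E ≃ₗᵢ[ℝ] Fock E),
      (∀ g v, V g (expVec v) = Real.exp (-‖b g‖ ^ 2 / 2 - inner ℝ (T g v) (b g)) •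
        expVec (T g v + b g)) ∧ ∀ g x, W (U g x) = V g (W x) := by
  -- `V` is `U` transported by `W`. It is a homomorphism for this reason, and no cocycle identity
  -- for `T` and `b` has to be checked.
  let V : G →* (Fock E ≃ₗᵢ[ℝ] Fock E) :=
    { toFun := fun g => (W.symm.trans (U g)).trans W
      map_one' := LinearIsometryEquiv.ext fun Φ => by
        rw [map_one]
        exact W.apply_symm_apply Φ
      map_mul' := fun g h => LinearIsometryEquiv.ext fun Φ => by
        rw [map_mul]
        exact congrArg (fun x => W (U g x)) (W.symm_apply_apply _).symm }
  have hV : ∀ g x, W (U g x) = V g (W x) := fun g x =>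
    congrArg (fun x => W (U g x)) (W.symm_apply_apply x).symm
  refine ⟨V, fun g v => ?_, hV⟩
  -- The formula on all exponential vectors defines an isometry `L`. It then suffices to compare `V
  -- g` with `L` on the total family `expVec (e i)`.
  obtain ⟨L, hL⟩ := exists_isometry_of_gram (f := fun v : E => expVec v)
    (g := fun v => Real.exp (-‖b g‖ ^ 2 / 2 - inner ℝ (T g v) (b g)) • expVec (T g v + b g))
    (dense_span_of_inner_eq_zero fun _ h => eq_zero_of_inner_expVec h)
    (fun v w => by rw [inner_expVec_add, hT, inner_expVec])
  rw [← hL]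
  refine eq_of_eqOn_total he (A := (V g).toLinearEquiv.toLinearMap) (B := L.toLinearMap)
    (V g).continuous L.continuous (fun i => ?_) _
  change V g (expVec (e i)) = L (expVec (e i))
  have h1 : expVec (e i) = (c i)⁻¹ • W (F i) := by
    rw [hW, smul_smul, inv_mul_cancel₀ (hc i), one_smul]
  have h2 : -‖b g‖ ^ 2 / 2 - inner ℝ (T g (e i)) (b g)
      = inner ℝ (b g) (b g) / 2 - inner ℝ (e (a g i)) (b g) := by
    rw [← ha, inner_add_left, real_inner_self_eq_norm_sq]
    ring
  rw [hL, h2, ha, h1, map_smul, ← hV, hU, map_smul, hW, smul_smul, smul_smul, mul_assoc, hμ, ← mul_assoc,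
    inv_mul_cancel₀ (hc i), one_mul]

end Gauss

/-! ### The current group in the integral model and the intertwining isometry -/

section Representations

variable {X : Type*} [MeasurableSpace X] [StandardBorelSpace X] (m : Measure X)
  [IsProbabilityMeasure m] [NullSingletonClass m]

theorem inner_functionalLp_eq (z w : HalfPlaneMaps X) :
    inner ℝ (functionalLp m z) (functionalLp m w)
      = Real.exp (frullaniConst - logSub m z w / 2) := by
  rw [inner_functionalLp, logSub_comm]
  rfl

theorem multiplier_mul (g h : currents X) (z : HalfPlaneMaps X) :
    multiplier m (g * h) z = multiplier m h z * multiplier m g (currentAct h z) := by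
  rw [multiplier_eq, multiplier_eq, multiplier_eq, logAut_mul, ← Real.exp_add]
  congr 1
  ring

theorem multiplier_one (z : HalfPlaneMaps X) : multiplier m 1 z = 1 := by
  rw [multiplier_eq, logAut_one]
  simp

/-- Each multiplier is `exp(-½ ∫ log|j|)`, while passing to `gz` and `gw` multiplies the inner
product by `exp(½ ∫ (log|j(g,z)| + log|j(g,w)|))`. -/
theorem inner_multiplier_smul_functionalLp (g : currents X) (z w : HalfPlaneMaps X) :
    inner ℝ (multiplier m g z • functionalLp m (currentAct g z))
      (multiplier m g w • functionalLp m (currentAct g w))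
      = inner ℝ (functionalLp m z) (functionalLp m w) := by
  rw [real_inner_smul_left, real_inner_smul_right, inner_functionalLp_eq, inner_functionalLp_eq,
    multiplier_eq, multiplier_eq, logSub_act, ← Real.exp_add, ← Real.exp_add]
  congr 1
  ring

/-- The operators `F_z ↦ e^{½ Re ∫ u(g, z)} F_{gz}`. -/
def currentOp (g : currents X) : IntH0 m →ₗᵢ[ℝ] IntH0 m :=
  (exists_isometry_of_gram (dense_span_functionalLp m)
    (inner_multiplier_smul_functionalLp m g)).choose

theorem currentOp_functionalLp (g : currents X) (z : HalfPlaneMaps X) :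
    currentOp m g (functionalLp m z) = multiplier m g z • functionalLp m (currentAct g z) :=
  (exists_isometry_of_gram (dense_span_functionalLp m)
    (inner_multiplier_smul_functionalLp m g)).choose_spec z

theorem eq_currentOp (g : currents X) {A : IntH0 m →ₗ[ℝ] IntH0 m} (hA : Continuous A)
    (h : ∀ z, A (functionalLp m z) = multiplier m g z • functionalLp m (currentAct g z))
    (F : IntH0 m) : A F = currentOp m g F :=
  eq_of_eqOn_total (dense_span_functionalLp m) (B := (currentOp m g).toLinearMap) hA
    (currentOp m g).continuous (fun z => (h z).trans (currentOp_functionalLp m g z).symm) F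

theorem currentOp_mul (g h : currents X) (F : IntH0 m) :
    currentOp m (g * h) F = currentOp m g (currentOp m h F) := by
  refine (eq_currentOp m (g * h)
    (A := (currentOp m g).toLinearMap ∘ₗ (currentOp m h).toLinearMap)
    ((currentOp m g).continuous.comp (currentOp m h).continuous) (fun z => ?_) F).symm
  change currentOp m g (currentOp m h (functionalLp m z)) = _
  rw [currentOp_functionalLp, map_smul, currentOp_functionalLp, smul_smul, multiplier_mul,
    currentAct_mul]

theorem currentOp_one (F : IntH0 m) : currentOp m 1 F = F := by
  refine (eq_currentOp m 1 (A := LinearMap.id) continuous_id (fun z => ?_) F).symm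
  rw [multiplier_one, currentAct_one, one_smul]
  rfl

/-- The orthogonal representation of the current group in the integral model. -/
def currentRep : currents X →* (IntH0 m ≃ₗᵢ[ℝ] IntH0 m) where
  toFun g := LinearIsometryEquiv.ofSurjective (currentOp m g) fun F =>
    ⟨currentOp m g⁻¹ F, by rw [← currentOp_mul, mul_inv_cancel, currentOp_one]⟩
  map_one' := LinearIsometryEquiv.ext fun F => currentOp_one m F
  map_mul' g h := LinearIsometryEquiv.ext fun F => currentOp_mul m g h F

/-- The exponential vectors that correspond to the functionals `F_z`. -/
def fockVec (z : HalfPlaneMaps X) : Fock (OneParticle m) :=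
  Real.exp (frullaniConst / 2 + logSub m (HalfPlaneMaps.const UpperHalfPlane.I)
    (HalfPlaneMaps.const UpperHalfPlane.I) / 4 -
    logSub m z (HalfPlaneMaps.const UpperHalfPlane.I) / 2) • expVec (specialField m z)

/-- With `L = logSub`, the field has inner product `-½ (L(z,w) - L(z,i) - L(w,i) + L(i,i))`. The
scalars in `fockVec` are chosen to cancel the terms with the base point and to supply the constant
of the Gaussian integral. -/
theorem inner_fockVec (z w : HalfPlaneMaps X) :
    inner ℝ (fockVec m z) (fockVec m w) = inner ℝ (functionalLp m z) (functionalLp m w) := by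
  rw [fockVec, fockVec, real_inner_smul_left, real_inner_smul_right, inner_expVec,
    inner_specialField, inner_functionalLp_eq, ← Real.exp_add, ← Real.exp_add]
  congr 1
  ring

theorem dense_span_fockVec :
    Dense (Submodule.span ℝ (Set.range (fockVec m)) : Set (Fock (OneParticle m))) := by
  refine dense_span_of_inner_eq_zero fun Φ h =>
    eq_zero_of_inner_expVec_specialField m fun z => ?_
  have := h z
  rw [fockVec, real_inner_smul_left] at this
  exact (mul_eq_zero.1 this).resolve_left (Real.exp_pos _).ne'

/-- The isomorphism of the integral model with the Fock space. -/
def fockEquiv : IntH0 m ≃ₗᵢ[ℝ] Fock (OneParticle m) :=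
  (exists_isometryEquiv_of_gram (dense_span_functionalLp m) (dense_span_fockVec m)
    (inner_fockVec m)).choose

theorem fockEquiv_functionalLp (z : HalfPlaneMaps X) :
    fockEquiv m (functionalLp m z) = fockVec m z :=
  (exists_isometryEquiv_of_gram (dense_span_functionalLp m) (dense_span_fockVec m)
    (inner_fockVec m)).choose_spec z

/-- The cocycle of the one-particle representation. -/
def cocycleField (g : currents X) : OneParticle m :=
  specialField m (currentAct g (HalfPlaneMaps.const UpperHalfPlane.I))

theorem exists_isFockRep : ∃ V : currents X →*
    (Fock (OneParticle m) ≃ₗᵢ[ℝ] Fock (OneParticle m)), IsFockRep m V ∧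
    ∀ g F, fockEquiv m (currentRep m g F) = V g (fockEquiv m F) := by
  obtain ⟨V, h1, h2⟩ := exists_fockRep (specialOpField m) (cocycleField m)
    (inner_specialOpField m) (currentRep m) (fockEquiv m) (functionalLp m) (specialField m)
    (fun z => Real.exp (frullaniConst / 2 + logSub m (HalfPlaneMaps.const UpperHalfPlane.I)
      (HalfPlaneMaps.const UpperHalfPlane.I) / 4 -
      logSub m z (HalfPlaneMaps.const UpperHalfPlane.I) / 2))
    (fun _ => (Real.exp_pos _).ne') (fockEquiv_functionalLp m)
    (dense_span_expVec_specialField m) currentAct (multiplier m) (currentOp_functionalLp m)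
    (specialOpField_specialField m) (fun g z => by
      have h3 := logSub_act m g z (HalfPlaneMaps.const UpperHalfPlane.I)
      have h4 := logSub_act m g (HalfPlaneMaps.const UpperHalfPlane.I)
        (HalfPlaneMaps.const UpperHalfPlane.I)
      rw [cocycleField, inner_specialField, inner_specialField, multiplier_eq, ← Real.exp_add,
        ← Real.exp_add]
      congr 1
      linarith)
  exact ⟨V, fun g v => ⟨specialOpField m g v, cocycleField m g, isSpecialAct_specialOpField m g v,
    isSpecialCocycle_specialField m g, h1 g v⟩, h2⟩

end Representations

/-! ### The restriction to the triangular currents -/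

section Restriction

variable {X : Type*} [MeasurableSpace X]

theorem mul_eq_one_of_triangular {g : currents X} (hg : g ∈ triangularCurrents X) (x : X) :
    g.1 x 0 0 * g.1 x 1 1 = 1 := by
  have h := (g.1 x).det_coe
  rw [Matrix.det_fin_two] at h
  have h0 : g.1 x 0 1 = 0 := hg x
  rw [h0, zero_mul, sub_zero] at h
  exact h

theorem triangular_bounds {g : currents X} (hg : g ∈ triangularCurrents X) :
    ∃ c C : ℝ, 0 < c ∧ ∀ x, c ≤ |g.1 x 1 1| ∧ |g.1 x 1 1| ≤ C := by
  obtain ⟨-, C, hC⟩ := g.2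
  refine ⟨(|C| + 1)⁻¹, C, by positivity, fun x => ⟨?_, hC x 1 1⟩⟩
  have h1 : |g.1 x 0 0| * |g.1 x 1 1| = 1 := by
    rw [← abs_mul, mul_eq_one_of_triangular hg, abs_one]
  have h2 : |g.1 x 0 0| ≤ |C| + 1 := (hC x 0 0).trans ((le_abs_self C).trans (by linarith))
  rw [inv_le_iff_one_le_mul₀ (by positivity), mul_comm]
  exact h1.symm.le.trans (mul_le_mul_of_nonneg_right h2 (abs_nonneg _))

/-- A triangular matrix acts by `z ↦ δ² (z + γ/δ)`. The translation matches the phases of the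
unipotent part and the factor `δ²` the scaling of the squared weights by `|δ|`. -/
theorem coe_currentAct_of_triangular {g : currents X} (hg : g ∈ triangularCurrents X)
    (z : HalfPlaneMaps X) (x : X) : ((currentAct g z).1 x : ℂ) =
      ((|g.1 x 1 1| : ℝ) : ℂ) ^ 2 * ((g.1 x 1 0 / g.1 x 1 1 : ℝ) + z.1 x) := by
  have h0 : g.1 x 0 1 = 0 := hg x
  have h1 := mul_eq_one_of_triangular hg x
  have h3 : g.1 x 1 1 ≠ 0 := right_ne_zero_of_mul_eq_one h1
  have h4 : g.1 x 0 0 = (g.1 x 1 1)⁻¹ := eq_inv_of_mul_eq_one_left h1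
  have h5 : (g.1 x 1 1 : ℂ) ≠ 0 := Complex.ofReal_ne_zero.2 h3
  change (act (g.1 x) (z.1 x) : ℂ) = _
  rw [coe_act, h0, h4, ← Complex.ofReal_pow, sq_abs]
  push_cast
  field_simp
  ring

/-- The fibre maps of the operators of the representation `INT T⁰`. -/
def intT0Fiber (m : Measure X) (g : currents X) (ξ : Config X) : TensorH0 →L[ℝ] TensorH0 :=
  Real.exp ((∫ x, Real.log |g.1 x 1 1| ∂m) / 2) •
    ((tensPerm 1 norm_one (multPerm (fun x => |g.1 x 1 1|) ξ).symm).toContinuousLinearMap ∘L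
      (tensMap 1 norm_one fun k => rotT0 (multiplicator (fun x => |g.1 x 1 1|) ξ k).1
        (g.1 (multiplicator (fun x => |g.1 x 1 1|) ξ k).2 1 0 /
          g.1 (multiplicator (fun x => |g.1 x 1 1|) ξ k).2 1 1)).toContinuousLinearMap)

theorem intT0_eq (m : Measure X) (g : currents X) (F : Config X → TensorH0) (ξ : Config X) :
    intT0 m g F ξ = intT0Fiber m g ξ (F (multiplicator (fun x => |g.1 x 1 1|) ξ)) := rfl

theorem tensMap_rotT0_expTens {t : X → ℝ} {w : X → ℂ} {C : ℝ} (ht : ∀ x, |t x| ≤ C)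
    (hw : ∀ x, 0 ≤ (w x).im ∧ ‖w x‖ ≤ C) {ξ : Config X} (hξ : ξ ∈ l1plus X) :
    tensMap 1 norm_one (fun k => rotT0 (ξ k).1 (t (ξ k).2)) (expTens w ξ)
      = expTens (fun x => t x + w x) ξ := by
  have hr : ∀ (r s : ℝ) (u : ℂ), rotT0 r s u = Complex.exp (Complex.I * (r : ℂ) ^ 2 * s) * u := by
    intro r s u
    rw [rotT0, rotation_apply, Circle.coe_exp]
    push_cast
    congr 2
    ring
  have h1 : Summable fun k => ‖rotT0 (ξ k).1 (t (ξ k).2) 1 - 1‖ := by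
    simp only [hr, mul_one]
    exact summable_exp_sub_one (w := fun x => (t x : ℂ)) (C := C)
      (fun x => ⟨by simp, by rw [Complex.norm_real]; exact ht x⟩) hξ
  rw [expTens, tensMap_tens norm_one h1 (summable_exp_sub_one hw hξ), expTens]
  congr 1
  funext k
  rw [hr, ← Complex.exp_add]
  congr 1
  ring

theorem tensPerm_expTens_multiplicator {a : X → ℝ} {w : X → ℂ} {C : ℝ}
    (hw : ∀ x, 0 ≤ (w x).im ∧ ‖w x‖ ≤ C) {ξ : Config X} (hξ : multiplicator a ξ ∈ l1plus X) :
    tensPerm 1 norm_one (multPerm a ξ).symm (expTens w (multiplicator a ξ))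
      = expTens (fun x => (a x : ℂ) ^ 2 * w x) ξ := by
  rw [expTens, tensPerm_tens norm_one _ (summable_exp_sub_one hw hξ), expTens]
  congr 1
  funext k
  simp only [multiplicator, Equiv.apply_symm_apply]
  congr 1
  push_cast
  ring

variable (m : Measure X)

theorem logAut_of_triangular {g : currents X} (hg : g ∈ triangularCurrents X)
    (z : HalfPlaneMaps X) : logAut m g z = -∫ x, Real.log |g.1 x 1 1| ∂m := by
  rw [logAut, ← integral_neg]
  congr 1
  funext x
  have h0 : g.1 x 0 1 = 0 := hg x
  have h4 : g.1 x 0 0 = (g.1 x 1 1)⁻¹ :=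
    eq_inv_of_mul_eq_one_left (mul_eq_one_of_triangular hg x)
  rw [autFactor, h0, h4, Complex.ofReal_zero, zero_mul, zero_add, Complex.norm_real,
    norm_inv, Real.log_inv]
  rfl

variable [StandardBorelSpace X] [IsProbabilityMeasure m] [NullSingletonClass m]

theorem intT0_functional {g : currents X} (hg : g ∈ triangularCurrents X) (z : HalfPlaneMaps X) :
    ∀ᵐ ξ ∂(infLebesgue m), intT0 m g (functional z) ξ
      = multiplier m g z • functional (currentAct g z) ξ := by
  obtain ⟨c, C, hc, hac⟩ := triangular_bounds hg
  obtain ⟨D, hD⟩ := g.2.2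
  obtain ⟨c', C', hc', hz⟩ := z.exists_bounds
  have ha : Measurable fun x => |g.1 x 1 1| := (g.2.1 1 1).abs
  have ht : ∀ x, |g.1 x 1 0 / g.1 x 1 1| ≤ |D| / c := fun x => by
    rw [abs_div]
    exact div_le_div₀ (abs_nonneg _) ((hD x 1 0).trans (le_abs_self D)) hc (hac x).1
  filter_upwards [ae_mem_l1plus m, ae_scaled_weights_injective m ha
    fun x => hc.trans_le (hac x).1] with ξ hξ hinj
  have hmem := multiplicator_mem hc hac hξ hinj
  have h1 := tensMap_rotT0_expTens (t := fun x => g.1 x 1 0 / g.1 x 1 1)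
    (w := fun x => (z.1 x : ℂ)) (C := max (|D| / c) C') (fun x => (ht x).trans (le_max_left _ _))
    (fun x => ⟨(z.1 x).im_pos.le, (hz x).2.trans (le_max_right _ _)⟩) hmem
  have h2 := tensPerm_expTens_multiplicator (a := fun x => |g.1 x 1 1|)
    (w := fun x => ((g.1 x 1 0 / g.1 x 1 1 : ℝ) : ℂ) + z.1 x) (C := |D| / c + C') (fun x => by
      refine ⟨?_, (norm_add_le _ _).trans (add_le_add ?_ (hz x).2)⟩
      · rw [Complex.add_im, Complex.ofReal_im, zero_add]
        exact (z.1 x).im_pos.le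
      · rw [Complex.norm_real]
        exact ht x) hmem
  change Real.exp ((∫ x, Real.log |g.1 x 1 1| ∂m) / 2) • tensPerm 1 norm_one _
    (tensMap 1 norm_one _ (expTens (fun x => (z.1 x : ℂ)) _)) = _
  rw [h1, h2, multiplier_eq, logAut_of_triangular m hg, neg_neg, functional_eq]
  congr 2
  funext x
  exact (coe_currentAct_of_triangular hg z x).symm

theorem exists_subseq_tendsto_ae {α E : Type*} [MeasurableSpace α] {μ : Measure α}
    [NormedAddCommGroup E] {u : ℕ → Lp E 2 μ} {f : Lp E 2 μ} (h : Tendsto u atTop (nhds f)) :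
    ∃ φ : ℕ → ℕ, StrictMono φ ∧ ∀ᵐ x ∂μ, Tendsto (fun n => u (φ n) x) atTop (nhds (f x)) :=
  (tendstoInMeasure_of_tendsto_Lp h).exists_seq_tendsto_ae

/-- The formula holds on the functionals. Being an evaluation at the scaled configuration followed
by a continuous linear map of the fibre, it passes to the span and to limits, since the
multiplicator preserves almost sure statements. -/
theorem currentOp_ae_eq_intT0 {g : currents X} (hg : g ∈ triangularCurrents X) (F : IntH0 m) :
    currentOp m g F =ᵐ[infLebesgue m] intT0 m g F := by
  obtain ⟨c, C, hc, hac⟩ := triangular_bounds hg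
  have ha : Measurable fun x => |g.1 x 1 1| := (g.2.1 1 1).abs
  have hmult : ∀ {q : Config X → Prop}, (∀ᵐ ξ ∂(infLebesgue m), q ξ) →
      ∀ᵐ ξ ∂(infLebesgue m), q (multiplicator (fun x => |g.1 x 1 1|) ξ) :=
    fun hq => ae_multiplicator m ha hc hac hq
  have hspan : ∀ F ∈ Submodule.span ℝ (Set.range (functionalLp m)),
      currentOp m g F =ᵐ[infLebesgue m] intT0 m g F := by
    intro F hF
    refine Submodule.span_induction
      (p := fun F _ => currentOp m g F =ᵐ[infLebesgue m] intT0 m g F) ?_ ?_ ?_ ?_ hF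
    · rintro _ ⟨z, rfl⟩
      rw [currentOp_functionalLp]
      filter_upwards [intT0_functional m hg z, hmult (memLp_functional m z).coeFn_toLp,
        (memLp_functional m (currentAct g z)).coeFn_toLp,
        Lp.coeFn_smul (multiplier m g z) (functionalLp m (currentAct g z))] with ξ h1 h2 h3 h4
      rw [h4, Pi.smul_apply, functionalLp, h3, ← h1, intT0_eq, intT0_eq, functionalLp, h2]
    · rw [map_zero]
      filter_upwards [Lp.coeFn_zero TensorH0 2 (infLebesgue m),
        hmult (Lp.coeFn_zero TensorH0 2 (infLebesgue m))] with ξ h1 h2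
      rw [h1, intT0_eq, h2]
      exact (map_zero _).symm
    · intro F F' _ _ hF hF'
      rw [map_add]
      filter_upwards [hF, hF', Lp.coeFn_add (currentOp m g F) (currentOp m g F'),
        hmult (Lp.coeFn_add F F')] with ξ h1 h2 h3 h4
      rw [h3, Pi.add_apply, h1, h2, intT0_eq, intT0_eq, intT0_eq, h4, Pi.add_apply, map_add]
    · intro s F _ hF
      rw [map_smul]
      filter_upwards [hF, Lp.coeFn_smul s (currentOp m g F), hmult (Lp.coeFn_smul s F)]
        with ξ h1 h2 h3
      rw [h2, Pi.smul_apply, h1, intT0_eq, intT0_eq, h3, Pi.smul_apply, map_smul]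
  obtain ⟨u, hu, huF⟩ := mem_closure_iff_seq_limit.1 (dense_span_functionalLp m F)
  obtain ⟨φ, hφ, h1⟩ := exists_subseq_tendsto_ae huF
  have hUF : Tendsto (fun n => currentOp m g (u (φ n))) atTop (nhds (currentOp m g F)) :=
    ((currentOp m g).continuous.tendsto F).comp (huF.comp hφ.tendsto_atTop)
  -- The second subsequence is taken inside the first, so that the vectors and their images both
  -- converge almost everywhere.
  obtain ⟨ψ, hψ, h2⟩ := exists_subseq_tendsto_ae hUF
  have h3 : ∀ᵐ ξ ∂(infLebesgue m), ∀ n, currentOp m g (u n) ξ = intT0 m g (u n) ξ :=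
    ae_all_iff.2 fun n => hspan _ (hu n)
  filter_upwards [hmult h1, h2, h3] with ξ e1 e2 e3
  refine tendsto_nhds_unique e2 ?_
  simp only [e3, intT0_eq]
  exact ((intT0Fiber m g ξ).continuous.tendsto _).comp (e1.comp hψ.tendsto_atTop)

end Restriction

/-! ### The Laplace transform -/

section Laplace

variable {X : Type*} [MeasurableSpace X] [StandardBorelSpace X] (m : Measure X)
  [IsProbabilityMeasure m] [NullSingletonClass m]

theorem lintegral_laplace_infLebesgue {f : X → ℝ} (hf : Measurable f) {c C : ℝ} (hc : 0 < c)
    (hfc : ∀ x, c ≤ f x ∧ f x ≤ C) :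
    ∫⁻ ξ, ENNReal.ofReal (Real.exp (-∑' k, (ξ k).1 * f (ξ k).2)) ∂(infLebesgue m)
      = ENNReal.ofReal (Real.exp (-∫ x, Real.log (f x) ∂m)) := by
  obtain ⟨h1, h2⟩ := laplace_infLebesgue m hf hc hfc
  rw [← h2, ofReal_integral_eq_lintegral_ofReal h1
    (Eventually.of_forall fun _ => (Real.exp_pos _).le)]

end Laplace

end CurrentGroup

end

/-! ### The main theorem -/

theorem mainTheorem6 {X : Type*} [MeasurableSpace X] [StandardBorelSpace X]
    (m : Measure X) [IsProbabilityMeasure m] [NullSingletonClass m] :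
    -- the measure on the cone of discrete measures and its Laplace transform
    ((∀ᵐ ξ ∂(CurrentGroup.infLebesgue m), ξ ∈ CurrentGroup.l1plus X) ∧
      ∀ f : X → ℝ, Measurable f → (∃ c C : ℝ, 0 < c ∧ ∀ x, c ≤ f x ∧ f x ≤ C) →
        ∫⁻ ξ, ENNReal.ofReal (Real.exp (-∑' k, (ξ k).1 * f (ξ k).2))
            ∂(CurrentGroup.infLebesgue m)
          = ENNReal.ofReal (Real.exp (-∫ x, Real.log (f x) ∂m))) ∧
    -- the functionals lie in the space of the integral model
    ∃ hF : ∀ z : CurrentGroup.HalfPlaneMaps X,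
        MemLp (CurrentGroup.functional z) 2 (CurrentGroup.infLebesgue m),
    -- the operators extend to an orthogonal representation
    ∃ U : CurrentGroup.currents X →*
        (CurrentGroup.IntH0 m ≃ₗᵢ[ℝ] CurrentGroup.IntH0 m),
      (∀ g z, U g ((hF z).toLp _) = CurrentGroup.multiplier m g z •
        (hF (CurrentGroup.currentAct g z)).toLp _) ∧
      -- the extension of each operator is unique
      (∀ (g : CurrentGroup.currents X)
          (A : CurrentGroup.IntH0 m →L[ℝ] CurrentGroup.IntH0 m),
        (∀ z, A ((hF z).toLp _) = CurrentGroup.multiplier m g z •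
          (hF (CurrentGroup.currentAct g z)).toLp _) → ∀ F, A F = U g F) ∧
      -- the restriction to the triangular currents is the original representation
      (∀ g ∈ CurrentGroup.triangularCurrents X, ∀ F : CurrentGroup.IntH0 m,
        U g F =ᵐ[CurrentGroup.infLebesgue m] CurrentGroup.intT0 m g F) ∧
      -- the representation is equivalent to the Fock representation
      ∃ V : CurrentGroup.currents X →*
          (CurrentGroup.Fock (CurrentGroup.OneParticle m) ≃ₗᵢ[ℝ]
            CurrentGroup.Fock (CurrentGroup.OneParticle m)),
        CurrentGroup.IsFockRep m V ∧
        ∃ W : CurrentGroup.IntH0 m ≃ₗᵢ[ℝ] CurrentGroup.Fock (CurrentGroup.OneParticle m),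
          ∀ g F, W (U g F) = V g (W F) := by
  obtain ⟨V, hV, hW⟩ := CurrentGroup.exists_isFockRep m
  refine ⟨⟨CurrentGroup.ae_mem_l1plus m, fun f hf ⟨c, C, hc, hfc⟩ =>
    CurrentGroup.lintegral_laplace_infLebesgue m hf hc hfc⟩, CurrentGroup.memLp_functional m,
    CurrentGroup.currentRep m, CurrentGroup.currentOp_functionalLp m, fun g A hA F => ?_,
    fun g hg F => CurrentGroup.currentOp_ae_eq_intT0 m hg F, V, hV,
    CurrentGroup.fockEquiv m, hW⟩
  exact CurrentGroup.eq_currentOp m g (A := A.toLinearMap) A.continuous hA F
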